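/- **Setting.** For $\lambda>0$ and $(b,h),(b',h')\in(0,\infty)^2$ let $$p^{(\lambda)}((b,h),(b',h'))=\frac{4b'}{h'^2+\lambda^{-4/3}b'^2}\Big(b\Big(1-\lambda^{-4/3}\frac{b^2-b'^2}{h'^2}\Big)^{-1/2}-b'\Big)e^{-A}\,\mathbf 1_{S_{(b,h)}}(b',h'),$$ where $S_{(b,h)}=\{0<b'<b,\ \lambda^{-2/3}(b^2-b'^2)^{1/2}<h'<(h^2+\lambda^{-4/3}(b^2-b'^2))^{1/2}\}$ and $$A=\rho'^2\Big(\arctan\frac{\lambda^{1/3}b}{L'}-\frac{\lambda^{1/3}bL'}{\rho'^2}\Big)-(\lambda^2h^2+\lambda^{2/3}b^2)\Big(\arctan\frac{\lambda^{-2/3}b}{h}-\lambda^{-2/3}\frac bh\Big(1+\lambda^{-4/3}\frac{b^2}{h^2}\Big)^{-1}\Big),$$ with $\rho'^2=\lambda^2h'^2+\lambda^{2/3}b'^2$ and $L'=(\lambda^2h'^2-\lambda^{2/3}(b^2-b'^2))^{1/2}$. Let also $$p^{(\infty)}((b,h),(b',h'))=\frac{4(b-b')b'}{h'^2}\exp\Big(-\frac23b^3\Big(\frac1{h'}-\frac1h\Big)\Big)\mathbf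 1_{(0,b)\times(0,h)}(b',h').$$ The density $p^{(\infty)}((b,h),\cdot)$ is a probability density, while $p^{(\lambda)}((b,h),\cdot)$ has total mass less than $1$; the exact chain $(B^{(\lambda)}_n,H^{(\lambda)}_n)_n$ moves according to $p^{(\lambda)}$ and is sent to an absorbing cemetery state with the missing probability. The idealized chain $(B^{(\infty)}_n,H^{(\infty)}_n)_n$ moves according to $p^{(\infty)}$. **Initial law.** Put $\rho(r)=\lambda+\lambda^{-1/3}r$ and let $(R,\Theta_l,\Theta_c,\Theta_r)$ have density proportional to $$e^{-a(\lambda,\rho(r))}\,\lambda^{-7/3}\rho(r)^3\,\Delta\big(\tfrac{\lambda}{\rho(r)},\lambda^{-2/3}\theta\big),$$ where $a(v,\rho)=\rho^2[\arccos\frac v\rho-\frac v\rho(1-\frac{v^2}{\rho^2})^{1/2}]$ and, for $\varphi=(\varphi_l,\varphi_c,\varphi_r)$, $\Delta(\frac v\rho,\varphi)=2|\sin\frac{\varphi_c-\varphi_r}2\sin\frac{\varphi_r-\varphi_l}2\sin\frac{\varphi_c-\varphi_l}2|$ if $v<\rho$ and $-\arccos\frac v\rho<\varphi_l<\varphi_c<\varphi_r<\arccos\frac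 v\rho$, and $0$ otherwise. Let $V_0=(0,\lambda)$, and let $Z_l$, $Z_c$ be the points at distance $\rho(R)$ from $V_0$ in the directions making the angles $\lambda^{-2/3}\Theta_l$, $\lambda^{-2/3}\Theta_c$ with the downward vertical. Both chains start from the law of $$(B_0,H_0)=\Big(\tfrac{\lambda^{-1/3}}2\|Z_c-Z_l\|,\ \lambda^{-1}\,\mathrm d\big(V_0,\ Z_c+\mathbb R(Z_c-Z_l)\big)\Big).$$ **Coupling.** The two chains start from the same random point. As long as they have coincided at all times $0,\dots,n$, their states at time $n+1$, which given the past have the conditional laws prescribed by the two transition mechanisms, are chosen so as to coincide with the largest possible conditional probability, that is $\iint\min(p^{(\lambda)},p^{(\infty)})((B_n,H_n),(b',h'))\,db'\,dh'$. Once they have differed, the next states are drawn independently according to the two transition mechanisms. In all cases, given the joint past, each chain moves according to its own transition mechanism. For $\varepsilon_0>0$ let $\tau_\lambda(\varepsilon_0)=\inf\{n\ge1:\ B^{(\infty)}_n<\lambda^{(\varepsilon_0-1)/3}\}$ (with $\inf\emptyset=\infty$) and let $E^{(\lambda)}_{\mathrm{coupl}}(\varepsilon_0)$ be the event that $(B^{(\lambda)}_n,H^{(\lambda)}_n)=(B^{(\infty)}_n,H^{(\infty)}_n)$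 for every integer $n$ with $1\le n\le\tau_\lambda(\varepsilon_0)$. **Proposition.** For every $\lambda>0$ such a coupling exists. For any choice of such couplings, one for each $\lambda>0$, and for every $\varepsilon_0>0$, $$\lim_{\lambda\to\infty}\mathbb P\big[E^{(\lambda)}_{\mathrm{coupl}}(\varepsilon_0)\big]=1 .$$ -/

import Mathlib

open MeasureTheory Filter Topology
open scoped ENNReal

noncomputable section

namespace VoronoiChain

/-! ### The two transition densities -/

/-- The area of the difference of the two circular caps cut by the chord of half-length
`l ^ (1/3) * b`. -/
def capArea (l : ℝ) (x y : ℝ × ℝ) : ℝ :=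
  (l ^ 2 * y.2 ^ 2 + l ^ (2 / 3 : ℝ) * y.1 ^ 2) *
      (Real.arctan (l ^ (1 / 3 : ℝ) * x.1 /
          √(l ^ 2 * y.2 ^ 2 - l ^ (2 / 3 : ℝ) * (x.1 ^ 2 - y.1 ^ 2)))
        - l ^ (1 / 3 : ℝ) * x.1 / (l ^ 2 * y.2 ^ 2 + l ^ (2 / 3 : ℝ) * y.1 ^ 2)
          * √(l ^ 2 * y.2 ^ 2 - l ^ (2 / 3 : ℝ) * (x.1 ^ 2 - y.1 ^ 2)))
    - (l ^ 2 * x.2 ^ 2 + l ^ (2 / 3 : ℝ) * x.1 ^ 2) *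
      (Real.arctan (l ^ (-(2 / 3) : ℝ) * (x.1 / x.2))
        - l ^ (-(2 / 3) : ℝ) * (x.1 / x.2) *
          (1 + l ^ (-(4 / 3) : ℝ) * (x.1 ^ 2 / x.2 ^ 2))⁻¹)

/-- The admissible set `S_{(b,h)}` of the exact chain. -/
def admissible (l : ℝ) (x : ℝ × ℝ) : Set (ℝ × ℝ) :=
  {y | 0 < y.1 ∧ y.1 < x.1 ∧
    l ^ (-(2 / 3) : ℝ) * √(x.1 ^ 2 - y.1 ^ 2) < y.2 ∧
    y.2 < √(x.2 ^ 2 + l ^ (-(4 / 3) : ℝ) * (x.1 ^ 2 - y.1 ^ 2))}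

/-- The exact transition density `p^{(l)}(x, y)`, with `x = (b, h)` and `y = (b', h')`. -/
def exactDensity (l : ℝ) (x y : ℝ × ℝ) : ℝ :=
  (admissible l x).indicator
    (fun y => 4 * y.1 / (y.2 ^ 2 + l ^ (-(4 / 3) : ℝ) * y.1 ^ 2) *
      (x.1 * (√(1 - l ^ (-(4 / 3) : ℝ) * ((x.1 ^ 2 - y.1 ^ 2) / y.2 ^ 2)))⁻¹ - y.1) *
      Real.exp (-capArea l x y)) y

/-- The idealized transition density `p^{(∞)}(x, y)`. -/
def idealDensity (x y : ℝ × ℝ) : ℝ :=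
  (Set.Ioo 0 x.1 ×ˢ Set.Ioo 0 x.2).indicator
    (fun y => 4 * (x.1 - y.1) * y.1 / y.2 ^ 2 *
      Real.exp (-(2 / 3) * x.1 ^ 3 * (1 / y.2 - 1 / x.2))) y

/-! ### State spaces and transition kernels -/

/-- The open quadrant `(0, ∞)²`. -/
abbrev Quadrant : Type := {x : ℝ × ℝ // 0 < x.1 ∧ 0 < x.2}

/-- Lebesgue measure on the quadrant. -/
def quadrantVolume : Measure Quadrant := Measure.comap Subtype.val volume

/-- State space of the exact chain: the quadrant with a cemetery `Sum.inr ()`. The density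
`p^{(l)}(x, ·)` has total mass less than `1`; the missing mass is the probability of being
killed. -/
abbrev KilledState : Type := Quadrant ⊕ Unit

/-- The sub-probability `p^{(l)}(x, y) dy`. -/
def exactSubLaw (l : ℝ) (x : Quadrant) : Measure Quadrant :=
  quadrantVolume.withDensity fun y => ENNReal.ofReal (exactDensity l x y)

/-- One step of the exact chain, killed with the missing mass of `p^{(l)}`. -/
def exactStep (l : ℝ) : KilledState → Measure KilledState
  | Sum.inl x => (exactSubLaw l x).map Sum.inl
      + (1 - exactSubLaw l x Set.univ) • Measure.dirac (Sum.inr ())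
  | Sum.inr _ => Measure.dirac (Sum.inr ())

/-- One step of the idealized chain: `p^{(∞)}(x, y) dy`. -/
def idealStep (x : Quadrant) : Measure Quadrant :=
  quadrantVolume.withDensity fun y => ENNReal.ofReal (idealDensity x y)

/-- `∫ min(p^{(l)}(x, y), p^{(∞)}(x, y)) dy`, i.e. one minus the total variation distance of the
two one-step laws from `x`: the largest probability with which two variables having these laws
can coincide. -/
def overlap (l : ℝ) (x : Quadrant) : ℝ≥0∞ :=
  ∫⁻ y, ENNReal.ofReal (min (exactDensity l x y) (idealDensity x y)) ∂quadrantVolume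

/-! ### The common initial law -/

/-- Area of the part below the `x`-axis of a disk of radius `r` centred at height `v`. -/
def diskCapArea (v r : ℝ) : ℝ :=
  r ^ 2 * (Real.arccos (1 - (r - v) / r)
    - (1 - (r - v) / r) * √(2 * (r - v) / r - (r - v) ^ 2 / r ^ 2))

/-- The weight `Δ(v / ρ, (φ_l, φ_c, φ_r))`. -/
def simplexArea (v ρ φl φc φr : ℝ) : ℝ :=
  open Classical in
  if -Real.arccos (v / ρ) < φl ∧ φl < φc ∧ φc < φr ∧ φr < Real.arccos (v / ρ) ∧ v < ρ then
    2 * |Real.sin ((φc - φr) / 2) * Real.sin ((φr - φl) / 2) * Real.sin ((φc - φl) / 2)|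
  else 0

/-- The radius `l + l^{-1/3} r`. -/
def radius (l r : ℝ) : ℝ := l + l ^ (-(1 / 3) : ℝ) * r

/-- Unnormalized density of `(R, Θ_l, Θ_c, Θ_r)`. -/
def quadrupletWeight (l : ℝ) (q : ℝ × ℝ × ℝ × ℝ) : ℝ :=
  Real.exp (-diskCapArea l (radius l q.1)) * l ^ (-(7 / 3) : ℝ) * radius l q.1 ^ 3 *
    simplexArea l (radius l q.1) (l ^ (-(2 / 3) : ℝ) * q.2.1)
      (l ^ (-(2 / 3) : ℝ) * q.2.2.1) (l ^ (-(2 / 3) : ℝ) * q.2.2.2)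

/-- The law of `(R, Θ_l, Θ_c, Θ_r)`: the normalized weight. -/
def quadrupletLaw (l : ℝ) : Measure (ℝ × ℝ × ℝ × ℝ) :=
  (∫⁻ q, ENNReal.ofReal (quadrupletWeight l q))⁻¹ •
    volume.withDensity fun q => ENNReal.ofReal (quadrupletWeight l q)

/-- The vertex `(0, l)`. -/
def topVertex (l : ℝ) : EuclideanSpace ℝ (Fin 2) := !₂[0, l]

/-- The nucleus at distance `radius l r` from the vertex `(0, l)`, in the direction making the
angle `l^{-2/3} θ` with the downward vertical. -/
def nucleus (l r θ : ℝ) : EuclideanSpace ℝ (Fin 2) :=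
  !₂[radius l r * Real.sin (l ^ (-(2 / 3) : ℝ) * θ),
    l - radius l r * Real.cos (l ^ (-(2 / 3) : ℝ) * θ)]

/-- `(B_0, H_0)`: normalized half-basis and height of the triangle with apex `(0, l)` and basis
`[Z_l, Z_c]`. -/
def initialPair (l : ℝ) (q : ℝ × ℝ × ℝ × ℝ) : ℝ × ℝ :=
  (l ^ (-(1 / 3) : ℝ) / 2 * dist (nucleus l q.1 q.2.2.1) (nucleus l q.1 q.2.1),
    l⁻¹ * Metric.infDist (topVertex l)
      (Set.range fun t : ℝ => nucleus l q.1 q.2.2.1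
        + t • (nucleus l q.1 q.2.2.1 - nucleus l q.1 q.2.1)))

/-- The common initial law, i.e. the law of `(B_0, H_0)`. -/
def initialLaw (l : ℝ) : Measure (ℝ × ℝ) := (quadrupletLaw l).map (initialPair l)

/-! ### The coupling -/

/-- Trajectories of the pair (exact chain, idealized chain). -/
abbrev Path : Type := ℕ → KilledState × Quadrant

/-- The exact chain. -/
def exactChain (n : ℕ) (ω : Path) : KilledState := (ω n).1

/-- The idealized chain. -/
def idealChain (n : ℕ) (ω : Path) : Quadrant := (ω n).2

/-- The two chains coincide at time `n` (in particular the exact one has not been killed). -/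
def meet (n : ℕ) : Set Path := {ω | exactChain n ω = Sum.inl (idealChain n ω)}

/-- The events that depend on the two chains up to time `n` only. -/
@[reducible] def past (n : ℕ) : MeasurableSpace Path :=
  MeasurableSpace.comap (fun ω (k : Set.Iic n) => ω k) inferInstance

/-- The two chains coincide at all times `0, …, n`. -/
def meetUpTo (n : ℕ) : Set Path := {ω | ∀ k ≤ n, ω ∈ meet k}

/-- `P` is the joint law of the two coupled chains. Conditional probabilities given the past
`past n` are expressed by integrating over its events. -/
structure IsCoupling (l : ℝ) (P : Measure Path) : Prop where
  prob : IsProbabilityMeasure P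
  init_meet : ∀ᵐ ω ∂P, ω ∈ meet 0
  init_law : P.map (fun ω => (idealChain 0 ω : ℝ × ℝ)) = initialLaw l
  /-- Given the past, the exact chain moves according to `exactStep l`. -/
  exact_step : ∀ n A, MeasurableSet[past n] A → ∀ s, MeasurableSet s →
    P (A ∩ exactChain (n + 1) ⁻¹' s) = ∫⁻ ω in A, exactStep l (exactChain n ω) s ∂P
  /-- Given the past, the idealized chain moves according to `idealStep`. -/
  ideal_step : ∀ n A, MeasurableSet[past n] A → ∀ t, MeasurableSet t →
    P (A ∩ idealChain (n + 1) ⁻¹' t) = ∫⁻ ω in A, idealStep (idealChain n ω) t ∂P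
  /-- As long as the chains have always coincided, the next states coincide with the largest
  possible conditional probability. -/
  coupled_step : ∀ n A, MeasurableSet[past n] A → A ⊆ meetUpTo n →
    P (A ∩ meet (n + 1)) = ∫⁻ ω in A, overlap l (idealChain n ω) ∂P
  /-- Once the chains have differed, the next states are drawn independently. -/
  indep_step : ∀ n A, MeasurableSet[past n] A → Disjoint A (meetUpTo n) →
    ∀ s, MeasurableSet s → ∀ t, MeasurableSet t →
    P (A ∩ (exactChain (n + 1) ⁻¹' s ∩ idealChain (n + 1) ⁻¹' t)) =
      ∫⁻ ω in A, exactStep l (exactChain n ω) s * idealStep (idealChain n ω) t ∂P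

/-- The stopping time `τ = inf {n ≥ 1 : B_n^{(∞)} < l^{(ε₀ - 1)/3}}`, infinite if there is no
such `n`. -/
def stopTime (l ε₀ : ℝ) (ω : Path) : ℕ∞ :=
  sInf ((fun n : ℕ => (n : ℕ∞)) ''
    {n | 1 ≤ n ∧ (idealChain n ω : ℝ × ℝ).1 < l ^ ((ε₀ - 1) / 3)})

/-- The event that the two chains coincide at all times `1 ≤ n ≤ τ`. -/
def couplingEvent (l ε₀ : ℝ) : Set Path :=
  {ω | ∀ n : ℕ, 1 ≤ n → (n : ℕ∞) ≤ stopTime l ε₀ ω → ω ∈ meet n}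

end VoronoiChain

end

namespace VoronoiChain

/-! ### Calculus -/

/-! Write `l = k ^ 3` and `θ = l ^ ((ε₀ - 1) / 3)`.

Existence. The killing probability makes sense because the mass of the exact density can be
computed. With `t` the normalized distance from the new centre to the old chord in place of the new
height, the cap area `A` is a function of `t` alone (the starting point being fixed). The integral
over the new half-basis has an elementary primitive, and what remains is the `t`-derivative of `exp
(-A)`. The mass is thus one minus an exponential (`exactSubLaw_univ`). The one-step maximal coupling
puts the common part of the two laws on the diagonal and takes a normalized product of the two
excesses elsewhere. The Ionescu-Tulcea construction chains these steps, with independent moves after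
the first discrepancy.

Convergence. Comparing the densities factor by factor gives `p^∞ ≤ p^l + p^∞ * O(k⁻⁴ (b⁻⁴ + b⁵ /
h'³))` (`idealDensity_le`). After integration, the step from `(b, h)` fails to coincide with
probability at most `164 k⁻⁴ (b⁵ / h³ + b⁻⁴)` (`one_le_overlap_add`). It remains to sum these errors
along the idealized chain while its half-basis stays above `θ`.

The idealized step is explicit: given `(b, h)`, the variables `b'` and `h'` are independent, `b' /
b` is Beta(2, 2), and `1 / h' - 1 / h` is exponential of rate `2 b³ / 3`. Hence `b⁵ / h³` contracts
in mean up to a multiple of `b⁻⁴`. Above level `θ` one has `b⁻⁴ ≤ θ ^ (-4 - d) * b ^ d`, and `b ^ d`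
contracts by a factor at most `1 - 5 d / 12`. A combination of the two is a potential whose mean
decrease pays for the error of each step (`lintegral_potential_add_le`). By telescoping and a union
bound, the failure probability is at most the error of the initial step plus the initial mean
potential, which is of order `k⁻⁴ θ ^ (-4 - d)` and vanishes for `0 < d ≤ ε₀`.

The initial step is separate since `τ` ignores time `0`, so that `B_0` may lie below `θ`. Truncating
its error at one leaves the requirement that `E [1 + B_0⁵ + B_0⁻¹]` be bounded uniformly in `l ≥ 1`,
together with `H_0 ≥ 1`. Both come from the explicit weight: it decays exponentially in `r` and
contains a sine factor proportional to `B_0`, which absorbs the inverse moment. -/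

theorem lintegral_Ioo_deriv_of_nonneg {F f : ℝ → ℝ} {a b A B : ℝ} (hab : a < b)
    (hderiv : ∀ x ∈ Set.Ioo a b, HasDerivAt F (f x) x) (hf : ∀ x ∈ Set.Ioo a b, 0 ≤ f x)
    (ha : Tendsto F (𝓝[>] a) (𝓝 A)) (hb : Tendsto F (𝓝[<] b) (𝓝 B)) :
    ∫⁻ x in Set.Ioo a b, ENNReal.ofReal (f x) = ENNReal.ofReal (B - A) := by
  have hcont : ContinuousOn F (Set.Ioo a b) := fun x hx =>
    (hderiv x hx).continuousAt.continuousWithinAt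
  -- The one-sided limits extend `F` continuously to the closed interval; integrability of `f` then
  -- follows from its sign and need not be assumed.
  have hext := continuousOn_Icc_extendFrom_Ioo hcont ha hb
  have hint : IntegrableOn f (Set.Ioc a b) := by
    refine intervalIntegral.integrableOn_deriv_of_nonneg hext (fun x hx => ?_) hf
    refine (hderiv x hx).congr_of_eventuallyEq ?_
    filter_upwards [Ioo_mem_nhds hx.1 hx.2] with y hy
    exact extendFrom_extends hcont y hy
  have h := intervalIntegral.integral_eq_sub_of_hasDerivAt_of_tendsto hab hderiv
    ((intervalIntegrable_iff_integrableOn_Ioc_of_le hab.le).2 hint) ha hb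
  rw [← h, intervalIntegral.integral_of_le hab.le, integral_Ioc_eq_integral_Ioo,
    ofReal_integral_eq_lintegral_ofReal (hint.mono_set Set.Ioo_subset_Ioc_self)
      ((ae_restrict_iff' measurableSet_Ioo).2 (ae_of_all _ hf))]

theorem lintegral_Ioo_deriv_of_nonneg_of_continuous {F f : ℝ → ℝ} {a b : ℝ} (hab : a < b)
    (hderiv : ∀ x ∈ Set.Ioo a b, HasDerivAt F (f x) x) (hf : ∀ x ∈ Set.Ioo a b, 0 ≤ f x)
    (hF : ContinuousOn F (Set.Icc a b)) :
    ∫⁻ x in Set.Ioo a b, ENNReal.ofReal (f x) = ENNReal.ofReal (F b - F a) := by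
  refine lintegral_Ioo_deriv_of_nonneg hab hderiv hf ?_ ?_
  · exact ((hF a (Set.left_mem_Icc.2 hab.le)).mono_left
      (nhdsWithin_le_of_mem (mem_of_superset (Ioo_mem_nhdsGT hab) Set.Ioo_subset_Icc_self)))
  · exact ((hF b (Set.right_mem_Icc.2 hab.le)).mono_left
      (nhdsWithin_le_of_mem (mem_of_superset (Ioo_mem_nhdsLT hab) Set.Ioo_subset_Icc_self)))

theorem sub_cube_div_three_le_arctan {x : ℝ} (hx : 0 ≤ x) : x - x ^ 3 / 3 ≤ Real.arctan x := by
  have hd : ∀ y : ℝ, HasDerivAt (fun y => Real.arctan y - (y - y ^ 3 / 3))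
      (1 / (1 + y ^ 2) - (1 - y ^ 2)) y := by
    intro y
    refine ((Real.hasDerivAt_arctan y).sub ((hasDerivAt_id y).sub
      ((hasDerivAt_pow 3 y).div_const 3))).congr_deriv ?_
    norm_num
  have hmono : MonotoneOn (fun y => Real.arctan y - (y - y ^ 3 / 3)) (Set.Ici 0) := by
    refine monotoneOn_of_deriv_nonneg (convex_Ici 0)
      (fun y _ => (hd y).continuousAt.continuousWithinAt)
      (fun y _ => (hd y).differentiableAt.differentiableWithinAt) (fun y _ => ?_)
    rw [(hd y).deriv, div_sub' (by positivity)]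
    apply div_nonneg _ (by positivity)
    nlinarith [sq_nonneg (y ^ 2)]
  have := hmono Set.self_mem_Ici hx hx
  simp at this
  linarith

theorem arctan_le_self {x : ℝ} (hx : 0 ≤ x) : Real.arctan x ≤ x := by
  have hd : ∀ y : ℝ, HasDerivAt (fun y => y - Real.arctan y) (1 - 1 / (1 + y ^ 2)) y := fun y =>
    (hasDerivAt_id y).sub (Real.hasDerivAt_arctan y)
  have hmono : MonotoneOn (fun y => y - Real.arctan y) (Set.Ici 0) := by
    refine monotoneOn_of_deriv_nonneg (convex_Ici 0)
      (fun y _ => (hd y).continuousAt.continuousWithinAt)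
      (fun y _ => (hd y).differentiableAt.differentiableWithinAt) (fun y _ => ?_)
    rw [(hd y).deriv, sub_nonneg, div_le_one (by positivity)]
    nlinarith [sq_nonneg y]
  have := hmono Set.self_mem_Ici hx hx
  simp at this
  linarith

/-! ### The circular cap as a function of the height of its chord -/

/-- Area of the circular cap cut by a chord of half-length `β` at distance `L` from the centre. -/
noncomputable def circCap (β L : ℝ) : ℝ := (L ^ 2 + β ^ 2) * Real.arctan (β / L) - β * L

/-- The arctangent contributes exactly `-β`, which adds to the `-β` of the triangle. This simple
derivative is what the integration of the exact density over the half-basis reproduces. -/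
theorem hasDerivAt_circCap {β L : ℝ} (hL : L ≠ 0) :
    HasDerivAt (circCap β) (2 * (L * Real.arctan (β / L) - β)) L := by
  have h1 : HasDerivAt (fun L : ℝ => L ^ 2 + β ^ 2) (2 * L) L := by
    simpa using (hasDerivAt_pow 2 L).add_const (β ^ 2)
  have h2 : HasDerivAt (fun L : ℝ => β / L) (-β / L ^ 2) L := by
    simpa [div_eq_mul_inv] using (hasDerivAt_inv hL).const_mul β
  have h := (h1.mul h2.arctan).sub ((hasDerivAt_id L).const_mul β)
  refine h.congr_deriv ?_
  have : L ^ 2 + β ^ 2 ≠ 0 := by positivity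
  field_simp
  ring

/-- When the chord passes through the centre the cap is a half-disk. -/
theorem tendsto_circCap_zero {β : ℝ} (hβ : 0 < β) :
    Tendsto (circCap β) (𝓝[>] 0) (𝓝 (β ^ 2 * (Real.pi / 2))) := by
  have h1 : Tendsto (fun L : ℝ => β / L) (𝓝[>] 0) atTop :=
    tendsto_inv_nhdsGT_zero.const_mul_atTop hβ
  have h3 : Tendsto (fun L : ℝ => Real.arctan (β / L)) (𝓝[>] 0) (𝓝 (Real.pi / 2)) :=
    ((Real.tendsto_arctan_atTop).comp h1).mono_right nhdsWithin_le_nhds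
  have h4 : Tendsto (fun L : ℝ => L) (𝓝[>] 0) (𝓝 0) := tendsto_id.mono_left nhdsWithin_le_nhds
  have h5 : circCap β = fun L => (L ^ 2 + β ^ 2) * Real.arctan (β / L) - β * L := rfl
  rw [h5]
  simpa using (((h4.pow 2).add_const (β ^ 2)).mul h3).sub (h4.const_mul β)

theorem mul_arctan_div_le {β L : ℝ} (hβ : 0 ≤ β) (hL : 0 < L) : L * Real.arctan (β / L) ≤ β := by
  have := mul_le_mul_of_nonneg_left (arctan_le_self (x := β / L) (by positivity)) hL.le
  rwa [mul_div_cancel₀ _ hL.ne'] at this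

/-- By `x - x ^ 3 / 3 ≤ arctan x`, the derivative of the cap area is at least that of `2 / 3 * β ^ 3
/ L`. This is the source of the exponent of the idealized density. -/
theorem circCap_sub_le {β L η : ℝ} (hβ : 0 ≤ β) (hL : 0 < L) (hη : L ≤ η) :
    circCap β L - circCap β η ≤ 2 / 3 * β ^ 3 * (1 / L - 1 / η) := by
  have hd : ∀ y : ℝ, 0 < y → HasDerivAt (fun y => circCap β y - 2 / 3 * β ^ 3 * y⁻¹)
      (2 * (y * Real.arctan (β / y) - β) - 2 / 3 * β ^ 3 * (-(y ^ 2)⁻¹)) y := fun y hy =>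
    (hasDerivAt_circCap hy.ne').sub ((hasDerivAt_inv hy.ne').const_mul _)
  have hmono : MonotoneOn (fun y => circCap β y - 2 / 3 * β ^ 3 * y⁻¹) (Set.Ioi 0) := by
    refine monotoneOn_of_deriv_nonneg (convex_Ioi 0)
      (fun y hy => (hd y hy).continuousAt.continuousWithinAt)
      (fun y hy => (hd y (by simpa using hy)).differentiableAt.differentiableWithinAt)
      (fun y hy => ?_)
    have hy : 0 < y := by simpa using hy
    rw [(hd y hy).deriv]
    have := mul_le_mul_of_nonneg_left
      (sub_cube_div_three_le_arctan (x := β / y) (by positivity)) hy.le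
    have h2 : y * (β / y - (β / y) ^ 3 / 3) = β - β ^ 3 * (y ^ 2)⁻¹ / 3 := by
      field_simp
    linarith
  have := hmono (Set.mem_Ioi.2 hL) (Set.mem_Ioi.2 (hL.trans_le hη)) hη
  simp only [one_div]
  simp only at this
  linarith

/-! ### The exact density -/

/-- With `l = k ^ 3` every fractional power becomes an integral power of `k`, within reach of
`field_simp` and `ring`. -/
theorem rpow_thirds {k : ℝ} (hk : 0 < k) :
    (k ^ 3) ^ (1 / 3 : ℝ) = k ∧ (k ^ 3) ^ (2 / 3 : ℝ) = k ^ 2 ∧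
      (k ^ 3) ^ (-(1 / 3) : ℝ) = k⁻¹ ∧ (k ^ 3) ^ (-(2 / 3) : ℝ) = (k ^ 2)⁻¹ ∧
      (k ^ 3) ^ (-(4 / 3) : ℝ) = (k ^ 4)⁻¹ ∧ (k ^ 3) ^ (-(7 / 3) : ℝ) = (k ^ 7)⁻¹ := by
  have h : ∀ a : ℝ, (k ^ 3) ^ a = k ^ (3 * a) := fun a => by
    rw [← Real.rpow_natCast k 3, ← Real.rpow_mul hk.le]; norm_num
  refine ⟨?_, ?_, ?_, ?_, ?_, ?_⟩
  · rw [h]; norm_num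
  · rw [h, ← Real.rpow_natCast]; norm_num
  · rw [h, ← Real.rpow_neg_one]; norm_num
  · rw [h, ← Real.rpow_natCast, ← Real.rpow_neg hk.le]; norm_num
  · rw [h, ← Real.rpow_natCast, ← Real.rpow_neg hk.le]; norm_num
  · rw [h, ← Real.rpow_natCast, ← Real.rpow_neg hk.le]; norm_num

theorem exists_cube {l : ℝ} (hl : 0 < l) : ∃ k : ℝ, 0 < k ∧ l = k ^ 3 :=
  ⟨l ^ (1 / 3 : ℝ), by positivity, by
    rw [← Real.rpow_natCast, ← Real.rpow_mul hl.le]; norm_num⟩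

theorem mem_admissible {k : ℝ} (hk : 0 < k) {x y : ℝ × ℝ} (hx : 0 < x.1 ∧ 0 < x.2) :
    y ∈ admissible (k ^ 3) x ↔ 0 < y.1 ∧ y.1 < x.1 ∧ 0 < y.2 ∧
      0 < y.2 ^ 2 - (k ^ 4)⁻¹ * (x.1 ^ 2 - y.1 ^ 2) ∧
      y.2 ^ 2 - (k ^ 4)⁻¹ * (x.1 ^ 2 - y.1 ^ 2) < x.2 ^ 2 := by
  obtain ⟨-, -, -, h2, h4, -⟩ := rpow_thirds hk
  simp only [admissible, Set.mem_ofPred_eq, h2, h4]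
  constructor
  · rintro ⟨h1, h2, h3, h4⟩
    have hc : 0 < x.1 ^ 2 - y.1 ^ 2 := by nlinarith
    have hy : 0 < y.2 := lt_trans (by positivity) h3
    refine ⟨h1, h2, hy, ?_, ?_⟩
    · have := pow_lt_pow_left₀ h3 (by positivity) two_ne_zero
      rw [mul_pow, Real.sq_sqrt hc.le] at this
      rw [show (k ^ 4)⁻¹ = ((k ^ 2)⁻¹) ^ 2 by rw [inv_pow]; ring]
      linarith
    · rw [Real.lt_sqrt hy.le] at h4
      linarith
  · rintro ⟨h1, h2, hy, h3, h4⟩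
    have hc : 0 < x.1 ^ 2 - y.1 ^ 2 := by nlinarith
    refine ⟨h1, h2, ?_, ?_⟩
    · refine lt_of_pow_lt_pow_left₀ 2 hy.le ?_
      rw [mul_pow, Real.sq_sqrt hc.le, inv_pow]
      rw [show (k ^ 2) ^ 2 = k ^ 4 by ring]
      linarith
    · rw [Real.lt_sqrt hy.le]
      linarith

/-- The squared radius `ρ'²` equals `L'² + (k b)²`, so both caps are cut by the same chord of
half-length `k b`, at distances `L'` and `k ^ 3 * h` from the two centres. -/
theorem capArea_eq {k : ℝ} (hk : 0 < k) {x y : ℝ × ℝ} (hx : 0 < x.1 ∧ 0 < x.2)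
    (h : 0 < y.2 ^ 2 - (k ^ 4)⁻¹ * (x.1 ^ 2 - y.1 ^ 2)) :
    capArea (k ^ 3) x y =
      circCap (k * x.1) (k ^ 3 * √(y.2 ^ 2 - (k ^ 4)⁻¹ * (x.1 ^ 2 - y.1 ^ 2))) -
        circCap (k * x.1) (k ^ 3 * x.2) := by
  obtain ⟨h1, h2, -, h3, h4, -⟩ := rpow_thirds hk
  set t := √(y.2 ^ 2 - (k ^ 4)⁻¹ * (x.1 ^ 2 - y.1 ^ 2)) with ht
  have ht0 : 0 < t := Real.sqrt_pos.2 h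
  have ht2 : t ^ 2 = y.2 ^ 2 - (k ^ 4)⁻¹ * (x.1 ^ 2 - y.1 ^ 2) := Real.sq_sqrt h.le
  have hsq : (k ^ 3) ^ 2 * y.2 ^ 2 - k ^ 2 * (x.1 ^ 2 - y.1 ^ 2) = (k ^ 3 * t) ^ 2 := by
    rw [mul_pow, ht2]; field_simp
  have hR : (k ^ 3) ^ 2 * y.2 ^ 2 + k ^ 2 * y.1 ^ 2 = (k ^ 3 * t) ^ 2 + (k * x.1) ^ 2 := by
    rw [← hsq]; ring
  have hk3 : 0 < k ^ 3 * t := by positivity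
  obtain ⟨hx1, hx2⟩ := hx
  rw [capArea, h1, h2, h3, h4, hR, hsq, Real.sqrt_sq hk3.le, circCap, circCap,
    show (k ^ 2)⁻¹ * (x.1 / x.2) = k * x.1 / (k ^ 3 * x.2) by field_simp]
  have e1 : (1 + (k ^ 4)⁻¹ * (x.1 ^ 2 / x.2 ^ 2))⁻¹
      = (k ^ 3 * x.2) ^ 2 / ((k ^ 3 * x.2) ^ 2 + (k * x.1) ^ 2) := by
    field_simp
  rw [e1]
  have : (k ^ 3 * t) ^ 2 + (k * x.1) ^ 2 ≠ 0 := by positivity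
  field_simp

theorem exactDensity_nonneg {l : ℝ} (hl : 0 < l) {x : ℝ × ℝ} (hx : 0 < x.1 ∧ 0 < x.2)
    (y : ℝ × ℝ) : 0 ≤ exactDensity l x y := by
  obtain ⟨k, hk, rfl⟩ := exists_cube hl
  refine Set.indicator_nonneg (fun y hy => ?_) y
  obtain ⟨-, -, -, h2, h4, -⟩ := rpow_thirds hk
  rw [mem_admissible hk hx] at hy
  obtain ⟨h1, h2, h3, h5, -⟩ := hy
  have hc : 0 < x.1 ^ 2 - y.1 ^ 2 := by nlinarith
  rw [h4]
  have hpos : 0 < 1 - (k ^ 4)⁻¹ * ((x.1 ^ 2 - y.1 ^ 2) / y.2 ^ 2) := by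
    rw [← mul_div_assoc, sub_pos, div_lt_one (by positivity)]
    linarith
  have hle : √(1 - (k ^ 4)⁻¹ * ((x.1 ^ 2 - y.1 ^ 2) / y.2 ^ 2)) ≤ 1 := by
    rw [Real.sqrt_le_one]
    have : 0 < (k ^ 4)⁻¹ * ((x.1 ^ 2 - y.1 ^ 2) / y.2 ^ 2) := by positivity
    linarith
  have hinv : 1 ≤ (√(1 - (k ^ 4)⁻¹ * ((x.1 ^ 2 - y.1 ^ 2) / y.2 ^ 2)))⁻¹ :=
    (one_le_inv₀ (Real.sqrt_pos.2 hpos)).2 hle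
  have : y.1 ≤ x.1 * (√(1 - (k ^ 4)⁻¹ * ((x.1 ^ 2 - y.1 ^ 2) / y.2 ^ 2)))⁻¹ := by
    nlinarith
  have := sub_nonneg.2 this
  positivity

theorem idealDensity_nonneg (x y : ℝ × ℝ) : 0 ≤ idealDensity x y := by
  refine Set.indicator_nonneg (fun y hy => ?_) y
  obtain ⟨⟨h1, h2⟩, -, -⟩ := hy
  have := sub_pos.2 h2
  positivity

/-! ### Measurability -/

theorem measurableSet_and {α : Type*} [MeasurableSpace α] {p q : α → Prop}
    (hp : MeasurableSet {a | p a}) (hq : MeasurableSet {a | q a}) :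
    MeasurableSet {a | p a ∧ q a} := hp.inter hq

theorem measurable_capArea (l : ℝ) :
    Measurable fun p : (ℝ × ℝ) × (ℝ × ℝ) => capArea l p.1 p.2 := by
  unfold capArea
  fun_prop

theorem measurable_exactDensity (l : ℝ) :
    Measurable fun p : (ℝ × ℝ) × (ℝ × ℝ) => exactDensity l p.1 p.2 := by
  have h := measurable_capArea l
  have hs : MeasurableSet {p : (ℝ × ℝ) × (ℝ × ℝ) | p.2 ∈ admissible l p.1} := by
    simp only [admissible, Set.mem_ofPred_eq]
    refine measurableSet_and ?_ (measurableSet_and ?_ (measurableSet_and ?_ ?_)) <;>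
      exact measurableSet_lt (by fun_prop) (by fun_prop)
  have hf : Measurable fun p : (ℝ × ℝ) × (ℝ × ℝ) =>
      4 * p.2.1 / (p.2.2 ^ 2 + l ^ (-(4 / 3) : ℝ) * p.2.1 ^ 2) *
      (p.1.1 * (√(1 - l ^ (-(4 / 3) : ℝ) * ((p.1.1 ^ 2 - p.2.1 ^ 2) / p.2.2 ^ 2)))⁻¹ - p.2.1) *
      Real.exp (-capArea l p.1 p.2) := by fun_prop
  exact hf.indicator hs

theorem measurable_idealDensity :
    Measurable fun p : (ℝ × ℝ) × (ℝ × ℝ) => idealDensity p.1 p.2 := by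
  have hs : MeasurableSet {p : (ℝ × ℝ) × (ℝ × ℝ) |
      p.2 ∈ Set.Ioo 0 p.1.1 ×ˢ Set.Ioo 0 p.1.2} := by
    simp only [Set.mem_prod, Set.mem_Ioo]
    refine measurableSet_and (measurableSet_and ?_ ?_) (measurableSet_and ?_ ?_) <;>
      exact measurableSet_lt (by fun_prop) (by fun_prop)
  have hf : Measurable fun p : (ℝ × ℝ) × (ℝ × ℝ) => 4 * (p.1.1 - p.2.1) * p.2.1 / p.2.2 ^ 2 *
      Real.exp (-(2 / 3) * p.1.1 ^ 3 * (1 / p.2.2 - 1 / p.1.2)) := by fun_prop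
  exact hf.indicator hs

theorem measurable_exactDensity_coe (l : ℝ) :
    Measurable fun p : Quadrant × Quadrant => exactDensity l p.1 p.2 :=
  (measurable_exactDensity l).comp
    (f := fun p : Quadrant × Quadrant => ((p.1 : ℝ × ℝ), (p.2 : ℝ × ℝ))) (by fun_prop)

theorem measurable_idealDensity_coe :
    Measurable fun p : Quadrant × Quadrant => idealDensity p.1 p.2 :=
  measurable_idealDensity.comp
    (f := fun p : Quadrant × Quadrant => ((p.1 : ℝ × ℝ), (p.2 : ℝ × ℝ))) (by fun_prop)

theorem measurableSet_quadrant : MeasurableSet {x : ℝ × ℝ | 0 < x.1 ∧ 0 < x.2} :=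
  (measurableSet_lt measurable_const measurable_fst).inter
    (measurableSet_lt measurable_const measurable_snd)

instance : SigmaFinite quadrantVolume :=
  SigmaFinite.of_map _ measurable_subtype_coe.aemeasurable
    ((map_comap_subtype_coe measurableSet_quadrant volume).symm ▸ inferInstance)

instance : StandardBorelSpace Quadrant :=
  measurableSet_quadrant.standardBorel

/-! ### Integrals on the quadrant -/

theorem lintegral_quadrantVolume {f : ℝ × ℝ → ℝ≥0∞} (hf : Measurable f) :
    ∫⁻ y : Quadrant, f y ∂quadrantVolume =
      ∫⁻ b in Set.Ioi 0, ∫⁻ h in Set.Ioi 0, f (b, h) := by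
  have : {x : ℝ × ℝ | 0 < x.1 ∧ 0 < x.2} = Set.Ioi 0 ×ˢ Set.Ioi 0 := rfl
  rw [quadrantVolume]
  refine (lintegral_subtype_comap measurableSet_quadrant f).trans ?_
  rw [this, Measure.volume_eq_prod, ← Measure.prod_restrict, lintegral_prod _ hf.aemeasurable]

theorem setLIntegral_Ioi_eq_Ioo {f : ℝ → ℝ≥0∞} {a b : ℝ} (h : ∀ x, b ≤ x → f x = 0) :
    ∫⁻ x in Set.Ioi a, f x = ∫⁻ x in Set.Ioo a b, f x := by
  rw [← lintegral_indicator measurableSet_Ioi, ← lintegral_indicator measurableSet_Ioo]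
  congr 1 with x
  by_cases hx : x < b
  · simp [Set.indicator, hx]
  · simp [Set.indicator, h x (not_lt.1 hx), hx]

/-! ### Moments of the idealized step -/

theorem lintegral_idealStep (x : Quadrant) {f : Quadrant → ℝ≥0∞} (hf : Measurable f) :
    ∫⁻ y, f y ∂idealStep x =
      ∫⁻ y : Quadrant, ENNReal.ofReal (idealDensity x y) * f y ∂quadrantVolume := by
  rw [idealStep, lintegral_withDensity_eq_lintegral_mul _ _ hf]
  · rfl
  · exact (measurable_idealDensity_coe.comp measurable_prodMk_left).ennreal_ofReal

/-- The idealized density is a product of a function of `b'` and a function of `h'`. -/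
theorem lintegral_idealStep_mul (x : Quadrant) {φ ψ : ℝ → ℝ} (hφ : Measurable φ)
    (hψ : Measurable ψ) (hψ0 : ∀ t, 0 < t → 0 ≤ ψ t) (hφ0 : ∀ t, 0 < t → 0 ≤ φ t) :
    ∫⁻ y, ENNReal.ofReal (φ y.1.1 * ψ y.1.2) ∂idealStep x =
      (∫⁻ b in Set.Ioo 0 x.1.1, ENNReal.ofReal (4 * (x.1.1 - b) * b * φ b)) *
      ∫⁻ h in Set.Ioo 0 x.1.2, ENNReal.ofReal
        (ψ h / h ^ 2 * Real.exp (-(2 / 3) * x.1.1 ^ 3 * (1 / h - 1 / x.1.2))) := by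
  have hm : Measurable fun y : ℝ × ℝ =>
      ENNReal.ofReal (idealDensity x y) * ENNReal.ofReal (φ y.1 * ψ y.2) :=
    (measurable_idealDensity.comp (measurable_prodMk_left (x := (x : ℝ × ℝ)))).ennreal_ofReal.mul
      ((hφ.comp measurable_fst).mul (hψ.comp measurable_snd)).ennreal_ofReal
  have hm' : Measurable fun y : Quadrant => ENNReal.ofReal (φ y.1.1 * ψ y.1.2) := by fun_prop
  rw [lintegral_idealStep x hm', lintegral_quadrantVolume hm,
    setLIntegral_Ioi_eq_Ioo (b := x.1.1), ← lintegral_mul_const _ (by fun_prop)]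
  · refine setLIntegral_congr_fun measurableSet_Ioo (fun b hb => ?_)
    rw [setLIntegral_Ioi_eq_Ioo (b := x.1.2), ← lintegral_const_mul']
    · refine setLIntegral_congr_fun measurableSet_Ioo (fun h hh => ?_)
      have h1 := sub_pos.2 hb.2
      have h2 := hb.1
      have h3 := hφ0 b hb.1
      have h4 := hψ0 h hh.1
      rw [← ENNReal.ofReal_mul (idealDensity_nonneg _ _), ← ENNReal.ofReal_mul (by positivity),
        idealDensity, Set.indicator_of_mem (by exact ⟨hb, hh⟩)]
      congr 1
      ring
    · finiteness
    · intro h hh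
      rw [idealDensity, Set.indicator_of_notMem]
      · simp
      · rintro ⟨-, h1⟩
        exact absurd h1.2 (not_lt.2 hh)
  · intro b hb
    refine (lintegral_congr fun h => ?_).trans lintegral_zero
    rw [idealDensity, Set.indicator_of_notMem]
    · simp
    · rintro ⟨h1, -⟩
      exact absurd h1.2 (not_lt.2 hb)

theorem lintegral_beta {b p : ℝ} (hb : 0 < b) (hp : 0 ≤ p) :
    ∫⁻ t in Set.Ioo 0 b, ENNReal.ofReal (4 * (b - t) * t * t ^ p) =
      ENNReal.ofReal (4 * b ^ 3 * b ^ p / ((p + 2) * (p + 3))) := by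
  have hd : ∀ t : ℝ, t ∈ Set.Ioo 0 b → HasDerivAt
      (fun t : ℝ => 4 * (b * (t ^ (p + 2) / (p + 2)) - t ^ (p + 3) / (p + 3)))
      (4 * (b - t) * t * t ^ p) t := by
    intro t ht
    have h1 := (Real.hasDerivAt_rpow_const (x := t) (p := p + 2) (Or.inl ht.1.ne')).div_const (p + 2)
    have h2 := (Real.hasDerivAt_rpow_const (x := t) (p := p + 3) (Or.inl ht.1.ne')).div_const (p + 3)
    refine (((h1.const_mul b).sub h2).const_mul 4).congr_deriv ?_
    rw [show p + 2 - 1 = p + 1 by ring, show p + 3 - 1 = p + 1 + 1 by ring,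
      Real.rpow_add_one ht.1.ne', Real.rpow_add_one ht.1.ne']
    field_simp
    rw [Real.rpow_add_one ht.1.ne']
    ring
  rw [lintegral_Ioo_deriv_of_nonneg_of_continuous hb hd]
  · rw [Real.zero_rpow (by positivity), Real.zero_rpow (by positivity),
      Real.rpow_add hb, Real.rpow_add hb]
    congr 1
    norm_num
    field_simp
    ring
  · intro t ht
    have := sub_pos.2 ht.2
    have := ht.1
    positivity
  · have h1 := Real.continuous_rpow_const (q := p + 2) (by positivity)
    have h2 := Real.continuous_rpow_const (q := p + 3) (by positivity)
    fun_prop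

/-- In the variable `w = 1 / t` the weight is that of an exponential variable of rate `c` shifted by
`1 / h`. A solution of `Q' = c Q - q` yields the primitive `Q w * exp (-c w)` directly, without a
change of variables. -/
theorem lintegral_exp_inv {Q q : ℝ → ℝ} {c h : ℝ} (hh : 0 < h)
    (hQ : ∀ w, 0 < w → HasDerivAt Q (c * Q w - q w) w) (hq : ∀ w, 0 < w → 0 ≤ q w)
    (hlim : Tendsto (fun w => Q w * Real.exp (-c * w)) atTop (𝓝 0)) :
    ∫⁻ t in Set.Ioo 0 h, ENNReal.ofReal (q t⁻¹ / t ^ 2 * Real.exp (-c * (1 / t - 1 / h))) =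
      ENNReal.ofReal (Q h⁻¹) := by
  have hd : ∀ t : ℝ, 0 < t → HasDerivAt
      (fun t : ℝ => Q t⁻¹ * Real.exp (-c * (t⁻¹ - h⁻¹)))
      (q t⁻¹ / t ^ 2 * Real.exp (-c * (1 / t - 1 / h))) t := by
    intro t ht
    have h1 := hasDerivAt_inv ht.ne'
    have h2 := (hQ t⁻¹ (by positivity)).comp t h1
    refine (h2.mul ((h1.sub_const h⁻¹).const_mul (-c)).exp).congr_deriv ?_
    simp only [Function.comp_apply, one_div]
    field_simp
    ring
  rw [lintegral_Ioo_deriv_of_nonneg (A := 0) (B := Q h⁻¹) hh (fun t ht => hd t ht.1)]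
  · simp
  · intro t ht
    have := hq t⁻¹ (inv_pos.2 ht.1)
    positivity
  · have h1 := (hlim.comp tendsto_inv_nhdsGT_zero).mul_const (Real.exp (c * h⁻¹))
    rw [zero_mul] at h1
    refine h1.congr fun t => ?_
    simp only [Function.comp_apply, mul_assoc, ← Real.exp_add]
    ring_nf
  · have h1 := (hd h hh).continuousAt.tendsto.mono_left (nhdsWithin_le_nhds (s := Set.Iio h))
    simpa using h1

theorem tendsto_pow_mul_exp_neg {c : ℝ} (hc : 0 < c) (n : ℕ) :
    Tendsto (fun w : ℝ => w ^ n * Real.exp (-c * w)) atTop (𝓝 0) := by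
  have := tendsto_exp_mul_div_rpow_atTop n c hc
  refine this.inv_tendsto_atTop.congr fun w => ?_
  rw [Pi.inv_apply, inv_div, Real.rpow_natCast, neg_mul, Real.exp_neg, div_eq_mul_inv]

/-- The ratio `b' / b` has the Beta(2, 2) density `6 u (1 - u)`, whose moment of order `p` is `6 /
((p + 2) (p + 3))`. -/
theorem lintegral_idealStep_rpow (x : Quadrant) {p : ℝ} (hp : 0 ≤ p) :
    ∫⁻ y, ENNReal.ofReal (y.1.1 ^ p) ∂idealStep x =
      ENNReal.ofReal (6 / ((p + 2) * (p + 3)) * x.1.1 ^ p) := by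
  obtain ⟨⟨b, h⟩, hb, hh⟩ := x
  simp only at hb hh
  have hc : 0 < 2 / 3 * b ^ 3 := by positivity
  have h1 := lintegral_idealStep_mul ⟨(b, h), hb, hh⟩ (φ := fun t => t ^ p) (ψ := fun _ => 1)
    (by fun_prop) (by fun_prop) (fun _ _ => zero_le_one) (fun t ht => by positivity)
  have h2 := lintegral_exp_inv (Q := fun _ => 1 / (2 / 3 * b ^ 3)) (q := fun _ => 1)
    (c := 2 / 3 * b ^ 3) hh (fun w _ => by
      refine (hasDerivAt_const w _).congr_deriv ?_
      field_simp
      ring) (fun _ _ => zero_le_one) (by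
      have := (tendsto_pow_mul_exp_neg hc 0).const_mul (1 / (2 / 3 * b ^ 3))
      simpa only [pow_zero, one_mul, mul_zero] using this)
  simp only [neg_mul] at h1 h2
  simp only [h2, lintegral_beta hb hp, mul_one] at h1 ⊢
  rw [h1, ← ENNReal.ofReal_mul (by positivity)]
  congr 1
  field_simp
  ring

/-- The third moment of `1 / h` plus an exponential variable of rate `c = 2 b³ / 3` is explicit; its
mixed terms are split so that only `h⁻³` and `c⁻³ = 27 / 8 * b⁻⁹` remain. -/
theorem lintegral_idealStep_rpow_mul_inv_cube_le (x : Quadrant) {p : ℝ} (hp : 0 ≤ p) :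
    ∫⁻ y, ENNReal.ofReal (y.1.1 ^ p * y.1.2⁻¹ ^ 3) ∂idealStep x ≤
      ENNReal.ofReal (6 / ((p + 2) * (p + 3)) * x.1.1 ^ p *
        (5 * x.1.2⁻¹ ^ 3 + 40 * x.1.1⁻¹ ^ 9)) := by
  obtain ⟨⟨b, h⟩, hb, hh⟩ := x
  simp only at hb hh
  set c := 2 / 3 * b ^ 3 with hcdef
  have hc : 0 < c := by positivity
  have h1 := lintegral_idealStep_mul ⟨(b, h), hb, hh⟩ (φ := fun t => t ^ p)
    (ψ := fun t => t⁻¹ ^ 3)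
    (by fun_prop) (by fun_prop) (fun t ht => by positivity) (fun t ht => by positivity)
  have h2 := lintegral_exp_inv
    (Q := fun w => c⁻¹ * (w ^ 3 + 3 * c⁻¹ * w ^ 2 + 6 * c⁻¹ ^ 2 * w + 6 * c⁻¹ ^ 3))
    (q := fun w => w ^ 3) (c := c) hh (fun w _ => by
      refine (((((hasDerivAt_pow 3 w).add ((hasDerivAt_pow 2 w).const_mul (3 * c⁻¹))).add
        ((hasDerivAt_id w).const_mul (6 * c⁻¹ ^ 2))).add_const (6 * c⁻¹ ^ 3)).const_mul
          c⁻¹).congr_deriv ?_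
      field_simp
      ring) (fun w hw => by positivity) (by
      have h0 := tendsto_pow_mul_exp_neg hc
      have := ((((h0 3).add ((h0 2).const_mul (3 * c⁻¹))).add
        ((h0 1).const_mul (6 * c⁻¹ ^ 2))).add ((h0 0).const_mul (6 * c⁻¹ ^ 3))).const_mul c⁻¹
      simp only [mul_zero, add_zero] at this
      refine this.congr fun w => ?_
      ring)
  simp only [neg_mul, ← hcdef] at h1 h2
  simp only [h2, lintegral_beta hb hp] at h1 ⊢
  rw [h1, ← ENNReal.ofReal_mul (by positivity)]
  refine ENNReal.ofReal_le_ofReal ?_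
  have hw : 0 < h⁻¹ := by positivity
  have hc0 : 0 < c⁻¹ := by positivity
  have hc3 : c⁻¹ ^ 3 = 27 / 8 * b⁻¹ ^ 9 := by rw [hcdef]; field_simp; norm_num
  have hp1 : 0 < b ^ p := by positivity
  have e1 : 4 * b ^ 3 * b ^ p / ((p + 2) * (p + 3)) *
      (c⁻¹ * (h⁻¹ ^ 3 + 3 * c⁻¹ * h⁻¹ ^ 2 + 6 * c⁻¹ ^ 2 * h⁻¹ + 6 * c⁻¹ ^ 3)) =
      6 / ((p + 2) * (p + 3)) * b ^ p *
        (h⁻¹ ^ 3 + 3 * c⁻¹ * h⁻¹ ^ 2 + 6 * c⁻¹ ^ 2 * h⁻¹ + 6 * c⁻¹ ^ 3) := by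
    have : 4 * b ^ 3 * c⁻¹ = 6 := by rw [hcdef]; field_simp; norm_num
    rw [← this]; ring
  rw [e1]
  refine mul_le_mul_of_nonneg_left ?_ (by positivity)
  generalize h⁻¹ = w at *
  generalize c⁻¹ = m at *
  -- Weighted arithmetic-geometric means. The total is `5 w³ + 11 m³`, and `11 * 27 / 8 ≤ 40`.
  have i1 : m * w ^ 2 ≤ (2 * w ^ 3 + m ^ 3) / 3 := by
    nlinarith [mul_nonneg (add_nonneg hw.le hw.le) (sq_nonneg (w - m)),
      mul_nonneg hc0.le (sq_nonneg (w - m))]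
  have i2 : m ^ 2 * w ≤ (w ^ 3 + 2 * m ^ 3) / 3 := by
    nlinarith [mul_nonneg hw.le (sq_nonneg (w - m)), mul_nonneg hc0.le (sq_nonneg (w - m))]
  have : 0 < b⁻¹ ^ 9 := by positivity
  linarith

theorem idealStep_univ (x : Quadrant) : idealStep x Set.univ = 1 := by
  have := lintegral_idealStep_rpow x le_rfl
  simp only [Real.rpow_zero, ENNReal.ofReal_one, lintegral_one] at this
  rw [this]
  norm_num

instance (x : Quadrant) : IsProbabilityMeasure (idealStep x) := ⟨idealStep_univ x⟩

theorem ae_idealStep_lt (x : Quadrant) : ∀ᵐ y ∂idealStep x, y.1.1 < x.1.1 := by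
  have hm : Measurable fun y : Quadrant => ENNReal.ofReal (idealDensity x y) :=
    (measurable_idealDensity_coe.comp measurable_prodMk_left).ennreal_ofReal
  rw [idealStep, ae_withDensity_iff hm]
  refine ae_of_all _ fun y hy => ?_
  by_contra hlt
  refine hy ?_
  rw [idealDensity, Set.indicator_of_notMem, ENNReal.ofReal_zero]
  rintro ⟨h1, -⟩
  exact hlt h1.2

/-! ### The total mass of the exact density -/

/-- The exact density in the coordinates `(b', t)`, where `t` is the normalized distance from the
new centre to the old chord. -/
noncomputable def chordDensity (k b h b' t : ℝ) : ℝ :=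
  4 * b' / (t ^ 2 + (k ^ 4)⁻¹ * b ^ 2) * (b - b' * (t / √(t ^ 2 + (k ^ 4)⁻¹ * (b ^ 2 - b' ^ 2)))) *
    Real.exp (-(circCap (k * b) (k ^ 3 * t) - circCap (k * b) (k ^ 3 * h)))

theorem image_sqrt_add {c h : ℝ} (hc : 0 < c) (hh : 0 < h) :
    (fun t => √(t ^ 2 + c)) '' Set.Ioo 0 h = Set.Ioo √c √(h ^ 2 + c) := by
  ext s
  constructor
  · rintro ⟨t, ⟨h1, h2⟩, rfl⟩
    exact ⟨Real.sqrt_lt_sqrt hc.le (by nlinarith), Real.sqrt_lt_sqrt (by positivity) (by nlinarith)⟩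
  · rintro ⟨h1, h2⟩
    have hs : 0 < s := (Real.sqrt_pos.2 hc).trans h1
    rw [Real.sqrt_lt' hs] at h1
    rw [Real.lt_sqrt hs.le] at h2
    refine ⟨√(s ^ 2 - c), ⟨Real.sqrt_pos.2 (by linarith), ?_⟩, ?_⟩
    · rw [Real.sqrt_lt' hh]
      linarith
    · simp only
      rw [Real.sq_sqrt (by linarith), sub_add_cancel, Real.sqrt_sq hs.le]

/-- The factor `t / h'` is the Jacobian of `h'² = t² + k⁻⁴ (b² - b'²)`. In these coordinates the
inverse square root becomes `h' / t`, while the denominator and the cap area no longer depend on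
`b'`. -/
theorem exactDensity_chord {k b h b' t : ℝ} (hk : 0 < k) (hb : 0 < b) (hh : 0 < h) (hb' : 0 < b')
    (hbb : b' < b) (ht : 0 < t) (hth : t < h) :
    t / √(t ^ 2 + (k ^ 4)⁻¹ * (b ^ 2 - b' ^ 2)) *
      exactDensity (k ^ 3) (b, h) (b', √(t ^ 2 + (k ^ 4)⁻¹ * (b ^ 2 - b' ^ 2))) =
    chordDensity k b h b' t := by
  obtain ⟨-, -, -, -, h4, -⟩ := rpow_thirds hk
  set c := (k ^ 4)⁻¹ * (b ^ 2 - b' ^ 2) with hcdef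
  have hb2 : 0 < b ^ 2 - b' ^ 2 := by nlinarith
  have hc : 0 < c := by positivity
  set s := √(t ^ 2 + c) with hs
  have hs0 : 0 < s := Real.sqrt_pos.2 (by positivity)
  have hs2 : s ^ 2 = t ^ 2 + c := Real.sq_sqrt (by positivity)
  have hsc : s ^ 2 - c = t ^ 2 := by rw [hs2]; ring
  have hmem : ((b', s) : ℝ × ℝ) ∈ admissible (k ^ 3) (b, h) := by
    rw [mem_admissible hk ⟨hb, hh⟩]
    simp only
    rw [← hcdef, hsc]
    exact ⟨hb', hbb, hs0, by positivity, by nlinarith⟩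
  have hA := capArea_eq hk (x := (b, h)) (y := (b', s)) ⟨hb, hh⟩ (by
    simp only
    rw [← hcdef, hsc]
    positivity)
  simp only [← hcdef, hsc, Real.sqrt_sq ht.le] at hA
  rw [exactDensity, Set.indicator_of_mem hmem]
  simp only [h4, hA]
  have e1 : 1 - (k ^ 4)⁻¹ * ((b ^ 2 - b' ^ 2) / s ^ 2) = (t / s) ^ 2 := by
    rw [← mul_div_assoc, ← hcdef, div_pow, one_sub_div (by positivity), hsc]
  have e2 : s ^ 2 + (k ^ 4)⁻¹ * b' ^ 2 = t ^ 2 + (k ^ 4)⁻¹ * b ^ 2 := by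
    rw [hs2, hcdef]; ring
  rw [e1, e2, Real.sqrt_sq (by positivity), chordDensity, ← hcdef, ← hs]
  have : t ^ 2 + (k ^ 4)⁻¹ * b ^ 2 ≠ 0 := by positivity
  field_simp

theorem lintegral_exactDensity_height {k b h b' : ℝ} (hk : 0 < k) (hb : 0 < b) (hh : 0 < h)
    (hb' : 0 < b') (hbb : b' < b) :
    ∫⁻ s in Set.Ioi 0, ENNReal.ofReal (exactDensity (k ^ 3) (b, h) (b', s)) =
      ∫⁻ t in Set.Ioo 0 h, ENNReal.ofReal (chordDensity k b h b' t) := by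
  set c := (k ^ 4)⁻¹ * (b ^ 2 - b' ^ 2) with hcdef
  have hb2 : 0 < b ^ 2 - b' ^ 2 := by nlinarith
  have hc : 0 < c := by positivity
  have h1 : ∫⁻ s in Set.Ioi 0, ENNReal.ofReal (exactDensity (k ^ 3) (b, h) (b', s)) =
      ∫⁻ s in (fun t => √(t ^ 2 + c)) '' Set.Ioo 0 h,
        ENNReal.ofReal (exactDensity (k ^ 3) (b, h) (b', s)) := by
    rw [image_sqrt_add hc hh, ← lintegral_indicator measurableSet_Ioi,
      ← lintegral_indicator measurableSet_Ioo]
    congr 1 with s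
    by_cases hs : s ∈ Set.Ioo √c √(h ^ 2 + c)
    · have : 0 < s := (Real.sqrt_pos.2 hc).trans hs.1
      simp [Set.indicator, this, hs.1, hs.2]
    · rw [Set.indicator_of_notMem hs]
      rw [Set.indicator_apply_eq_zero]
      intro _
      rw [exactDensity, Set.indicator_of_notMem, ENNReal.ofReal_zero]
      rw [mem_admissible hk ⟨hb, hh⟩]
      rintro ⟨-, -, h2, h3, h4⟩
      simp only [← hcdef] at h2 h3 h4
      exact hs ⟨(Real.sqrt_lt' h2).2 (by linarith), (Real.lt_sqrt h2.le).2 (by linarith)⟩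
  rw [h1, lintegral_image_eq_lintegral_abs_deriv_mul measurableSet_Ioo
    (f' := fun t => t / √(t ^ 2 + c))]
  · refine setLIntegral_congr_fun measurableSet_Ioo (fun t ht => ?_)
    have ht0 := ht.1
    rw [abs_of_nonneg (by positivity), ← ENNReal.ofReal_mul (by positivity),
      exactDensity_chord hk hb hh hb' hbb ht.1 ht.2]
  · intro t ht
    have h2 : HasDerivAt (fun t : ℝ => t ^ 2 + c) (2 * t) t := by
      simpa using (hasDerivAt_pow 2 t).add_const c
    refine ((h2.sqrt (by positivity)).congr_deriv ?_).hasDerivWithinAt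
    rw [mul_div_mul_left _ _ two_ne_zero]
  · intro t ht u hu h
    have h2 := ht.1
    have h3 := hu.1
    simp only at h
    rw [Real.sqrt_inj (by positivity) (by positivity)] at h
    exact (pow_left_inj₀ h2.le h3.le two_ne_zero).1 (by linarith)

theorem hasDerivAt_arcsin_chord {R x : ℝ} (hx : x ^ 2 < R ^ 2) (hR : 0 < R) :
    HasDerivAt (fun x => (R ^ 2 * Real.arcsin (x / R) - x * √(R ^ 2 - x ^ 2)) / 2)
      (x ^ 2 / √(R ^ 2 - x ^ 2)) x := by
  have hlt := abs_lt_of_sq_lt_sq hx hR.le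
  rw [abs_lt] at hlt
  have hpos : 0 < R ^ 2 - x ^ 2 := by linarith
  have hsq : √(1 - (x / R) ^ 2) = √(R ^ 2 - x ^ 2) / R := by
    rw [div_pow, one_sub_div (by positivity), Real.sqrt_div hpos.le, Real.sqrt_sq hR.le]
  have h1 := (Real.hasDerivAt_arcsin (x := x / R)
    (by rw [Ne, div_eq_iff hR.ne']; linarith)
    (by rw [Ne, div_eq_iff hR.ne']; linarith)).comp x ((hasDerivAt_id x).div_const R)
  have h2 : HasDerivAt (fun x : ℝ => R ^ 2 - x ^ 2) (-(2 * x)) x := by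
    simpa using (hasDerivAt_pow 2 x).const_sub (R ^ 2)
  refine (((h1.const_mul (R ^ 2)).sub ((hasDerivAt_id x).mul
    (h2.sqrt hpos.ne'))).div_const 2).congr_deriv ?_
  simp only [id]
  rw [hsq]
  have h3 : 0 < √(R ^ 2 - x ^ 2) := Real.sqrt_pos.2 hpos
  have h4 := Real.sq_sqrt hpos.le
  field_simp
  rw [h4]
  ring

/-- Only `b' * (b - b' t / h')` depends on `b'`, and it has an arcsine primitive. At `b' = b` the
arcsine is the arctangent of the derivative of `circCap`, so the result is itself a `t`-derivative
of the exponential. -/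
theorem lintegral_chordDensity_base {k b h t : ℝ} (hk : 0 < k) (hb : 0 < b) (ht : 0 < t) :
    ∫⁻ b' in Set.Ioo 0 b, ENNReal.ofReal (chordDensity k b h b' t) =
      ENNReal.ofReal (2 * k ^ 3 * (k * b - k ^ 3 * t * Real.arctan (k * b / (k ^ 3 * t))) *
        Real.exp (-(circCap (k * b) (k ^ 3 * t) - circCap (k * b) (k ^ 3 * h)))) := by
  set e := Real.exp (-(circCap (k * b) (k ^ 3 * t) - circCap (k * b) (k ^ 3 * h)))
  have he : Real.exp (-(circCap (k * b) (k ^ 3 * t) - circCap (k * b) (k ^ 3 * h))) = e := rfl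
  set R := √(t ^ 2 + (k ^ 4)⁻¹ * b ^ 2) with hRdef
  have hR : 0 < R := Real.sqrt_pos.2 (by positivity)
  have hR2 : R ^ 2 = t ^ 2 + (k ^ 4)⁻¹ * b ^ 2 := Real.sq_sqrt (by positivity)
  have hμ : (k ^ 4)⁻¹ = ((k ^ 2)⁻¹) ^ 2 := by rw [inv_pow]; ring
  have hsq : ∀ y : ℝ, t ^ 2 + (k ^ 4)⁻¹ * (b ^ 2 - y ^ 2) = R ^ 2 - ((k ^ 2)⁻¹ * y) ^ 2 := by
    intro y
    rw [hR2, hμ]; ring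
  have hd : ∀ y ∈ Set.Ioo 0 b, HasDerivAt
      (fun y => (2 * b * y ^ 2 - 4 * t * k ^ 6 *
        ((R ^ 2 * Real.arcsin ((k ^ 2)⁻¹ * y / R) -
          (k ^ 2)⁻¹ * y * √(R ^ 2 - ((k ^ 2)⁻¹ * y) ^ 2)) / 2)) / R ^ 2 * e)
      (chordDensity k b h y t) y := by
    intro y hy
    have hlt : 0 < R ^ 2 - ((k ^ 2)⁻¹ * y) ^ 2 := by
      rw [← hsq]
      have : 0 < b ^ 2 - y ^ 2 := by nlinarith [hy.1, hy.2]
      positivity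
    have h1 := (hasDerivAt_arcsin_chord (x := (k ^ 2)⁻¹ * y) (by linarith) hR).comp y
      ((hasDerivAt_id y).const_mul (k ^ 2)⁻¹)
    refine ((((((hasDerivAt_pow 2 y).const_mul (2 * b)).sub
      (h1.const_mul (4 * t * k ^ 6)))).div_const (R ^ 2)).mul_const e).congr_deriv ?_
    rw [chordDensity, hsq, ← hR2, he]
    have h3 : 0 < √(R ^ 2 - ((k ^ 2)⁻¹ * y) ^ 2) := Real.sqrt_pos.2 hlt
    generalize √(R ^ 2 - ((k ^ 2)⁻¹ * y) ^ 2) = S at *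
    field_simp
    norm_num
    ring
  rw [lintegral_Ioo_deriv_of_nonneg_of_continuous hb hd]
  · congr 1
    have h5 : Real.arcsin ((k ^ 2)⁻¹ * b / R) = Real.arctan (k * b / (k ^ 3 * t)) := by
      rw [Real.arctan_eq_arcsin]
      congr 1
      have : 1 + (k * b / (k ^ 3 * t)) ^ 2 = (R / t) ^ 2 := by
        rw [div_pow R, hR2]
        field_simp
      rw [this, Real.sqrt_sq (by positivity)]
      field_simp
    have h6 : R ^ 2 - ((k ^ 2)⁻¹ * b) ^ 2 = t ^ 2 := by
      rw [hR2, hμ]; ring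
    rw [h5, h6, Real.sqrt_sq ht.le]
    simp only [mul_zero, zero_div, Real.arcsin_zero, zero_mul, sub_zero, ne_eq, OfNat.ofNat_ne_zero,
      not_false_eq_true, zero_pow]
    congr 1
    field_simp
    rw [hR2]
    field_simp
    ring
  · intro y hy
    have h1 : 0 < b ^ 2 - y ^ 2 := by nlinarith [hy.1, hy.2]
    have h2 : t / √(t ^ 2 + (k ^ 4)⁻¹ * (b ^ 2 - y ^ 2)) ≤ 1 := by
      rw [div_le_one (by positivity)]
      refine Real.le_sqrt_of_sq_le ?_
      have : 0 < (k ^ 4)⁻¹ * (b ^ 2 - y ^ 2) := by positivity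
      linarith
    have h3 : 0 ≤ b - y * (t / √(t ^ 2 + (k ^ 4)⁻¹ * (b ^ 2 - y ^ 2))) := by
      nlinarith [hy.1, hy.2]
    have := hy.1
    rw [chordDensity]
    positivity
  · fun_prop

theorem measurable_chordDensity (k b h : ℝ) :
    Measurable fun p : ℝ × ℝ => chordDensity k b h p.1 p.2 := by
  unfold chordDensity circCap
  fun_prop

/-- The missing mass is the limit of the exponential as `t` tends to `0`, where the cap becomes a
half-disk of radius `k b`. -/
theorem exactSubLaw_univ {k : ℝ} (hk : 0 < k) (x : Quadrant) :
    exactSubLaw (k ^ 3) x Set.univ =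
      ENNReal.ofReal (1 - Real.exp (-((k * x.1.1) ^ 2 * (Real.pi / 2) -
        circCap (k * x.1.1) (k ^ 3 * x.1.2)))) := by
  obtain ⟨⟨b, h⟩, hb, hh⟩ := x
  simp only at hb hh
  have hm : Measurable fun y : ℝ × ℝ => ENNReal.ofReal (exactDensity (k ^ 3) (b, h) y) :=
    ((measurable_exactDensity _).comp measurable_prodMk_left).ennreal_ofReal
  rw [exactSubLaw, withDensity_apply _ MeasurableSet.univ, Measure.restrict_univ,
    lintegral_quadrantVolume hm, setLIntegral_Ioi_eq_Ioo (b := b)]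
  · rw [setLIntegral_congr_fun measurableSet_Ioo fun b' hb' =>
      lintegral_exactDensity_height hk hb hh hb'.1 hb'.2,
      lintegral_lintegral_swap (measurable_chordDensity k b h).ennreal_ofReal.aemeasurable,
      setLIntegral_congr_fun measurableSet_Ioo fun t ht =>
        lintegral_chordDensity_base hk hb ht.1]
    have hk3 : 0 < k ^ 3 := by positivity
    have hd : ∀ t : ℝ, 0 < t → HasDerivAt
        (fun t => Real.exp (-(circCap (k * b) (k ^ 3 * t) - circCap (k * b) (k ^ 3 * h))))
        (2 * k ^ 3 * (k * b - k ^ 3 * t * Real.arctan (k * b / (k ^ 3 * t))) *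
        Real.exp (-(circCap (k * b) (k ^ 3 * t) - circCap (k * b) (k ^ 3 * h)))) t := by
      intro t ht
      have h1 := (hasDerivAt_circCap (β := k * b) (L := k ^ 3 * t) (by positivity)).comp t
        ((hasDerivAt_id t).const_mul (k ^ 3))
      refine ((h1.sub_const _).neg.exp).congr_deriv ?_
      simp only [Pi.neg_apply, Function.comp_apply, mul_one]
      ring
    refine lintegral_Ioo_deriv_of_nonneg hh (fun t ht => hd t ht.1) (fun t ht => ?_) ?_ ?_
    · have := ht.1
      have := sub_nonneg.2 (mul_arctan_div_le (β := k * b) (L := k ^ 3 * t) (by positivity)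
        (by positivity))
      positivity
    · have h1 : Tendsto (fun t => k ^ 3 * t) (𝓝[>] 0) (𝓝[>] 0) := by
        refine tendsto_nhdsWithin_iff.2 ⟨?_, ?_⟩
        · have : Tendsto (fun t => k ^ 3 * t) (𝓝 0) (𝓝 (k ^ 3 * 0)) := by
            exact (continuous_const_mul _).tendsto _
          rw [mul_zero] at this
          exact this.mono_left nhdsWithin_le_nhds
        · filter_upwards [self_mem_nhdsWithin] with t ht
          exact mul_pos hk3 ht
      exact (Real.continuous_exp.tendsto _).comp
        ((((tendsto_circCap_zero (β := k * b) (by positivity)).comp h1).sub_const _).neg)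
    · have h1 := (hd h hh).continuousAt.tendsto.mono_left (nhdsWithin_le_nhds (s := Set.Iio h))
      simpa using h1
  · intro b' hb'
    refine (lintegral_congr fun s => ?_).trans lintegral_zero
    rw [exactDensity, Set.indicator_of_notMem, ENNReal.ofReal_zero]
    rw [mem_admissible hk ⟨hb, hh⟩]
    rintro ⟨-, h1, -⟩
    exact absurd h1 (not_lt.2 hb')

theorem exactSubLaw_univ_le {l : ℝ} (hl : 0 < l) (x : Quadrant) :
    exactSubLaw l x Set.univ ≤ 1 := by
  obtain ⟨k, hk, rfl⟩ := exists_cube hl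
  rw [exactSubLaw_univ hk, ← ENNReal.ofReal_one]
  exact ENNReal.ofReal_le_ofReal (by linarith [Real.exp_pos (-((k * x.1.1) ^ 2 * (Real.pi / 2) -
        circCap (k * x.1.1) (k ^ 3 * x.1.2)))])

/-! ### Comparison of the two densities -/

/-- Bounding the caps at distance `t` gives the idealized exponent with `1 / t` instead of `1 / h'`.
When `h'²` is at least `2 k⁻⁴ b²`, `t` is comparable with `h'` and the replacement costs at most
`k⁻⁴ b⁵ / h'³`. -/
theorem capArea_le {k : ℝ} (hk : 0 < k) {b h b' h' : ℝ} (hb : 0 < b) (hb' : 0 < b')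
    (hbb : b' < b) (hh' : 0 < h') (hhh : h' < h)
    (hbig : 2 * ((k ^ 4)⁻¹ * b ^ 2) ≤ h' ^ 2) :
    capArea (k ^ 3) (b, h) (b', h') ≤
      2 / 3 * b ^ 3 * (1 / h' - 1 / h) + (k ^ 4)⁻¹ * b ^ 5 / h' ^ 3 := by
  set μ := (k ^ 4)⁻¹ with hμ
  have hμ0 : 0 < μ := by positivity
  have hb2 : 0 < b ^ 2 - b' ^ 2 := by nlinarith
  have hlt : μ * (b ^ 2 - b' ^ 2) < μ * b ^ 2 := by
    have := pow_pos hb' 2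
    exact mul_lt_mul_of_pos_left (by linarith) hμ0
  have hpos : 0 < h' ^ 2 - μ * (b ^ 2 - b' ^ 2) := by
    have := mul_pos hμ0 (pow_pos hb 2)
    linarith
  rw [capArea_eq hk ⟨hb, hh'.trans hhh⟩ hpos]
  simp only
  rw [← hμ]
  set t := √(h' ^ 2 - μ * (b ^ 2 - b' ^ 2)) with ht
  have ht0 : 0 < t := Real.sqrt_pos.2 hpos
  have ht2 : t ^ 2 = h' ^ 2 - μ * (b ^ 2 - b' ^ 2) := Real.sq_sqrt hpos.le
  have hth : t ≤ h' := by
    refine le_of_sq_le_sq (b := h') ?_ hh'.le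
    have : 0 < μ * (b ^ 2 - b' ^ 2) := by positivity
    linarith
  have hht : h' ≤ 3 / 2 * t := by
    refine le_of_sq_le_sq (b := 3 / 2 * t) ?_ (by positivity)
    rw [mul_pow, ht2]
    linarith
  refine (circCap_sub_le (by positivity) (by positivity)
    (mul_le_mul_of_nonneg_left (hth.trans hhh.le) (by positivity))).trans ?_
  have e1 : 2 / 3 * (k * b) ^ 3 * (1 / (k ^ 3 * t) - 1 / (k ^ 3 * h)) =
      2 / 3 * b ^ 3 * (1 / h' - 1 / h) + 2 / 3 * b ^ 3 * ((h' - t) / (t * h')) := by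
    field_simp
    ring
  rw [e1]
  gcongr
  have e2 : (h' - t) * h' ≤ μ * b ^ 2 := by nlinarith
  calc 2 / 3 * b ^ 3 * ((h' - t) / (t * h'))
      = 2 / 3 * b ^ 3 * ((h' - t) * h') / (t * h' ^ 2) := by field_simp
    _ ≤ 2 / 3 * b ^ 3 * (μ * b ^ 2) / (2 / 3 * h' * h' ^ 2) := by
        gcongr
        linarith
    _ = μ * b ^ 5 / h' ^ 3 := by field_simp

/-- This is `z² ≤ 1 + z³` with `z = b³ w`; it reduces all comparison errors to the two terms carried
by the potential. -/
theorem sq_mul_sq_le {b w : ℝ} (hb : 0 < b) (hw : 0 ≤ w) :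
    b ^ 2 * w ^ 2 ≤ b⁻¹ ^ 4 + b ^ 5 * w ^ 3 := by
  have h1 : (b ^ 3 * w) ^ 2 ≤ 1 + (b ^ 3 * w) ^ 3 := by
    have h0 : 0 ≤ b ^ 3 * w := by positivity
    generalize b ^ 3 * w = z at *
    nlinarith [mul_nonneg h0 (sq_nonneg (z - 1)), sq_nonneg (z - 1)]
  have h2 := mul_le_mul_of_nonneg_left h1 (show 0 ≤ b⁻¹ ^ 4 by positivity)
  calc b ^ 2 * w ^ 2 = b⁻¹ ^ 4 * (b ^ 3 * w) ^ 2 := by field_simp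
    _ ≤ _ := h2
    _ = _ := by field_simp

theorem idealDensity_le {k : ℝ} (hk : 0 < k) (x : Quadrant) (y : ℝ × ℝ) :
    idealDensity x y ≤ exactDensity (k ^ 3) x y +
      idealDensity x y * (4 * (k ^ 4)⁻¹ * (x.1.1⁻¹ ^ 4 + x.1.1 ^ 5 * y.2⁻¹ ^ 3)) := by
  obtain ⟨⟨b, h⟩, hb, hh⟩ := x
  obtain ⟨b', h'⟩ := y
  simp only at hb hh ⊢
  have hE : 0 ≤ exactDensity (k ^ 3) (b, h) (b', h') :=
    exactDensity_nonneg (by positivity) ⟨hb, hh⟩ _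
  by_cases hmem : ((b', h') : ℝ × ℝ) ∈ Set.Ioo 0 b ×ˢ Set.Ioo 0 h
  swap
  · rw [idealDensity, Set.indicator_of_notMem hmem]
    linarith
  have hI := idealDensity_nonneg (b, h) (b', h')
  obtain ⟨⟨hb', hbb⟩, hh', hhh⟩ := id hmem
  simp only at hb' hbb hh' hhh
  set μ := (k ^ 4)⁻¹ with hμ
  have hμ0 : 0 < μ := by positivity
  have hsq := sq_mul_sq_le hb (inv_nonneg.2 hh'.le)
  have hw : 0 < h'⁻¹ := inv_pos.2 hh'
  have hterm : 0 ≤ b⁻¹ ^ 4 + b ^ 5 * h'⁻¹ ^ 3 := by positivity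
  -- For small `h'` the relative error on the right already exceeds one. Otherwise the point is
  -- admissible and the factors can be compared.
  rcases lt_or_ge (h' ^ 2) (2 * (μ * b ^ 2)) with hsmall | hbig
  · have h1 : 1 ≤ 2 * μ * (b ^ 2 * h'⁻¹ ^ 2) := by
      have : 2 * μ * (b ^ 2 * h'⁻¹ ^ 2) = 2 * (μ * b ^ 2) / h' ^ 2 := by field_simp
      rw [this, one_le_div (by positivity)]
      exact hsmall.le
    have h2 : 1 ≤ 4 * μ * (b⁻¹ ^ 4 + b ^ 5 * h'⁻¹ ^ 3) := by
      have := mul_le_mul_of_nonneg_left hsq hμ0.le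
      have := mul_nonneg hμ0.le hterm
      linarith
    have := mul_le_mul_of_nonneg_left h2 hI
    linarith
  · have hb2 : 0 < b ^ 2 - b' ^ 2 := by nlinarith
    have hlt : μ * (b ^ 2 - b' ^ 2) < μ * b ^ 2 := by
      have := pow_pos hb' 2
      exact mul_lt_mul_of_pos_left (by linarith) hμ0
    have hpos : 0 < h' ^ 2 - μ * (b ^ 2 - b' ^ 2) := by
      have := mul_pos hμ0 (pow_pos hb 2)
      linarith
    have hadm : ((b', h') : ℝ × ℝ) ∈ admissible (k ^ 3) (b, h) := by
      rw [mem_admissible hk ⟨hb, hh⟩]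
      have : 0 < μ * (b ^ 2 - b' ^ 2) := by positivity
      refine ⟨hb', hbb, hh', hpos, ?_⟩
      simp only
      rw [← hμ]
      nlinarith
    obtain ⟨-, -, -, -, h4, -⟩ := rpow_thirds hk
    have hA := capArea_le hk hb hb' hbb hh' hhh hbig
    rw [← hμ] at hA
    set D := μ * b ^ 5 / h' ^ 3 with hD
    have hD0 : 0 ≤ D := by positivity
    have hexp : Real.exp (-(2 / 3) * b ^ 3 * (1 / h' - 1 / h)) * (1 - D) ≤
        Real.exp (-capArea (k ^ 3) (b, h) (b', h')) := by
      have h1 : 1 - D ≤ Real.exp (-D) := by linarith [Real.add_one_le_exp (-D)]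
      calc _ ≤ Real.exp (-(2 / 3) * b ^ 3 * (1 / h' - 1 / h)) * Real.exp (-D) := by gcongr
        _ = Real.exp (-(2 / 3 * b ^ 3 * (1 / h' - 1 / h) + D)) := by
          rw [← Real.exp_add]; ring_nf
        _ ≤ _ := Real.exp_le_exp.2 (by linarith)
    -- This factor is larger for the exact density; only the prefactor and the exponential lose, by
    -- relative amounts `m` and `D`.
    have hfac : b - b' ≤ b * (√(1 - μ * ((b ^ 2 - b' ^ 2) / h' ^ 2)))⁻¹ - b' := by
      have hp : 0 < 1 - μ * ((b ^ 2 - b' ^ 2) / h' ^ 2) := by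
        rw [← mul_div_assoc, sub_pos, div_lt_one (by positivity)]
        linarith
      have hle : √(1 - μ * ((b ^ 2 - b' ^ 2) / h' ^ 2)) ≤ 1 := by
        rw [Real.sqrt_le_one]
        have : 0 < μ * ((b ^ 2 - b' ^ 2) / h' ^ 2) := by positivity
        linarith
      have := (one_le_inv₀ (Real.sqrt_pos.2 hp)).2 hle
      nlinarith
    have hpre : 4 * b' / h' ^ 2 * (1 - μ * b ^ 2 / h' ^ 2) ≤ 4 * b' / (h' ^ 2 + μ * b' ^ 2) := by
      have h1 : 1 - μ * b ^ 2 / h' ^ 2 ≤ h' ^ 2 / (h' ^ 2 + μ * b' ^ 2) := by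
        rw [one_sub_div (by positivity), div_le_div_iff₀ (by positivity) (by positivity)]
        have h2 : μ * b' ^ 2 ≤ μ * b ^ 2 := by gcongr
        have h3 : 0 ≤ μ * b ^ 2 * (μ * b' ^ 2) := by positivity
        nlinarith [mul_le_mul_of_nonneg_left h2 (sq_nonneg h')]
      calc _ ≤ 4 * b' / h' ^ 2 * (h' ^ 2 / (h' ^ 2 + μ * b' ^ 2)) := by gcongr
        _ = _ := by field_simp
    set m := μ * b ^ 2 / h' ^ 2 with hm
    have hm0 : 0 ≤ m := by positivity
    have hm1 : m ≤ 1 / 2 := by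
      rw [hm, div_le_iff₀ (by positivity)]
      linarith
    have hbd : 0 < b - b' := sub_pos.2 hbb
    have hexact : idealDensity (b, h) (b', h') * ((1 - m) * (1 - D)) ≤
        exactDensity (k ^ 3) (b, h) (b', h') := by
      rcases le_or_gt D 1 with hD1 | hD1
      · rw [idealDensity, Set.indicator_of_mem hmem, exactDensity, Set.indicator_of_mem hadm]
        simp only [h4, ← hμ]
        calc _ = (4 * b' / h' ^ 2 * (1 - m)) * (b - b') *
              (Real.exp (-(2 / 3) * b ^ 3 * (1 / h' - 1 / h)) * (1 - D)) := by ring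
          _ ≤ _ := by
            have := sub_nonneg.2 hD1
            have : 0 ≤ 4 * b' / h' ^ 2 * (1 - m) :=
              mul_nonneg (by positivity) (by linarith)
            have h7 := hbd.le.trans hfac
            have h8 : 0 ≤ 4 * b' / (h' ^ 2 + μ * b' ^ 2) *
              (b * (√(1 - μ * ((b ^ 2 - b' ^ 2) / h' ^ 2)))⁻¹ - b') :=
                mul_nonneg (by positivity) h7
            gcongr
      · refine le_trans (mul_nonpos_of_nonneg_of_nonpos hI ?_) hE
        exact mul_nonpos_of_nonneg_of_nonpos (by linarith) (by linarith)
    have herr : 1 - (1 - m) * (1 - D) ≤ 4 * μ * (b⁻¹ ^ 4 + b ^ 5 * h'⁻¹ ^ 3) := by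
      have h1 : m = μ * (b ^ 2 * h'⁻¹ ^ 2) := by rw [hm]; field_simp
      have h2 : D = μ * (b ^ 5 * h'⁻¹ ^ 3) := by rw [hD]; field_simp
      have h3 := mul_le_mul_of_nonneg_left hsq hμ0.le
      have h5 : 0 ≤ μ * b⁻¹ ^ 4 := by positivity
      have h6 := mul_nonneg hm0 hD0
      rw [← h1, mul_add, ← h2] at h3
      rw [mul_assoc 4, mul_add μ, ← h2]
      nlinarith
    have := mul_le_mul_of_nonneg_left herr hI
    linarith

theorem one_le_overlap_add {k : ℝ} (hk : 0 < k) (x : Quadrant) :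
    1 ≤ overlap (k ^ 3) x +
      ENNReal.ofReal (164 * (k ^ 4)⁻¹ * (x.1.1 ^ 5 * x.1.2⁻¹ ^ 3 + x.1.1⁻¹ ^ 4)) := by
  have hm1 : Measurable fun y : Quadrant => idealDensity x y :=
    measurable_idealDensity_coe.comp measurable_prodMk_left
  have hm2 : Measurable fun y : Quadrant => exactDensity (k ^ 3) x y :=
    (measurable_exactDensity_coe _).comp measurable_prodMk_left
  have hx1 := x.2.1
  have hx2 := x.2.2
  have hpt : ∀ y : Quadrant, ENNReal.ofReal (idealDensity x y) ≤
      ENNReal.ofReal (min (exactDensity (k ^ 3) x y) (idealDensity x y)) +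
      ENNReal.ofReal (idealDensity x y) * (ENNReal.ofReal (4 * (k ^ 4)⁻¹ * x.1.1⁻¹ ^ 4) +
        ENNReal.ofReal (4 * (k ^ 4)⁻¹ * x.1.1 ^ 5) * ENNReal.ofReal (y.1.1 ^ (0 : ℝ) *
          y.1.2⁻¹ ^ 3)) := by
    intro y
    have hy2 := y.2.2
    have hI := idealDensity_nonneg x y
    have hE := exactDensity_nonneg (l := k ^ 3) (by positivity) x.2 y
    rw [Real.rpow_zero, one_mul, ← ENNReal.ofReal_mul (by positivity),
      ← ENNReal.ofReal_add (by positivity) (by positivity), ← ENNReal.ofReal_mul hI,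
      ← ENNReal.ofReal_add (le_min hE hI) (by positivity)]
    refine ENNReal.ofReal_le_ofReal ?_
    have h1 := idealDensity_le hk x y
    have h2 : 4 * (k ^ 4)⁻¹ * x.1.1⁻¹ ^ 4 + 4 * (k ^ 4)⁻¹ * x.1.1 ^ 5 * y.1.2⁻¹ ^ 3 =
      4 * (k ^ 4)⁻¹ * (x.1.1⁻¹ ^ 4 + x.1.1 ^ 5 * y.1.2⁻¹ ^ 3) := by ring
    rw [h2]
    have h3 : 0 ≤ idealDensity x y *
      (4 * (k ^ 4)⁻¹ * (x.1.1⁻¹ ^ 4 + x.1.1 ^ 5 * y.1.2⁻¹ ^ 3)) := by positivity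
    rcases min_cases (exactDensity (k ^ 3) x y) (idealDensity x y) with h | h <;> linarith [h.1]
  have hI := lintegral_mono hpt (μ := quadrantVolume)
  rw [lintegral_add_left (by fun_prop), ← lintegral_idealStep x (by fun_prop),
    lintegral_add_left measurable_const, lintegral_const_mul _ (by fun_prop), lintegral_const,
    measure_univ, mul_one] at hI
  have h1 : ∫⁻ y : Quadrant, ENNReal.ofReal (idealDensity x y) ∂quadrantVolume = 1 := by
    have := idealStep_univ x
    rwa [idealStep, withDensity_apply _ MeasurableSet.univ, Measure.restrict_univ] at this
  have h2 := lintegral_idealStep_rpow_mul_inv_cube_le x le_rfl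
  rw [h1] at hI
  refine hI.trans (add_le_add le_rfl ((add_le_add le_rfl (mul_le_mul_right h2 _)).trans ?_))
  rw [← ENNReal.ofReal_mul (by positivity), ← ENNReal.ofReal_add (by positivity) (by positivity)]
  refine ENNReal.ofReal_le_ofReal ?_
  rw [Real.rpow_zero]
  have e : x.1.1 ^ 5 * x.1.1⁻¹ ^ 9 = x.1.1⁻¹ ^ 4 := by field_simp
  have h3 : 0 ≤ (k ^ 4)⁻¹ * (x.1.1 ^ 5 * x.1.2⁻¹ ^ 3) := by positivity
  -- The coefficient of `b⁻⁴` is `4 + 4 * 40 = 164`; that of `b⁵ / h³` is only `20`.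
  calc _ = 4 * (k ^ 4)⁻¹ * x.1.1⁻¹ ^ 4 + 20 * ((k ^ 4)⁻¹ * (x.1.1 ^ 5 * x.1.2⁻¹ ^ 3)) +
        160 * (k ^ 4)⁻¹ * (x.1.1 ^ 5 * x.1.1⁻¹ ^ 9) := by ring
    _ ≤ _ := by
      rw [e]
      linarith

end VoronoiChain

namespace VoronoiChain

open ProbabilityTheory

/-! ### The one-step kernels -/

theorem measurable_withDensity_param {α β : Type*} [MeasurableSpace α] [MeasurableSpace β]
    (μ : Measure β) [SFinite μ] {f : α → β → ℝ≥0∞} (hf : Measurable (Function.uncurry f)) :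
    Measurable fun x => μ.withDensity (f x) := by
  have h := (Kernel.withDensity (Kernel.const α μ) f).measurable
  have e : ⇑(Kernel.withDensity (Kernel.const α μ) f) = fun x => μ.withDensity (f x) := by
    ext1 x
    rw [Kernel.withDensity_apply _ hf, Kernel.const_apply]
  rwa [e] at h

theorem measurable_idealStep : Measurable idealStep :=
  measurable_withDensity_param quadrantVolume
    (f := fun x y : Quadrant => ENNReal.ofReal (idealDensity x y))
    measurable_idealDensity_coe.ennreal_ofReal

theorem measurable_exactSubLaw (l : ℝ) : Measurable (exactSubLaw l) :=
  measurable_withDensity_param quadrantVolume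
    (f := fun x y : Quadrant => ENNReal.ofReal (exactDensity l x y))
    (measurable_exactDensity_coe l).ennreal_ofReal

theorem exactStep_inl_apply (l : ℝ) (x : Quadrant) {s : Set KilledState} (hs : MeasurableSet s) :
    exactStep l (Sum.inl x) s = exactSubLaw l x (Sum.inl ⁻¹' s) +
      (1 - exactSubLaw l x Set.univ) * Measure.dirac (Sum.inr ()) s := by
  simp [exactStep, Measure.map_apply measurable_inl hs]

theorem measurable_exactStep (l : ℝ) : Measurable (exactStep l) := by
  refine Measure.measurable_of_measurable_coe _ fun s hs => measurable_fun_sum ?_ ?_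
  · have h := measurable_exactSubLaw l
    have h1 : Measurable fun x => exactSubLaw l x (Sum.inl ⁻¹' s) +
      (1 - exactSubLaw l x Set.univ) * Measure.dirac (Sum.inr () : KilledState) s :=
      (Measure.measurable_measure.1 h _ (measurable_inl hs)).add
        ((measurable_const.sub (Measure.measurable_measure.1 h _ MeasurableSet.univ)).mul_const _)
    have e : (fun x => exactStep l x s) ∘ Sum.inl = fun x => exactSubLaw l x (Sum.inl ⁻¹' s) +
        (1 - exactSubLaw l x Set.univ) * Measure.dirac (Sum.inr () : KilledState) s :=
      funext fun x => exactStep_inl_apply l x hs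
    rwa [e]
  · exact measurable_const

/-- The idealized step as a kernel. -/
noncomputable def idealKernel : Kernel Quadrant Quadrant := ⟨idealStep, measurable_idealStep⟩

/-- The exact step as a kernel. -/
noncomputable def exactKernel (l : ℝ) : Kernel KilledState KilledState :=
  ⟨exactStep l, measurable_exactStep l⟩

instance : IsMarkovKernel idealKernel := ⟨fun x => ⟨idealStep_univ x⟩⟩

theorem exactStep_univ {l : ℝ} (hl : 0 < l) (x : KilledState) : exactStep l x Set.univ = 1 := by
  rcases x with x | x
  · rw [exactStep_inl_apply _ _ MeasurableSet.univ, Set.preimage_univ,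
      measure_univ (μ := Measure.dirac (Sum.inr () : KilledState)), mul_one,
      add_tsub_cancel_of_le (exactSubLaw_univ_le hl x)]
  · simp [exactStep]

theorem isMarkovKernel_exactKernel {l : ℝ} (hl : 0 < l) : IsMarkovKernel (exactKernel l) :=
  ⟨fun x => ⟨exactStep_univ hl x⟩⟩

/-! ### Maximal coupling of the two steps from a common point -/

/-- The common part of the two laws. -/
noncomputable def commonLaw (l : ℝ) (x : Quadrant) : Measure Quadrant :=
  quadrantVolume.withDensity fun y => ENNReal.ofReal (min (exactDensity l x y) (idealDensity x y))

/-- What the idealized law has in excess of the common part. -/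
noncomputable def idealExcess (l : ℝ) (x : Quadrant) : Measure Quadrant :=
  quadrantVolume.withDensity fun y =>
    ENNReal.ofReal (idealDensity x y - min (exactDensity l x y) (idealDensity x y))

/-- What the exact law has in excess of the common part, the killing included. -/
noncomputable def exactExcess (l : ℝ) (x : Quadrant) : Measure KilledState :=
  (quadrantVolume.withDensity fun y =>
    ENNReal.ofReal (exactDensity l x y - min (exactDensity l x y) (idealDensity x y))).map Sum.inl
    + (1 - exactSubLaw l x Set.univ) • Measure.dirac (Sum.inr ())

/-- The maximal coupling of the two steps from a common point. -/
noncomputable def maximalCoupling (l : ℝ) (x : Quadrant) : Measure (KilledState × Quadrant) :=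
  (commonLaw l x).map (fun y => (Sum.inl y, y)) +
    (1 - overlap l x)⁻¹ • (exactExcess l x).prod (idealExcess l x)

theorem commonLaw_univ (l : ℝ) (x : Quadrant) : commonLaw l x Set.univ = overlap l x := by
  rw [commonLaw, withDensity_apply _ MeasurableSet.univ, Measure.restrict_univ, overlap]

theorem measurable_commonDensity (l : ℝ) : Measurable fun p : Quadrant × Quadrant =>
    ENNReal.ofReal (min (exactDensity l p.1 p.2) (idealDensity p.1 p.2)) :=
  ((measurable_exactDensity_coe l).min measurable_idealDensity_coe).ennreal_ofReal

theorem measurable_overlap (l : ℝ) : Measurable (overlap l) :=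
  (measurable_commonDensity l).lintegral_prod_right'

theorem commonLaw_add_idealExcess {l : ℝ} (hl : 0 < l) (x : Quadrant) :
    commonLaw l x + idealExcess l x = idealStep x := by
  rw [commonLaw, idealExcess, idealStep, ← withDensity_add_left]
  · congr 1 with y
    rw [Pi.add_apply, ← ENNReal.ofReal_add
      (le_min (exactDensity_nonneg hl x.2 y) (idealDensity_nonneg x y))
      (sub_nonneg.2 (min_le_right _ _))]
    congr 2
    ring
  · exact (measurable_commonDensity l).comp measurable_prodMk_left

theorem map_commonLaw_add_exactExcess {l : ℝ} (hl : 0 < l) (x : Quadrant) :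
    (commonLaw l x).map Sum.inl + exactExcess l x = exactStep l (Sum.inl x) := by
  have hm : Measurable fun y : Quadrant =>
      ENNReal.ofReal (min (exactDensity l x y) (idealDensity x y)) :=
    (measurable_commonDensity l).comp measurable_prodMk_left
  rw [exactExcess, ← add_assoc, ← Measure.map_add _ _ measurable_inl, commonLaw,
    ← withDensity_add_left hm, exactStep, exactSubLaw]
  congr 3
  ext y
  rw [Pi.add_apply, ← ENNReal.ofReal_add
    (le_min (exactDensity_nonneg hl x.2 y) (idealDensity_nonneg x y))
    (sub_nonneg.2 (min_le_left _ _))]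
  congr 1
  ring

theorem overlap_add_idealExcess {l : ℝ} (hl : 0 < l) (x : Quadrant) :
    overlap l x + idealExcess l x Set.univ = 1 := by
  rw [← commonLaw_univ, ← Measure.add_apply, commonLaw_add_idealExcess hl, idealStep_univ]

theorem overlap_add_exactExcess {l : ℝ} (hl : 0 < l) (x : Quadrant) :
    overlap l x + exactExcess l x Set.univ = 1 := by
  have h := congrArg (fun μ => μ Set.univ) (map_commonLaw_add_exactExcess hl x)
  simp only [Measure.add_apply, Measure.map_apply measurable_inl MeasurableSet.univ,
    Set.preimage_univ, commonLaw_univ] at h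
  rw [h, exactStep_univ hl]

theorem overlap_le_one {l : ℝ} (hl : 0 < l) (x : Quadrant) : overlap l x ≤ 1 :=
  le_self_add.trans_eq (overlap_add_idealExcess hl x)

theorem idealExcess_univ {l : ℝ} (hl : 0 < l) (x : Quadrant) :
    idealExcess l x Set.univ = 1 - overlap l x :=
  ENNReal.eq_sub_of_add_eq ((overlap_le_one hl x).trans_lt ENNReal.one_lt_top).ne
    (by rw [add_comm]; exact overlap_add_idealExcess hl x)

theorem exactExcess_univ {l : ℝ} (hl : 0 < l) (x : Quadrant) :
    exactExcess l x Set.univ = 1 - overlap l x :=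
  ENNReal.eq_sub_of_add_eq ((overlap_le_one hl x).trans_lt ENNReal.one_lt_top).ne
    (by rw [add_comm]; exact overlap_add_exactExcess hl x)

theorem isFiniteMeasure_idealExcess {l : ℝ} (hl : 0 < l) (x : Quadrant) :
    IsFiniteMeasure (idealExcess l x) :=
  ⟨by rw [idealExcess_univ hl]; exact tsub_le_self.trans_lt ENNReal.one_lt_top⟩

/-- Includes `c = 0`, the case of overlap one: both excesses vanish, and the infinite normalization
is multiplied by zero. -/
theorem inv_mul_mul_cancel_of_le {a c : ℝ≥0∞} (h : a ≤ c) (hc : c ≠ ∞) : c⁻¹ * (a * c) = a := by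
  rcases eq_or_ne c 0 with rfl | h0
  · simp [nonpos_iff_eq_zero.1 h]
  · rw [mul_comm a, ← mul_assoc, ENNReal.inv_mul_cancel h0 hc, one_mul]

theorem maximalCoupling_apply_prod {l : ℝ} (hl : 0 < l) (x : Quadrant) {s : Set KilledState}
    {t : Set Quadrant} (hs : MeasurableSet s) (ht : MeasurableSet t) :
    maximalCoupling l x (s ×ˢ t) = commonLaw l x (Sum.inl ⁻¹' s ∩ t) +
      (1 - overlap l x)⁻¹ * (exactExcess l x s * idealExcess l x t) := by
  have := isFiniteMeasure_idealExcess hl x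
  rw [maximalCoupling, Measure.add_apply, Measure.smul_apply, Measure.prod_prod, smul_eq_mul,
    Measure.map_apply (by fun_prop) (hs.prod ht)]
  rfl

theorem maximalCoupling_fst {l : ℝ} (hl : 0 < l) (x : Quadrant) {s : Set KilledState}
    (hs : MeasurableSet s) :
    maximalCoupling l x (s ×ˢ Set.univ) = exactStep l (Sum.inl x) s := by
  rw [maximalCoupling_apply_prod hl x hs MeasurableSet.univ, idealExcess_univ hl,
    inv_mul_mul_cancel_of_le, Set.inter_univ, ← map_commonLaw_add_exactExcess hl,
    Measure.add_apply, Measure.map_apply measurable_inl hs]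
  · exact (measure_mono (Set.subset_univ _)).trans_eq (exactExcess_univ hl x)
  · finiteness

theorem maximalCoupling_snd {l : ℝ} (hl : 0 < l) (x : Quadrant) {t : Set Quadrant}
    (ht : MeasurableSet t) :
    maximalCoupling l x (Set.univ ×ˢ t) = idealStep x t := by
  rw [maximalCoupling_apply_prod hl x MeasurableSet.univ ht, exactExcess_univ hl, mul_comm (_ - _),
    inv_mul_mul_cancel_of_le, Set.preimage_univ, Set.univ_inter, ← commonLaw_add_idealExcess hl,
    Measure.add_apply]
  · exact (measure_mono (Set.subset_univ _)).trans_eq (idealExcess_univ hl x)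
  · finiteness

theorem measurableSet_diagonal :
    MeasurableSet {p : KilledState × Quadrant | p.1 = Sum.inl p.2} := by
  have h : {p : KilledState × Quadrant | p.1 = Sum.inl p.2} =
      Prod.map Sum.inl id '' {p : Quadrant × Quadrant | p.1 = p.2} := by
    ext ⟨a, b⟩
    constructor
    · intro h
      exact ⟨(b, b), rfl, Prod.ext h.symm rfl⟩
    · rintro ⟨⟨c, d⟩, h, h'⟩
      simp only [Set.mem_ofPred_eq, Prod.map_apply, id, Prod.mk.injEq] at h h' ⊢
      rw [← h'.1, ← h'.2, h]
  rw [h]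
  have h1 : MeasurableEmbedding (Sum.inl : Quadrant → KilledState) :=
    ⟨Sum.inl_injective, measurable_inl, fun _ hs => measurableSet_inl_image.2 hs⟩
  exact (h1.prodMap MeasurableEmbedding.id).measurableSet_image.2
    (measurableSet_eq_fun measurable_fst measurable_snd)

instance : NullSingletonClass quadrantVolume := by
  refine ⟨fun x => ?_⟩
  have h := (MeasurableEmbedding.subtype_coe measurableSet_quadrant).comap_apply volume {x}
  rw [Set.image_singleton, measure_singleton (x : ℝ × ℝ)] at h
  exact h

/-- The product part gives the diagonal no mass, because the excess of the idealized law has a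
density and so no atoms. -/
theorem maximalCoupling_diagonal {l : ℝ} (hl : 0 < l) (x : Quadrant) :
    maximalCoupling l x {p | p.1 = Sum.inl p.2} = overlap l x := by
  have := isFiniteMeasure_idealExcess hl x
  rw [maximalCoupling, Measure.add_apply, Measure.smul_apply,
    Measure.map_apply (by fun_prop) measurableSet_diagonal,
    Measure.prod_apply measurableSet_diagonal]
  have h0 : ∀ a : KilledState, idealExcess l x
      (Prod.mk a ⁻¹' {p : KilledState × Quadrant | p.1 = Sum.inl p.2}) = 0 := by
    intro a
    refine (withDensity_absolutelyContinuous quadrantVolume _)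
      (Set.Subsingleton.measure_zero ?_ quadrantVolume)
    intro b hb c hc
    have hb : a = Sum.inl b := hb
    have hc : a = Sum.inl c := hc
    exact Sum.inl_injective (hb.symm.trans hc)
  simp only [h0, lintegral_zero, smul_zero, add_zero]
  rw [← commonLaw_univ]
  congr 1
  ext y
  simp

theorem measurable_maximalCoupling {l : ℝ} (hl : 0 < l) : Measurable (maximalCoupling l) := by
  have hE := (measurable_exactDensity_coe l)
  have hI := measurable_idealDensity_coe
  have h1 : Measurable (commonLaw l) := measurable_withDensity_param quadrantVolume
    (f := fun x y : Quadrant =>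
      ENNReal.ofReal (min (exactDensity l x y) (idealDensity x y))) (measurable_commonDensity l)
  have h2 : Measurable (idealExcess l) := measurable_withDensity_param quadrantVolume
    (f := fun x y : Quadrant =>
      ENNReal.ofReal (idealDensity x y - min (exactDensity l x y) (idealDensity x y)))
    (hI.sub (hE.min hI)).ennreal_ofReal
  have h3 : Measurable fun x : Quadrant => quadrantVolume.withDensity fun y =>
      ENNReal.ofReal (exactDensity l x y - min (exactDensity l x y) (idealDensity x y)) :=
    measurable_withDensity_param quadrantVolume
    (f := fun x y : Quadrant =>
      ENNReal.ofReal (exactDensity l x y - min (exactDensity l x y) (idealDensity x y)))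
    (hE.sub (hE.min hI)).ennreal_ofReal
  have h4 : Measurable (exactExcess l) := by
    refine Measure.measurable_of_measurable_coe _ fun s hs => ?_
    simp only [exactExcess, Measure.add_apply, Measure.map_apply measurable_inl hs,
      Measure.smul_apply, smul_eq_mul]
    exact (Measure.measurable_measure.1 h3 _ (measurable_inl hs)).add
      ((measurable_const.sub (Measure.measurable_measure.1 (measurable_exactSubLaw l) _
        MeasurableSet.univ)).mul_const _)
  let K1 : Kernel Quadrant KilledState := ⟨exactExcess l, h4⟩
  let K2 : Kernel Quadrant Quadrant := ⟨idealExcess l, h2⟩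
  have : IsFiniteKernel K1 := ⟨1, ENNReal.one_lt_top, fun x =>
    (exactExcess_univ hl x).trans_le tsub_le_self⟩
  have : IsFiniteKernel K2 := ⟨1, ENNReal.one_lt_top, fun x =>
    (idealExcess_univ hl x).trans_le tsub_le_self⟩
  have h5 : Measurable fun x => (exactExcess l x).prod (idealExcess l x) := by
    have e : ⇑(K1 ×ₖ K2) = fun x => (exactExcess l x).prod (idealExcess l x) := by
      ext1 x
      rw [Kernel.prod_apply]
      rfl
    rw [← e]
    exact (K1 ×ₖ K2).measurable
  refine Measure.measurable_of_measurable_coe _ fun s hs => ?_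
  have hd : Measurable fun y : Quadrant => ((Sum.inl y : KilledState), y) := by fun_prop
  simp only [maximalCoupling, Measure.add_apply, Measure.map_apply hd hs,
      Measure.smul_apply, smul_eq_mul]
  exact (Measure.measurable_measure.1 h1 _ (hd hs)).add
    ((measurable_const.sub (measurable_overlap l)).inv.mul (Measure.measurable_measure.1 h5 _ hs))

/-! ### Existence of the coupling -/

/-- The maximal coupling as a kernel. -/
noncomputable def maximalKernel {l : ℝ} (hl : 0 < l) : Kernel Quadrant (KilledState × Quadrant) :=
  ⟨maximalCoupling l, measurable_maximalCoupling hl⟩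

theorem isMarkovKernel_maximalKernel {l : ℝ} (hl : 0 < l) : IsMarkovKernel (maximalKernel hl) :=
  ⟨fun x => ⟨by
    have := maximalCoupling_fst hl x MeasurableSet.univ
    rw [Set.univ_prod_univ, exactStep_univ hl] at this
    exact this⟩⟩

/-- Finite trajectories along which the two chains always coincide. -/
def metHistories (n : ℕ) : Set (Finset.Iic n → KilledState × Quadrant) :=
  {x | ∀ i, (x i).1 = Sum.inl (x i).2}

theorem measurableSet_metHistories (n : ℕ) : MeasurableSet (metHistories n) := by
  have : metHistories n = ⋂ i, (fun x : Finset.Iic n → KilledState × Quadrant => x i) ⁻¹'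
      {p | p.1 = Sum.inl p.2} := by
    ext x
    simp [metHistories]
  rw [this]
  exact MeasurableSet.iInter fun i => measurable_pi_apply i measurableSet_diagonal

/-- The last point of a finite trajectory. -/
def lastState (n : ℕ) (x : Finset.Iic n → KilledState × Quadrant) : KilledState × Quadrant :=
  x ⟨n, Finset.mem_Iic.2 le_rfl⟩

theorem measurable_lastState (n : ℕ) : Measurable (lastState n) := measurable_pi_apply _

/-- The transition of the pair of chains given their history: maximal coupling as long as they have
coincided, independent moves afterwards. -/
noncomputable def pairKernel {l : ℝ} (hl : 0 < l) (n : ℕ) :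
    Kernel (Finset.Iic n → KilledState × Quadrant) (KilledState × Quadrant) :=
  open Classical in
  Kernel.piecewise (measurableSet_metHistories n)
    ((maximalKernel hl).comap (fun x => (lastState n x).2) (measurable_lastState n).snd)
    ((exactKernel l ∥ₖ idealKernel).comap (lastState n) (measurable_lastState n))

instance {l : ℝ} (hl : 0 < l) (n : ℕ) : IsMarkovKernel (pairKernel hl n) := by
  have := isMarkovKernel_maximalKernel hl
  have := isMarkovKernel_exactKernel hl
  unfold pairKernel
  infer_instance

theorem pairKernel_apply_of_met {l : ℝ} (hl : 0 < l) {n : ℕ}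
    {x : Finset.Iic n → KilledState × Quadrant} (hx : x ∈ metHistories n) :
    pairKernel hl n x = maximalCoupling l (lastState n x).2 := by
  classical
  rw [pairKernel, Kernel.piecewise_apply, if_pos hx, Kernel.comap_apply]
  rfl

theorem pairKernel_apply_of_not_met {l : ℝ} (hl : 0 < l) {n : ℕ}
    {x : Finset.Iic n → KilledState × Quadrant} (hx : x ∉ metHistories n) :
    pairKernel hl n x =
      (exactStep l (lastState n x).1).prod (idealStep (lastState n x).2) := by
  have := isMarkovKernel_exactKernel hl
  classical
  rw [pairKernel, Kernel.piecewise_apply, if_neg hx, Kernel.comap_apply, Kernel.parallelComp_apply]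
  rfl

theorem pairKernel_fst {l : ℝ} (hl : 0 < l) {n : ℕ} (x : Finset.Iic n → KilledState × Quadrant)
    {s : Set KilledState} (hs : MeasurableSet s) :
    pairKernel hl n x (s ×ˢ Set.univ) = exactStep l (lastState n x).1 s := by
  by_cases hx : x ∈ metHistories n
  · rw [pairKernel_apply_of_met hl hx, maximalCoupling_fst hl _ hs]
    exact congrArg (fun a => exactStep l a s) (hx _).symm
  · rw [pairKernel_apply_of_not_met hl hx, Measure.prod_prod, measure_univ, mul_one]

theorem pairKernel_snd {l : ℝ} (hl : 0 < l) {n : ℕ} (x : Finset.Iic n → KilledState × Quadrant)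
    {t : Set Quadrant} (ht : MeasurableSet t) :
    pairKernel hl n x (Set.univ ×ˢ t) = idealStep (lastState n x).2 t := by
  by_cases hx : x ∈ metHistories n
  · rw [pairKernel_apply_of_met hl hx, maximalCoupling_snd hl _ ht]
  · rw [pairKernel_apply_of_not_met hl hx, Measure.prod_prod, exactStep_univ hl, one_mul]

theorem measurableSet_past_iff {n : ℕ} {A : Set Path} (hA : MeasurableSet[past n] A) :
    ∃ B : Set (Finset.Iic n → KilledState × Quadrant), MeasurableSet B ∧
      A = Preorder.frestrictLe n ⁻¹' B := by
  obtain ⟨C, hC, rfl⟩ := hA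
  refine ⟨(fun x (k : Set.Iic n) => x ⟨k, Finset.mem_Iic.2 k.2⟩) ⁻¹' C, ?_, rfl⟩
  exact (measurable_pi_lambda _ fun k => measurable_pi_apply _) hC

/-- The one-step conditional law of the Ionescu-Tulcea measure, tested on events of the past. -/
theorem measure_inter_next {l : ℝ} (hl : 0 < l) (μ : Measure (KilledState × Quadrant))
    [IsProbabilityMeasure μ] {n : ℕ} {A : Set Path} (hA : MeasurableSet[past n] A)
    {C : Set (KilledState × Quadrant)} (hC : MeasurableSet C) :
    Kernel.trajMeasure (X := fun _ => KilledState × Quadrant) μ (pairKernel hl)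
        (A ∩ (fun ω => ω (n + 1)) ⁻¹' C) =
      ∫⁻ ω in A, pairKernel hl n (Preorder.frestrictLe n ω) C
        ∂Kernel.trajMeasure (X := fun _ => KilledState × Quadrant) μ (pairKernel hl) := by
  obtain ⟨B, hB, rfl⟩ := measurableSet_past_iff hA
  have h := Kernel.map_frestrictLe_trajMeasure_compProd_eq_map_trajMeasure
    (X := fun _ => KilledState × Quadrant) (μ₀ := μ) (κ := pairKernel hl) (a := n)
  have hf : Measurable (Preorder.frestrictLe (π := fun _ => KilledState × Quadrant) n) :=
    Preorder.measurable_frestrictLe n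
  have h2 := congrArg (fun ν => ν (B ×ˢ C)) h
  rw [Measure.compProd_apply_prod hB hC, Measure.map_apply (by fun_prop) (hB.prod hC),
    setLIntegral_map hB (Kernel.measurable_coe _ hC) hf] at h2
  exact h2.symm

theorem trajMeasure_map_zero {l : ℝ} (hl : 0 < l) (μ : Measure (KilledState × Quadrant))
    [IsProbabilityMeasure μ] :
    (Kernel.trajMeasure (X := fun _ => KilledState × Quadrant) μ (pairKernel hl)).map
      (fun ω => ω 0) = μ := by
  have he : (fun ω : Path => ω 0) =
      (fun x : Finset.Iic 0 → KilledState × Quadrant => x ⟨0, Finset.mem_Iic.2 le_rfl⟩) ∘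
        Preorder.frestrictLe 0 := rfl
  have hf : Measurable (Preorder.frestrictLe (π := fun _ => KilledState × Quadrant) 0) :=
    Preorder.measurable_frestrictLe 0
  rw [he, ← Measure.map_map (measurable_pi_apply _) hf, Kernel.trajMeasure,
    Measure.map_comp _ _ hf, Kernel.traj_map_frestrictLe, Kernel.partialTraj_self,
    Measure.id_comp, Measure.map_map (measurable_pi_apply _) (MeasurableEquiv.measurable _)]
  exact Measure.map_id

theorem exists_isCoupling {l : ℝ} (hl : 0 < l) (h1 : IsProbabilityMeasure (initialLaw l))
    (h2 : ∀ᵐ x ∂initialLaw l, 0 < x.1 ∧ 0 < x.2) : ∃ P : Measure Path, IsCoupling l P := by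
  -- The initial law is carried by the open quadrant, so restricting it there loses no mass; placed
  -- on the diagonal, it starts the pair.
  set ν : Measure Quadrant := (initialLaw l).comap Subtype.val with hν
  have hνmap : ν.map Subtype.val = initialLaw l := by
    rw [hν]
    refine (map_comap_subtype_coe measurableSet_quadrant _).trans ?_
    exact Measure.restrict_eq_self_of_ae_mem h2
  have hνp : IsProbabilityMeasure ν := by
    refine ⟨?_⟩
    have := congrArg (fun m => m Set.univ) hνmap
    simpa [Measure.map_apply measurable_subtype_coe] using this
  have hd : Measurable fun y : Quadrant => ((Sum.inl y : KilledState), y) := by fun_prop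
  set μ : Measure (KilledState × Quadrant) := ν.map fun y => (Sum.inl y, y) with hμ
  have hμp : IsProbabilityMeasure μ := Measure.isProbabilityMeasure_map hd.aemeasurable
  have h0 := trajMeasure_map_zero hl μ
  have he : ∀ n, Measurable fun ω : Path => ω n := fun n => measurable_pi_apply n
  refine ⟨Kernel.trajMeasure (X := fun _ => KilledState × Quadrant) μ (pairKernel hl),
    inferInstance, ?_, ?_, ?_, ?_, ?_, ?_⟩
  · have : ∀ᵐ p ∂μ, p.1 = Sum.inl p.2 :=
      (ae_map_iff hd.aemeasurable measurableSet_diagonal).2 (ae_of_all _ fun _ => rfl)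
    rw [← h0] at this
    exact ae_of_ae_map (he 0).aemeasurable this
  · have e : (fun ω : Path => (idealChain 0 ω : ℝ × ℝ)) =
      (fun p : KilledState × Quadrant => (p.2 : ℝ × ℝ)) ∘ fun ω => ω 0 := rfl
    rw [e, ← Measure.map_map (by fun_prop) (he 0), h0, hμ, Measure.map_map (by fun_prop) hd]
    exact hνmap
  · intro n A hA s hs
    have := measure_inter_next hl μ hA (hs.prod MeasurableSet.univ)
    simp only [pairKernel_fst hl _ hs] at this
    rw [Set.prod_univ] at this
    exact this
  · intro n A hA t ht
    have := measure_inter_next hl μ hA (MeasurableSet.univ.prod ht)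
    simp only [pairKernel_snd hl _ ht] at this
    rw [Set.univ_prod] at this
    exact this
  · intro n A hA hAm
    refine (measure_inter_next hl μ hA measurableSet_diagonal).trans ?_
    refine setLIntegral_congr_fun (Measurable.comap_le (by fun_prop) _ hA) fun ω hω => ?_
    have hm : Preorder.frestrictLe n ω ∈ metHistories n := fun i =>
      hAm hω i (Finset.mem_Iic.1 i.2)
    rw [pairKernel_apply_of_met hl hm, maximalCoupling_diagonal hl]
    rfl
  · intro n A hA hAm s hs t ht
    refine (measure_inter_next hl μ hA (hs.prod ht)).trans ?_
    refine setLIntegral_congr_fun (Measurable.comap_le (by fun_prop) _ hA) fun ω hω => ?_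
    have hm : Preorder.frestrictLe n ω ∉ metHistories n := fun h =>
      Set.disjoint_left.1 hAm hω fun k hk => h ⟨k, Finset.mem_Iic.2 hk⟩
    rw [pairKernel_apply_of_not_met hl hm, Measure.prod_prod]
    rfl

/-! ### A supermartingale controlling the accumulated coupling error -/

/-- Bound for the probability that the two steps from `x` cannot be made to coincide. -/
noncomputable def stepError (k : ℝ) (x : ℝ × ℝ) : ℝ :=
  164 * (k ^ 4)⁻¹ * (x.1 ^ 5 * x.2⁻¹ ^ 3 + x.1⁻¹ ^ 4)

/-- A function whose decrease along the idealized chain above the level `θ` dominates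
`stepError`. -/
noncomputable def potential (k θ d : ℝ) (x : ℝ × ℝ) : ℝ :=
  164 * (k ^ 4)⁻¹ * (3 * (x.1 ^ 5 * x.2⁻¹ ^ 3) + 34 / d * θ ^ (-4 - d) * x.1 ^ d)

theorem one_sub_overlap_le {k : ℝ} (hk : 0 < k) (x : Quadrant) :
    1 - overlap (k ^ 3) x ≤ ENNReal.ofReal (stepError k x) :=
  tsub_le_iff_left.2 (one_le_overlap_add hk x)

/-- Above level `θ` the term `b⁵ / h³` contracts but leaves a multiple of `b⁻⁴`, which is dominated
by `θ ^ (-4 - d) * b ^ d`; the contraction of `b ^ d` compensates the factor `1 / d` of its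
coefficient. -/
theorem lintegral_potential_add_le {k θ d : ℝ} (hk : 0 < k) (hθ : 0 < θ) (hd : 0 < d) (hd1 : d ≤ 1)
    (x : Quadrant) (hx : θ ≤ x.1.1) :
    ∫⁻ y, ENNReal.ofReal (potential k θ d y) ∂idealStep x + ENNReal.ofReal (stepError k x) ≤
      ENNReal.ofReal (potential k θ d x) := by
  have h1 := lintegral_idealStep_rpow_mul_inv_cube_le x (p := 5) (by norm_num)
  have h2 := lintegral_idealStep_rpow x hd.le
  obtain ⟨⟨b, h⟩, hb, hh⟩ := x
  simp only at hb hh hx h1 h2 ⊢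
  set c := 164 * (k ^ 4)⁻¹ with hc
  have hc0 : 0 < c := by positivity
  have hΘ : 0 < θ ^ (-4 - d) := by positivity
  have e : ∀ y : Quadrant, ENNReal.ofReal (potential k θ d y) =
      ENNReal.ofReal (3 * c) * ENNReal.ofReal (y.1.1 ^ (5 : ℝ) * y.1.2⁻¹ ^ 3) +
      ENNReal.ofReal (c * (34 / d * θ ^ (-4 - d))) * ENNReal.ofReal (y.1.1 ^ d) := by
    intro y
    have hy1 := y.2.1
    have hy2 := y.2.2
    rw [← ENNReal.ofReal_mul (by positivity), ← ENNReal.ofReal_mul (by positivity),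
      ← ENNReal.ofReal_add (by positivity) (by positivity), potential,
      show (5 : ℝ) = ((5 : ℕ) : ℝ) by norm_num, Real.rpow_natCast]
    congr 1
    ring
  simp_rw [e]
  rw [lintegral_add_left (by fun_prop), lintegral_const_mul _ (by fun_prop),
    lintegral_const_mul _ (by fun_prop), h2]
  refine (add_le_add_left (add_le_add_left (mul_le_mul_right h1 _) _) _).trans ?_
  rw [← ENNReal.ofReal_mul (by positivity), ← ENNReal.ofReal_mul (by positivity),
    ← ENNReal.ofReal_add (by positivity) (by positivity),
    ← ENNReal.ofReal_add (by positivity) (by rw [stepError]; positivity)]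
  refine ENNReal.ofReal_le_ofReal ?_
  rw [stepError, potential, ← hc, show (5 : ℝ) = ((5 : ℕ) : ℝ) by norm_num, Real.rpow_natCast]
  simp only
  have e9 : b ^ 5 * b⁻¹ ^ 9 = b⁻¹ ^ 4 := by field_simp
  have hpow : b⁻¹ ^ 4 ≤ θ ^ (-4 - d) * b ^ d := by
    have : b⁻¹ ^ 4 = b ^ (-4 - d) * b ^ d := by
      rw [← Real.rpow_add hb, sub_add_cancel, Real.rpow_neg hb.le, inv_pow]
      norm_cast
    rw [this]
    have := Real.rpow_le_rpow_of_nonpos hθ hx (show -4 - d ≤ 0 by linarith)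
    gcongr
  -- The margins are `45 / 28 + 1 ≤ 3` for `b⁵ / h³` and `90 / 7 + 1 ≤ 34 * 5 / 12 = 85 / 6` for
  -- `b⁻⁴`; this explains the constants `3` and `34`.
  have hκ : 6 / ((d + 2) * (d + 3)) ≤ 1 - 5 / 12 * d := by
    rw [div_le_iff₀ (by positivity)]
    nlinarith [mul_nonneg hd.le (sub_nonneg.2 hd1), mul_nonneg hd.le hd.le,
      mul_nonneg (mul_nonneg hd.le hd.le) (sub_nonneg.2 hd1)]
  set T := θ ^ (-4 - d) * b ^ d with hT
  have hT0 : 0 ≤ T := by positivity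
  set S := b ^ 5 * h⁻¹ ^ 3 with hS
  have hS0 : 0 ≤ S := by positivity
  have h3 : 34 / d * T * (6 / ((d + 2) * (d + 3))) ≤ 34 / d * T * (1 - 5 / 12 * d) := by gcongr
  have h4 : 34 / d * T * (1 - 5 / 12 * d) = 34 / d * T - 85 / 6 * T := by field_simp; ring
  have h5 : 3 * (6 / ((5 + 2) * (5 + 3)) * b ^ 5 * (5 * h⁻¹ ^ 3 + 40 * b⁻¹ ^ 9)) =
      45 / 28 * S + 90 / 7 * b⁻¹ ^ 4 := by rw [← e9, hS]; ring
  calc _ = c * (3 * (6 / ((5 + 2) * (5 + 3)) * b ^ 5 * (5 * h⁻¹ ^ 3 + 40 * b⁻¹ ^ 9)) +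
        34 / d * T * (6 / ((d + 2) * (d + 3))) + (S + b⁻¹ ^ 4)) := by rw [hT]; push_cast; ring
    _ ≤ c * (3 * S + 34 / d * T) := by
        refine mul_le_mul_of_nonneg_left ?_ hc0.le
        rw [h5]
        have : 0 ≤ b⁻¹ ^ 4 := by positivity
        linarith
    _ = _ := by rw [hT]; ring

/-- The potential, cut off below the level `θ`. -/
noncomputable def cutPotential (k θ d : ℝ) (x : ℝ × ℝ) : ℝ≥0∞ :=
  {x : ℝ × ℝ | θ ≤ x.1}.indicator (fun x => ENNReal.ofReal (potential k θ d x)) x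

theorem measurable_cutPotential (k θ d : ℝ) : Measurable (cutPotential k θ d) := by
  have : Measurable (potential k θ d) := by unfold potential; fun_prop
  exact this.ennreal_ofReal.indicator (measurableSet_le (by fun_prop) (by fun_prop))

/-- The half-basis decreases along the idealized chain. Once below `θ` it stays there, so the
cut-off does not spoil the supermartingale inequality. -/
theorem lintegral_cutPotential_add_le {k θ d : ℝ} (hk : 0 < k) (hθ : 0 < θ) (hd : 0 < d)
    (hd1 : d ≤ 1) (x : Quadrant) :
    ∫⁻ y : Quadrant, cutPotential k θ d y ∂idealStep x +
      {x : ℝ × ℝ | θ ≤ x.1}.indicator (fun x => ENNReal.ofReal (stepError k x)) x ≤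
      cutPotential k θ d x := by
  by_cases hx : θ ≤ x.1.1
  · rw [cutPotential, Set.indicator_of_mem (by exact hx), Set.indicator_of_mem (by exact hx)]
    refine le_trans (add_le_add_left (lintegral_mono fun y => ?_) _)
      (lintegral_potential_add_le hk hθ hd hd1 x hx)
    exact Set.indicator_le_self' (fun _ _ => zero_le) _
  · rw [Set.indicator_of_notMem (by exact hx), add_zero]
    refine le_of_eq_of_le ?_ zero_le
    have hm : Measurable fun y : Quadrant => cutPotential k θ d y :=
      (measurable_cutPotential k θ d).comp measurable_subtype_coe
    rw [lintegral_eq_zero_iff hm]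
    filter_upwards [ae_idealStep_lt x] with y hy
    have hy' : (y : ℝ × ℝ) ∉ {x : ℝ × ℝ | θ ≤ x.1} := fun h => hx (le_trans h hy.le)
    rw [cutPotential, Set.indicator_of_notMem hy', Pi.zero_apply]

/-! ### The coupling event -/

theorem measurable_idealChain (n : ℕ) : Measurable (idealChain n) :=
  (measurable_pi_apply n).snd

theorem past_le (n : ℕ) : past n ≤ (inferInstance : MeasurableSpace Path) :=
  Measurable.comap_le (by fun_prop)

theorem measurable_past_apply {n k : ℕ} (hk : k ≤ n) :
    Measurable[past n] (fun ω : Path => ω k) :=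
  (measurable_pi_apply (⟨k, hk⟩ : Set.Iic n)).comp
    (comap_measurable fun (ω : Path) (k : Set.Iic n) => ω k)

theorem measurableSet_past_meet {n k : ℕ} (hk : k ≤ n) : MeasurableSet[past n] (meet k) :=
  measurable_past_apply hk measurableSet_diagonal

theorem measurableSet_meet (n : ℕ) : MeasurableSet (meet n) :=
  past_le n _ (measurableSet_past_meet le_rfl)

/-- The chains have coincided up to time `n`, and the idealized one has stayed above the level `θ`
at the times `1, …, n`. -/
def goodUpTo (θ : ℝ) (n : ℕ) : Set Path :=
  meetUpTo n ∩ {ω | ∀ k, 1 ≤ k → k ≤ n → θ ≤ (idealChain k ω : ℝ × ℝ).1}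

theorem measurableSet_past_goodUpTo (θ : ℝ) (n : ℕ) : MeasurableSet[past n] (goodUpTo θ n) := by
  have h1 : meetUpTo n = ⋂ k, ⋂ (_ : k ≤ n), meet k := by
    ext ω
    simp [meetUpTo]
  have h2 : {ω : Path | ∀ k, 1 ≤ k → k ≤ n → θ ≤ (idealChain k ω : ℝ × ℝ).1} =
      ⋂ k, ⋂ (_ : 1 ≤ k), ⋂ (_ : k ≤ n), (fun ω : Path => ω k) ⁻¹'
        {p : KilledState × Quadrant | θ ≤ p.2.1.1} := by
    ext ω
    simp [idealChain]
  rw [goodUpTo, h1, h2]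
  refine MeasurableSet.inter
    (MeasurableSet.iInter fun k => MeasurableSet.iInter fun hk => measurableSet_past_meet hk)
    (MeasurableSet.iInter fun k => MeasurableSet.iInter fun _ => MeasurableSet.iInter fun hk =>
      measurable_past_apply hk (measurableSet_le (by fun_prop) (by fun_prop)))

theorem goodUpTo_succ_subset (θ : ℝ) (n : ℕ) : goodUpTo θ (n + 1) ⊆ goodUpTo θ n :=
  fun _ h => ⟨fun k hk => h.1 k (hk.trans n.le_succ), fun k h1 hk => h.2 k h1 (hk.trans n.le_succ)⟩

/-- If `n + 1 ≤ τ`, the half-basis was at least `θ` at all times `1, …, n`. Coincidence at `τ`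
itself therefore only involves steps from states still above the level, or from time `0`. -/
theorem mem_couplingEvent {l ε₀ : ℝ} {ω : Path} (h0 : ω ∈ meet 0)
    (h : ∀ n, ω ∈ goodUpTo (l ^ ((ε₀ - 1) / 3)) n → ω ∈ meet (n + 1)) :
    ω ∈ couplingEvent l ε₀ := by
  have key : ∀ n : ℕ, (n : ℕ∞) ≤ stopTime l ε₀ ω → ω ∈ meetUpTo n := by
    intro n
    induction n with
    | zero =>
      intro _ k hk
      rwa [Nat.le_zero.1 hk]
    | succ n ih =>
      intro hn k hk
      have hlt : (n : ℕ∞) < stopTime l ε₀ ω := lt_of_lt_of_le (by exact_mod_cast n.lt_succ_self) hn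
      have hm := ih hlt.le
      rcases Nat.lt_or_ge k (n + 1) with h1 | h1
      · exact hm k (Nat.lt_succ_iff.1 h1)
      · rw [le_antisymm hk h1]
        refine h n ⟨hm, fun j hj hjn => ?_⟩
        by_contra hlow
        have hle : stopTime l ε₀ ω ≤ (j : ℕ∞) := sInf_le ⟨j, ⟨hj, not_le.1 hlow⟩, rfl⟩
        have : (j : ℕ∞) ≤ n := by exact_mod_cast hjn
        exact absurd (hle.trans this) (not_le.2 hlt)
  exact fun n _ hn => key n hn n le_rfl

namespace IsCoupling

variable {l : ℝ} {P : Measure Path}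

theorem lintegral_next (hP : IsCoupling l P) {n : ℕ} {A : Set Path} (hA : MeasurableSet[past n] A)
    {f : Quadrant → ℝ≥0∞} (hf : Measurable f) :
    ∫⁻ ω in A, f (idealChain (n + 1) ω) ∂P =
      ∫⁻ ω in A, ∫⁻ y, f y ∂idealStep (idealChain n ω) ∂P := by
  have hm : (P.restrict A).map (idealChain (n + 1)) =
      (P.restrict A).bind fun ω => idealStep (idealChain n ω) := by
    ext t ht
    have hmk : Measurable fun ω : Path => idealStep (idealChain n ω) :=
      measurable_idealStep.comp (measurable_idealChain n)
    rw [Measure.map_apply (measurable_idealChain _) ht, Measure.bind_apply ht hmk.aemeasurable,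
      Measure.restrict_apply (measurable_idealChain _ ht), Set.inter_comm]
    exact hP.ideal_step n A hA t ht
  have hmk : Measurable fun ω : Path => idealStep (idealChain n ω) :=
    measurable_idealStep.comp (measurable_idealChain n)
  rw [← lintegral_map hf (measurable_idealChain _), hm,
    Measure.lintegral_bind hmk.aemeasurable hf.aemeasurable]

theorem measure_diff_meet_le (hP : IsCoupling l P) {n : ℕ} {A : Set Path}
    (hA : MeasurableSet[past n] A) (hAm : A ⊆ meetUpTo n) :
    P (A \ meet (n + 1)) ≤ ∫⁻ ω in A, (1 - overlap l (idealChain n ω)) ∂P := by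
  have := hP.prob
  have hm : Measurable fun ω : Path => overlap l (idealChain n ω) :=
    (measurable_overlap l).comp (measurable_idealChain n)
  rw [← Set.sdiff_inter_self_eq_sdiff, Set.inter_comm, measure_sdiff Set.inter_subset_left
    ((past_le n _ hA).inter (measurableSet_meet _)).nullMeasurableSet (measure_ne_top _ _),
    tsub_le_iff_left, hP.coupled_step n A hA hAm,
    ← lintegral_add_left hm]
  calc P A = ∫⁻ _ in A, 1 ∂P := by simp
    _ ≤ _ := lintegral_mono fun ω => le_add_tsub

/-- Union bound over the first time of separation; the expected step errors telescope against the
decrease of the cut potential. -/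
theorem measure_couplingEvent_compl_le (hP : IsCoupling l P) {k θ d ε₀ : ℝ} (hk : 0 < k)
    (hl : l = k ^ 3) (hθ : θ = l ^ ((ε₀ - 1) / 3)) (hd : 0 < d) (hd1 : d ≤ 1) :
    1 ≤ P (couplingEvent l ε₀) + (∫⁻ ω, (1 - overlap l (idealChain 0 ω)) ∂P +
      ∫⁻ ω, cutPotential k θ d (idealChain 0 ω) ∂P) := by
  have hprob := hP.prob
  have hθ0 : 0 < θ := by rw [hθ, hl]; positivity
  set E : Quadrant → ℝ≥0∞ := fun x =>
    {x : ℝ × ℝ | θ ≤ x.1}.indicator (fun x => ENNReal.ofReal (stepError k x)) x with hE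
  have hG : Measurable fun x : Quadrant => cutPotential k θ d x :=
    (measurable_cutPotential k θ d).comp measurable_subtype_coe
  have hEm : Measurable E := by
    have : Measurable (stepError k) := by unfold stepError; fun_prop
    exact (this.ennreal_ofReal.indicator
      (measurableSet_le (by fun_prop) (by fun_prop))).comp measurable_subtype_coe
  set B : ℕ → Set Path := fun n => goodUpTo θ n \ meet (n + 1) with hB
  have hgood : ∀ n, MeasurableSet (goodUpTo θ n) := fun n =>
    past_le n _ (measurableSet_past_goodUpTo θ n)
  have hBm : ∀ n, MeasurableSet (B n) := fun n => (hgood n).diff (measurableSet_meet _)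
  have hsum : ∀ N, ∑ n ∈ Finset.range N, ∫⁻ ω in goodUpTo θ n, E (idealChain n ω) ∂P +
      ∫⁻ ω in goodUpTo θ N, cutPotential k θ d (idealChain N ω) ∂P ≤
      ∫⁻ ω, cutPotential k θ d (idealChain 0 ω) ∂P := by
    intro N
    induction N with
    | zero => simpa using setLIntegral_le_lintegral _ _
    | succ N ih =>
      refine le_trans ?_ ih
      rw [Finset.sum_range_succ, add_assoc]
      gcongr
      calc _ ≤ ∫⁻ ω in goodUpTo θ N, E (idealChain N ω) ∂P +
            ∫⁻ ω in goodUpTo θ N, cutPotential k θ d (idealChain (N + 1) ω) ∂P := by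
            gcongr
            exact goodUpTo_succ_subset θ N
        _ = ∫⁻ ω in goodUpTo θ N, (E (idealChain N ω) +
              ∫⁻ y : Quadrant, cutPotential k θ d y ∂idealStep (idealChain N ω)) ∂P := by
            have hm : Measurable fun ω : Path => E (idealChain N ω) :=
              hEm.comp (measurable_idealChain N)
            rw [hP.lintegral_next (measurableSet_past_goodUpTo θ N) hG, lintegral_add_left hm]
        _ ≤ _ := lintegral_mono fun ω => by
            rw [add_comm]
            exact lintegral_cutPotential_add_le hk hθ0 hd hd1 _
  -- Time `0` keeps its true failure probability, since nothing forces the initial half-basis to be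
  -- at least `θ`.
  have hBle : ∀ n, P (B n) ≤
      (if n = 0 then ∫⁻ ω, (1 - overlap l (idealChain 0 ω)) ∂P else 0) +
        ∫⁻ ω in goodUpTo θ n, E (idealChain n ω) ∂P := by
    intro n
    have h1 := hP.measure_diff_meet_le (measurableSet_past_goodUpTo θ n) Set.inter_subset_left
    refine h1.trans ?_
    split_ifs with hn
    · subst hn
      exact (setLIntegral_le_lintegral _ _).trans le_self_add
    · rw [zero_add]
      refine setLIntegral_mono' (hgood n) fun ω hω => ?_
      have hmem : θ ≤ (idealChain n ω : ℝ × ℝ).1 := hω.2 n (Nat.one_le_iff_ne_zero.2 hn) le_rfl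
      simp only [hE]
      rw [Set.indicator_of_mem (by exact hmem), hl]
      exact one_sub_overlap_le hk _
  have hU : P ((meet 0)ᶜ ∪ ⋃ n, B n) ≤ ∫⁻ ω, (1 - overlap l (idealChain 0 ω)) ∂P +
      ∫⁻ ω, cutPotential k θ d (idealChain 0 ω) ∂P := by
    refine (measure_union_le _ _).trans ?_
    have h0 : P (meet 0)ᶜ = 0 := hP.init_meet
    rw [h0, zero_add]
    refine (measure_iUnion_le _).trans ((ENNReal.tsum_le_tsum hBle).trans ?_)
    rw [ENNReal.tsum_add, tsum_ite_eq]
    gcongr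
    rw [ENNReal.tsum_eq_iSup_nat]
    exact iSup_le fun N => le_self_add.trans (hsum N)
  have hsub : ((meet 0)ᶜ ∪ ⋃ n, B n)ᶜ ⊆ couplingEvent l ε₀ := by
    intro ω hω
    simp only [Set.mem_compl_iff, Set.mem_union, not_or, not_not, Set.mem_iUnion, not_exists] at hω
    refine mem_couplingEvent hω.1 fun n hn => ?_
    by_contra hc
    rw [← hθ] at hn
    exact hω.2 n ⟨hn, hc⟩
  have hUm : MeasurableSet ((meet 0)ᶜ ∪ ⋃ n, B n) :=
    (measurableSet_meet 0).compl.union (MeasurableSet.iUnion hBm)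
  calc 1 = P ((meet 0)ᶜ ∪ ⋃ n, B n)ᶜ + P ((meet 0)ᶜ ∪ ⋃ n, B n) := by
        rw [add_comm, measure_add_measure_compl hUm, measure_univ]
    _ ≤ _ := add_le_add (measure_mono hsub) hU

theorem one_le_measure_couplingEvent_add (hP : IsCoupling l P) {k d ε₀ : ℝ} (hk : 0 < k)
    (hl : l = k ^ 3) (hd : 0 < d) (hd1 : d ≤ 1) (hinit : ∀ᵐ x ∂initialLaw l, 1 ≤ x.2) :
    1 ≤ P (couplingEvent l ε₀) +
      ENNReal.ofReal (164 * (k⁻¹ + 4 * (k ^ 4)⁻¹ +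
        34 / d * ((k ^ 4)⁻¹ * (l ^ ((ε₀ - 1) / 3)) ^ (-4 - d)))) *
      ∫⁻ x, ENNReal.ofReal (1 + x.1 ^ 5 + x.1⁻¹) ∂initialLaw l := by
  have hprob := hP.prob
  have h := hP.measure_couplingEvent_compl_le hk hl (ε₀ := ε₀) rfl hd hd1
  set θ := l ^ ((ε₀ - 1) / 3) with hθ
  have hθ0 : 0 < θ := by rw [hθ, hl]; positivity
  refine h.trans (add_le_add le_rfl ?_)
  have hm0 : Measurable fun ω : Path => (idealChain 0 ω : ℝ × ℝ) :=
    measurable_subtype_coe.comp (measurable_idealChain 0)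
  have hge : ∀ᵐ ω ∂P, 1 ≤ (idealChain 0 ω : ℝ × ℝ).2 := by
    rw [← hP.init_law] at hinit
    exact ae_of_ae_map hm0.aemeasurable hinit
  have hm1 : Measurable fun ω : Path => 1 - overlap l (idealChain 0 ω) :=
    measurable_const.sub ((measurable_overlap l).comp (measurable_idealChain 0))
  rw [← hP.init_law, lintegral_map (by fun_prop) hm0, ← lintegral_const_mul _ (by fun_prop),
    ← lintegral_add_left hm1]
  refine lintegral_mono_ae ?_
  filter_upwards [hge] with ω hω
  generalize idealChain 0 ω = x at hω
  -- The failure probability is at most one, so `(k b)⁻⁴` may be replaced by `(k b)⁻¹`. This matters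
  -- because the initial weight vanishes only linearly in `B_0`, and `B_0⁻⁴` is not integrable.
  have h1 : 1 - overlap l x ≤ ENNReal.ofReal (164 * ((k ^ 4)⁻¹ * x.1.1 ^ 5 + k⁻¹ * x.1.1⁻¹)) := by
    rcases le_total 1 (k⁻¹ * x.1.1⁻¹) with h1 | h1
    · refine tsub_le_self.trans ?_
      rw [← ENNReal.ofReal_one]
      refine ENNReal.ofReal_le_ofReal ?_
      have : 0 ≤ (k ^ 4)⁻¹ * x.1.1 ^ 5 := by
        have := x.2.1
        positivity
      linarith
    · rw [hl]
      refine (one_sub_overlap_le hk x).trans (ENNReal.ofReal_le_ofReal ?_)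
      have hx := x.2.1
      have h2 : (k⁻¹ * x.1.1⁻¹) ^ 4 ≤ k⁻¹ * x.1.1⁻¹ :=
        pow_le_of_le_one (by positivity) h1 (by norm_num)
      have h3 : x.1.2⁻¹ ^ 3 ≤ 1 := pow_le_one₀ (by positivity) (inv_le_one_of_one_le₀ hω)
      have h4 : (k ^ 4)⁻¹ * (x.1.1 ^ 5 * x.1.2⁻¹ ^ 3) ≤ (k ^ 4)⁻¹ * (x.1.1 ^ 5 * 1) := by gcongr
      rw [mul_pow, inv_pow] at h2
      rw [stepError]
      linarith
  have h2 : cutPotential k θ d x ≤ ENNReal.ofReal (164 * ((k ^ 4)⁻¹ * (3 * x.1.1 ^ 5 +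
      34 / d * θ ^ (-4 - d) * (1 + x.1.1 ^ 5)))) := by
    refine (Set.indicator_le_self' (fun _ _ => zero_le) _).trans (ENNReal.ofReal_le_ofReal ?_)
    have hx := x.2.1
    have h3 : x.1.2⁻¹ ^ 3 ≤ 1 := pow_le_one₀ (by positivity) (inv_le_one_of_one_le₀ hω)
    have h4 : x.1.1 ^ d ≤ 1 + x.1.1 ^ 5 := by
      rcases le_total x.1.1 1 with h1 | h1
      · have := Real.rpow_le_one hx.le h1 hd.le
        have : 0 < x.1.1 ^ 5 := by positivity
        linarith
      · have h5 := Real.rpow_le_rpow_of_exponent_le h1 (show d ≤ ((5 : ℕ) : ℝ) by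
          push_cast
          linarith)
        rw [Real.rpow_natCast] at h5
        linarith
    rw [potential, mul_assoc]
    gcongr
    exact mul_le_of_le_one_right (by positivity) h3
  have hx := x.2.1
  refine (add_le_add h1 h2).trans ?_
  have hΘ : 0 < θ ^ (-4 - d) := by positivity
  rw [← ENNReal.ofReal_add (by positivity) (by positivity), ← ENNReal.ofReal_mul (by positivity)]
  refine ENNReal.ofReal_le_ofReal ?_
  have i1 : 0 ≤ k⁻¹ * (1 + x.1.1 ^ 5) := by positivity
  have i2 : 0 ≤ (k ^ 4)⁻¹ * (1 + x.1.1⁻¹) := by positivity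
  have i3 : 0 ≤ 34 / d * ((k ^ 4)⁻¹ * θ ^ (-4 - d)) * x.1.1⁻¹ := by positivity
  linarith

end IsCoupling

end VoronoiChain

namespace VoronoiChain

/-! ### The initial law -/

/-- Both nuclei lie on a circle about the vertex, so half-chord and distance to the chord are the
radius times the sine and cosine of half the angle between them. -/
theorem initialPair_eq {k : ℝ} (hk : 0 < k) (q : ℝ × ℝ × ℝ × ℝ) :
    initialPair (k ^ 3) q =
      (k⁻¹ * (|radius (k ^ 3) q.1| * |Real.sin (((k ^ 2)⁻¹ * q.2.2.1 - (k ^ 2)⁻¹ * q.2.1) / 2)|),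
        (k ^ 3)⁻¹ *
          (|radius (k ^ 3) q.1| * |Real.cos (((k ^ 2)⁻¹ * q.2.2.1 - (k ^ 2)⁻¹ * q.2.1) / 2)|)) := by
  obtain ⟨-, -, h1, h2, -, -⟩ := rpow_thirds hk
  obtain ⟨r, θl, θc, θr⟩ := q
  set ρ := radius (k ^ 3) r
  simp only [initialPair, nucleus, topVertex, h1, h2]
  set a := (k ^ 2)⁻¹ * θc
  set b := (k ^ 2)⁻¹ * θl
  set x := (a - b) / 2 with hx
  have hcos : Real.cos a * Real.cos b + Real.sin a * Real.sin b =
      Real.cos x ^ 2 - Real.sin x ^ 2 := by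
    rw [← Real.cos_sub, show a - b = 2 * x by rw [hx]; ring, Real.cos_two_mul']
  have ha := Real.sin_sq_add_cos_sq a
  have hb := Real.sin_sq_add_cos_sq b
  have hxx := Real.sin_sq_add_cos_sq x
  have hdist : ∀ t : ℝ, dist (!₂[(0 : ℝ), k ^ 3] : EuclideanSpace ℝ (Fin 2))
      (!₂[ρ * Real.sin a, k ^ 3 - ρ * Real.cos a] +
        t • (!₂[ρ * Real.sin a, k ^ 3 - ρ * Real.cos a] -
          !₂[ρ * Real.sin b, k ^ 3 - ρ * Real.cos b])) =
      √(ρ ^ 2 * (Real.cos x ^ 2 + (1 + 2 * t) ^ 2 * Real.sin x ^ 2)) := by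
    intro t
    rw [EuclideanSpace.dist_eq]
    congr 1
    simp only [Fin.sum_univ_two, Real.dist_eq, sq_abs]
    simp
    have e : (ρ * Real.sin a + t * (ρ * Real.sin a - ρ * Real.sin b)) ^ 2 +
        (ρ * Real.cos a - t * (ρ * Real.cos b - ρ * Real.cos a)) ^ 2 =
      ρ ^ 2 * ((1 + t) ^ 2 * (Real.sin a ^ 2 + Real.cos a ^ 2) +
        t ^ 2 * (Real.sin b ^ 2 + Real.cos b ^ 2) -
        2 * t * (1 + t) * (Real.cos a * Real.cos b + Real.sin a * Real.sin b)) := by ring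
    rw [hcos, ha, hb] at e
    have e2 : ρ ^ 2 * (Real.cos x ^ 2 + (1 + 2 * t) ^ 2 * Real.sin x ^ 2) =
      ρ ^ 2 * ((1 + t) ^ 2 * (Real.sin x ^ 2 + Real.cos x ^ 2) +
        t ^ 2 * (Real.sin x ^ 2 + Real.cos x ^ 2) -
        2 * t * (1 + t) * (Real.cos x ^ 2 - Real.sin x ^ 2)) := by ring
    rw [hxx] at e2
    rw [e2, ← e]
    ring
  have hbase : dist (!₂[ρ * Real.sin a, k ^ 3 - ρ * Real.cos a] : EuclideanSpace ℝ (Fin 2))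
      !₂[ρ * Real.sin b, k ^ 3 - ρ * Real.cos b] = 2 * (|ρ| * |Real.sin x|) := by
    rw [EuclideanSpace.dist_eq, ← abs_mul,
      show 2 * |ρ * Real.sin x| = |2 * (ρ * Real.sin x)| by rw [abs_mul 2, abs_two],
      ← Real.sqrt_sq_eq_abs]
    congr 1
    simp only [Fin.sum_univ_two, Real.dist_eq, sq_abs]
    simp
    have e : (ρ * Real.sin a - ρ * Real.sin b) ^ 2 + (ρ * Real.cos b - ρ * Real.cos a) ^ 2 =
      ρ ^ 2 * ((Real.sin a ^ 2 + Real.cos a ^ 2) + (Real.sin b ^ 2 + Real.cos b ^ 2) -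
        2 * (Real.cos a * Real.cos b + Real.sin a * Real.sin b)) := by ring
    rw [e, hcos, ha, hb]
    linear_combination (-2 * ρ ^ 2) * hxx
  have hheight : Metric.infDist (!₂[(0 : ℝ), k ^ 3] : EuclideanSpace ℝ (Fin 2))
      (Set.range fun t : ℝ => !₂[ρ * Real.sin a, k ^ 3 - ρ * Real.cos a] +
        t • (!₂[ρ * Real.sin a, k ^ 3 - ρ * Real.cos a] -
          !₂[ρ * Real.sin b, k ^ 3 - ρ * Real.cos b])) = |ρ| * |Real.cos x| := by
    rw [← abs_mul, ← Real.sqrt_sq_eq_abs, mul_pow]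
    refine le_antisymm ?_ ?_
    -- The parameter `-1 / 2` gives the midpoint of the chord, the foot of the perpendicular.
    · refine (Metric.infDist_le_dist_of_mem (Set.mem_range_self (-1 / 2 : ℝ))).trans ?_
      rw [hdist]
      norm_num
    · rw [Metric.le_infDist (Set.range_nonempty _)]
      rintro _ ⟨t, rfl⟩
      rw [hdist]
      refine Real.sqrt_le_sqrt (mul_le_mul_of_nonneg_left ?_ (sq_nonneg ρ))
      have : 0 ≤ (1 + 2 * t) ^ 2 * Real.sin x ^ 2 := by positivity
      linarith
  rw [hbase, hheight]
  refine Prod.ext ?_ rfl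
  ring

theorem measurable_initialPair {k : ℝ} (hk : 0 < k) : Measurable (initialPair (k ^ 3)) := by
  rw [funext (initialPair_eq hk)]
  unfold radius
  fun_prop

theorem measurable_simplexArea (l : ℝ) : Measurable fun p : ℝ × ℝ × ℝ × ℝ =>
    simplexArea l p.1 p.2.1 p.2.2.1 p.2.2.2 := by
  unfold simplexArea
  refine Measurable.ite ?_ (by fun_prop) measurable_const
  refine measurableSet_and ?_ (measurableSet_and ?_ (measurableSet_and ?_
    (measurableSet_and ?_ ?_))) <;>
  exact measurableSet_lt (by fun_prop) (by fun_prop)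

theorem measurable_quadrupletWeight (l : ℝ) : Measurable (quadrupletWeight l) := by
  have h1 : Measurable fun q : ℝ × ℝ × ℝ × ℝ => simplexArea l (radius l q.1)
      (l ^ (-(2 / 3) : ℝ) * q.2.1) (l ^ (-(2 / 3) : ℝ) * q.2.2.1)
      (l ^ (-(2 / 3) : ℝ) * q.2.2.2) :=
    (measurable_simplexArea l).comp (f := fun q : ℝ × ℝ × ℝ × ℝ => (radius l q.1,
      l ^ (-(2 / 3) : ℝ) * q.2.1, l ^ (-(2 / 3) : ℝ) * q.2.2.1, l ^ (-(2 / 3) : ℝ) * q.2.2.2))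
      (by unfold radius; fun_prop)
  have h2 : Measurable fun q : ℝ × ℝ × ℝ × ℝ => diskCapArea l (radius l q.1) := by
    unfold diskCapArea radius
    fun_prop
  have h3 : Measurable fun q : ℝ × ℝ × ℝ × ℝ => radius l q.1 := by
    unfold radius
    fun_prop
  unfold quadrupletWeight
  fun_prop

theorem simplexArea_nonneg (v ρ φl φc φr : ℝ) : 0 ≤ simplexArea v ρ φl φc φr := by
  unfold simplexArea
  split_ifs <;> positivity

theorem diskCapArea_eq {v ρ : ℝ} (hv : 0 ≤ v) (hρ : 0 < ρ) (hvρ : v ≤ ρ) :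
    diskCapArea v ρ = ρ ^ 2 * (Real.arccos (v / ρ) -
      Real.sin (Real.arccos (v / ρ)) * Real.cos (Real.arccos (v / ρ))) := by
  have e1 : 1 - (ρ - v) / ρ = v / ρ := by field_simp; ring
  have e2 : 2 * (ρ - v) / ρ - (ρ - v) ^ 2 / ρ ^ 2 = 1 - (v / ρ) ^ 2 := by field_simp; ring
  have h0 : 0 ≤ v / ρ := by positivity
  rw [diskCapArea, e1, e2, Real.sin_arccos, Real.cos_arccos (by linarith)
    ((div_le_one hρ).2 hvρ), mul_comm (√_)]

/-! ### Bounds for the opening angle and the disk cap area -/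

theorem sin_cube_le_sub_sin_mul_cos {t : ℝ} (ht : 0 ≤ t) :
    2 / 3 * Real.sin t ^ 3 ≤ t - Real.sin t * Real.cos t := by
  have hd : ∀ y : ℝ, HasDerivAt (fun y => y - Real.sin y * Real.cos y - 2 / 3 * Real.sin y ^ 3)
      (2 * Real.sin y ^ 2 * (1 - Real.cos y)) y := by
    intro y
    refine (((hasDerivAt_id y).sub ((Real.hasDerivAt_sin y).mul (Real.hasDerivAt_cos y))).sub
      (((Real.hasDerivAt_sin y).pow 3).const_mul (2 / 3))).congr_deriv ?_
    have := Real.sin_sq_add_cos_sq y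
    push_cast
    linear_combination -this
  have hmono : Monotone fun y => y - Real.sin y * Real.cos y - 2 / 3 * Real.sin y ^ 3 := by
    refine monotone_of_deriv_nonneg (fun y => (hd y).differentiableAt) fun y => ?_
    rw [(hd y).deriv]
    have := sub_nonneg.2 (Real.cos_le_one y)
    positivity
  have := hmono ht
  simp at this
  linarith

theorem sub_sin_mul_cos_le {t : ℝ} (ht : 0 ≤ t) :
    t - Real.sin t * Real.cos t ≤ 2 / 3 * t ^ 3 := by
  have hd : ∀ y : ℝ, HasDerivAt (fun y => 2 / 3 * y ^ 3 - (y - Real.sin y * Real.cos y))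
      (2 * (y ^ 2 - Real.sin y ^ 2)) y := by
    intro y
    refine (((hasDerivAt_pow 3 y).const_mul (2 / 3)).sub
      ((hasDerivAt_id y).sub ((Real.hasDerivAt_sin y).mul (Real.hasDerivAt_cos y)))).congr_deriv ?_
    have := Real.sin_sq_add_cos_sq y
    push_cast
    linear_combination this
  have hmono : Monotone fun y => 2 / 3 * y ^ 3 - (y - Real.sin y * Real.cos y) := by
    refine monotone_of_deriv_nonneg (fun y => (hd y).differentiableAt) fun y => ?_
    rw [(hd y).deriv]
    have := sub_nonneg.2 (Real.sin_sq_le_sq (x := y))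
    positivity
  have := hmono ht
  simp at this
  linarith

theorem radius_cube {k : ℝ} (hk : 0 < k) (r : ℝ) : radius (k ^ 3) r = k ^ 3 + k⁻¹ * r := by
  rw [radius, (rpow_thirds hk).2.2.1]

/-- The half-opening angle of the disk of radius `radius (k ^ 3) r`. -/
noncomputable def halfAngle (k r : ℝ) : ℝ := Real.arccos (k ^ 3 / radius (k ^ 3) r)

theorem sin_halfAngle_sq {k r : ℝ} (hk : 0 < k) (hr : 0 < r) :
    radius (k ^ 3) r ^ 2 * Real.sin (halfAngle k r) ^ 2 =
      k⁻¹ * r * (radius (k ^ 3) r + k ^ 3) := by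
  have hρ : 0 < radius (k ^ 3) r := by rw [radius_cube hk]; positivity
  have hle : k ^ 3 ≤ radius (k ^ 3) r := by
    rw [radius_cube hk]
    have : 0 < k⁻¹ * r := by positivity
    linarith
  have h1 : k ^ 3 / radius (k ^ 3) r ≤ 1 := (div_le_one hρ).2 hle
  have h0 : 0 < k ^ 3 / radius (k ^ 3) r := by positivity
  rw [halfAngle, Real.sin_arccos, Real.sq_sqrt (by nlinarith)]
  have e : radius (k ^ 3) r ^ 2 * (1 - (k ^ 3 / radius (k ^ 3) r) ^ 2) =
    (radius (k ^ 3) r - k ^ 3) * (radius (k ^ 3) r + k ^ 3) := by field_simp; ring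
  rw [e, radius_cube hk]
  ring

theorem halfAngle_mem {k r : ℝ} (hk : 0 < k) (hr : 0 < r) :
    0 < halfAngle k r ∧ halfAngle k r < Real.pi / 2 := by
  have hρ : 0 < radius (k ^ 3) r := by rw [radius_cube hk]; positivity
  have hlt : k ^ 3 < radius (k ^ 3) r := by
    rw [radius_cube hk]
    have : 0 < k⁻¹ * r := by positivity
    linarith
  exact ⟨Real.arccos_pos.2 ((div_lt_one hρ).2 hlt), Real.arccos_lt_pi_div_two.2 (by positivity)⟩

/-- The opening angle is of order `k⁻² √r`, so the rescaled angles `θ` satisfy `θ² ≤ 8 r` uniformly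
in `k`. -/
theorem halfAngle_sq_le {k r : ℝ} (hk : 0 < k) (hr : 0 < r) :
    halfAngle k r ^ 2 ≤ 8 * (k ^ 4)⁻¹ * r := by
  obtain ⟨h0, h1⟩ := halfAngle_mem hk hr
  have hρ : k ^ 3 < radius (k ^ 3) r := by
    rw [radius_cube hk]
    have : 0 < k⁻¹ * r := by positivity
    linarith
  have hρ0 : 0 < radius (k ^ 3) r := lt_trans (by positivity) hρ
  have hs := sin_halfAngle_sq hk hr
  have hsin := Real.mul_le_sin h0.le h1.le
  have h2 : halfAngle k r ≤ 2 * Real.sin (halfAngle k r) := by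
    have h3 : 1 / 2 ≤ 2 / Real.pi := by
      rw [div_le_div_iff₀ two_pos Real.pi_pos]
      linarith [Real.pi_le_four]
    have := mul_le_mul_of_nonneg_right h3 h0.le
    linarith
  have h4 : halfAngle k r ^ 2 ≤ (2 * Real.sin (halfAngle k r)) ^ 2 := by gcongr
  set ρ := radius (k ^ 3) r
  have h5 : Real.sin (halfAngle k r) ^ 2 ≤ 2 * (k ^ 4)⁻¹ * r := by
    have : ρ ^ 2 * Real.sin (halfAngle k r) ^ 2 ≤ ρ ^ 2 * (2 * (k ^ 4)⁻¹ * r) := by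
      rw [hs]
      have e : ρ ^ 2 * (2 * (k ^ 4)⁻¹ * r) = k⁻¹ * r * (2 * (ρ * (ρ / k ^ 3))) := by
        field_simp
      rw [e]
      have : 1 ≤ ρ / k ^ 3 := (one_le_div (by positivity)).2 hρ.le
      have : ρ ≤ ρ * (ρ / k ^ 3) := le_mul_of_one_le_right hρ0.le this
      gcongr
      linarith
    exact le_of_mul_le_mul_left this (by positivity)
  nlinarith

/-- Linear growth uniform in `k`: the resulting exponential decay in `r` absorbs all polynomial
factors of the weight and of the moments. -/
theorem diskCapArea_ge {k r : ℝ} (hk : 0 < k) (hr : 0 < r) :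
    r - 1 / 3 ≤ diskCapArea (k ^ 3) (radius (k ^ 3) r) := by
  obtain ⟨h0, h1⟩ := halfAngle_mem hk hr
  have hρ : k ^ 3 < radius (k ^ 3) r := by
    rw [radius_cube hk]
    have : 0 < k⁻¹ * r := by positivity
    linarith
  have hρ0 : 0 < radius (k ^ 3) r := lt_trans (by positivity) hρ
  have hs := sin_halfAngle_sq hk hr
  rw [diskCapArea_eq (by positivity) hρ0 hρ.le]
  change _ ≤ _ * (halfAngle k r - Real.sin (halfAngle k r) * Real.cos (halfAngle k r))
  have h2 := sin_cube_le_sub_sin_mul_cos h0.le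
  refine le_trans ?_ (mul_le_mul_of_nonneg_left h2 (by positivity))
  set s := Real.sin (halfAngle k r)
  have hs0 : 0 < s := Real.sin_pos_of_pos_of_lt_pi h0 (by linarith [Real.pi_pos])
  set ρ := radius (k ^ 3) r
  set w := √(k * ρ) with hw
  have hw2 : w ^ 2 = k * ρ := Real.sq_sqrt (by positivity)
  have hw0 : 0 < w := Real.sqrt_pos.2 (by positivity)
  have hq : r ≤ (w * s) ^ 2 := by
    have : ρ * r ≤ ρ * (w * s) ^ 2 := by
      rw [mul_pow, hw2]
      calc ρ * r ≤ (ρ + k ^ 3) * r := by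
            gcongr
            have : 0 < k ^ 3 := by positivity
            linarith
        _ = k * (ρ ^ 2 * s ^ 2) := by rw [hs]; field_simp
        _ = _ := by ring
    exact le_of_mul_le_mul_left this hρ0
  have hkw : k * w ≤ ρ := by
    refine le_of_sq_le_sq (b := ρ) ?_ hρ0.le
    rw [mul_pow, hw2]
    nlinarith
  have h3 : (w * s) ^ 3 ≤ ρ ^ 2 * s ^ 3 := by
    rw [mul_pow]
    gcongr
    calc w ^ 3 = k * w * ρ := by rw [pow_succ, hw2]; ring
      _ ≤ ρ * ρ := by gcongr
      _ = ρ ^ 2 := by ring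
  have hq0 : 0 < w * s := by positivity
  generalize w * s = z at *
  -- With `z² ≥ r`, this uses `2 / 3 * z³ - z² + 1 / 3 = (z - 1)² (2 z + 1) / 3 ≥ 0`.
  nlinarith [mul_nonneg hq0.le (sq_nonneg (z - 1)), sq_nonneg (z - 1)]

theorem diskCapArea_le {k r m : ℝ} (hk : 0 < k) (hr : 0 < r) (hr2 : r ≤ 2) (hm : (k ^ 4)⁻¹ ≤ m) :
    diskCapArea (k ^ 3) (radius (k ^ 3) r) ≤ 2000 * (1 + 2 * m) ^ 4 := by
  obtain ⟨h0, h1⟩ := halfAngle_mem hk hr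
  have hμ : 0 < (k ^ 4)⁻¹ := by positivity
  have hρ : k ^ 3 < radius (k ^ 3) r := by
    rw [radius_cube hk]
    have : 0 < k⁻¹ * r := by positivity
    linarith
  have hρ0 : 0 < radius (k ^ 3) r := lt_trans (by positivity) hρ
  have hρ1 : radius (k ^ 3) r ≤ k ^ 3 * (1 + 2 * m) := by
    rw [radius_cube hk]
    have e : k⁻¹ * r = k ^ 3 * ((k ^ 4)⁻¹ * r) := by field_simp
    have h2 : (k ^ 4)⁻¹ * r ≤ m * 2 := mul_le_mul hm hr2 hr.le (hμ.le.trans hm)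
    have h3 := mul_le_mul_of_nonneg_left h2 (pow_pos hk 3).le
    rw [e]
    linarith
  rw [diskCapArea_eq (by positivity) hρ0 hρ.le]
  change _ * (halfAngle k r - Real.sin (halfAngle k r) * Real.cos (halfAngle k r)) ≤ _
  have h2 := sub_sin_mul_cos_le h0.le
  refine (mul_le_mul_of_nonneg_left h2 (by positivity)).trans ?_
  have h3 := halfAngle_sq_le hk hr
  set t := halfAngle k r
  set ρ := radius (k ^ 3) r
  have ht2 : t ^ 2 ≤ 16 * (k ^ 4)⁻¹ := by nlinarith
  have ht3 : (k ^ 6 * t ^ 3) ^ 2 ≤ 64 ^ 2 := by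
    calc (k ^ 6 * t ^ 3) ^ 2 = k ^ 12 * (t ^ 2) ^ 3 := by ring
      _ ≤ k ^ 12 * (16 * (k ^ 4)⁻¹) ^ 3 := by gcongr
      _ = 64 ^ 2 := by field_simp; norm_num
  have ht4 : k ^ 6 * t ^ 3 ≤ 64 := le_of_sq_le_sq ht3 (by norm_num)
  have hm0 : 0 < m := hμ.trans_le hm
  calc ρ ^ 2 * (2 / 3 * t ^ 3) ≤ (k ^ 3 * (1 + 2 * m)) ^ 2 * (2 / 3 * t ^ 3) := by gcongr
    _ = 2 / 3 * (1 + 2 * m) ^ 2 * (k ^ 6 * t ^ 3) := by ring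
    _ ≤ 2 / 3 * (1 + 2 * m) ^ 2 * 64 := by gcongr
    _ ≤ _ := by nlinarith [sq_nonneg ((1 + 2 * m) ^ 2 - 1), sq_nonneg (1 + 2 * m)]

theorem quadrupletWeight_eq {k : ℝ} (hk : 0 < k) (q : ℝ × ℝ × ℝ × ℝ) :
    quadrupletWeight (k ^ 3) q = Real.exp (-diskCapArea (k ^ 3) (radius (k ^ 3) q.1)) * (k ^ 7)⁻¹ *
      radius (k ^ 3) q.1 ^ 3 * simplexArea (k ^ 3) (radius (k ^ 3) q.1)
        ((k ^ 2)⁻¹ * q.2.1) ((k ^ 2)⁻¹ * q.2.2.1) ((k ^ 2)⁻¹ * q.2.2.2) := by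
  obtain ⟨-, -, -, h2, -, h3⟩ := rpow_thirds hk
  rw [quadrupletWeight, h2, h3]

/-- The quadruplets of positive weight. -/
def quadrupletSupport (k : ℝ) : Set (ℝ × ℝ × ℝ × ℝ) :=
  {q | 0 < q.1 ∧ -halfAngle k q.1 < (k ^ 2)⁻¹ * q.2.1 ∧
    (k ^ 2)⁻¹ * q.2.1 < (k ^ 2)⁻¹ * q.2.2.1 ∧ (k ^ 2)⁻¹ * q.2.2.1 < (k ^ 2)⁻¹ * q.2.2.2 ∧
    (k ^ 2)⁻¹ * q.2.2.2 < halfAngle k q.1}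

theorem simplexArea_radius {k : ℝ} (hk : 0 < k) (q : ℝ × ℝ × ℝ × ℝ) :
    simplexArea (k ^ 3) (radius (k ^ 3) q.1)
        ((k ^ 2)⁻¹ * q.2.1) ((k ^ 2)⁻¹ * q.2.2.1) ((k ^ 2)⁻¹ * q.2.2.2) =
      (quadrupletSupport k).indicator (fun q =>
        2 * |Real.sin (((k ^ 2)⁻¹ * q.2.2.1 - (k ^ 2)⁻¹ * q.2.2.2) / 2) *
          Real.sin (((k ^ 2)⁻¹ * q.2.2.2 - (k ^ 2)⁻¹ * q.2.1) / 2) *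
          Real.sin (((k ^ 2)⁻¹ * q.2.2.1 - (k ^ 2)⁻¹ * q.2.1) / 2)|) q := by
  classical
  have h : k ^ 3 < radius (k ^ 3) q.1 ↔ 0 < q.1 := by
    rw [radius_cube hk, lt_add_iff_pos_right, mul_pos_iff_of_pos_left (inv_pos.2 hk)]
  rw [simplexArea, Set.indicator_apply]
  refine if_congr ?_ rfl rfl
  rw [h]
  simp only [quadrupletSupport, Set.mem_ofPred_eq, halfAngle]
  tauto

theorem quadrupletWeight_nonneg {k : ℝ} (hk : 0 < k) (q : ℝ × ℝ × ℝ × ℝ) :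
    0 ≤ quadrupletWeight (k ^ 3) q := by
  rw [quadrupletWeight_eq hk]
  by_cases h : q ∈ quadrupletSupport k
  · have hr : 0 < q.1 := h.1
    have : 0 < radius (k ^ 3) q.1 := by rw [radius_cube hk]; positivity
    have := simplexArea_nonneg (k ^ 3) (radius (k ^ 3) q.1)
      ((k ^ 2)⁻¹ * q.2.1) ((k ^ 2)⁻¹ * q.2.2.1) ((k ^ 2)⁻¹ * q.2.2.2)
    positivity
  · rw [simplexArea_radius hk, Set.indicator_of_notMem h, mul_zero]

theorem mem_support_of_weight_ne_zero {k : ℝ} (hk : 0 < k) {q : ℝ × ℝ × ℝ × ℝ}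
    (h : quadrupletWeight (k ^ 3) q ≠ 0) : q ∈ quadrupletSupport k := by
  by_contra hq
  rw [quadrupletWeight_eq hk, simplexArea_radius hk, Set.indicator_of_notMem hq, mul_zero] at h
  exact h rfl

/-- Half the angle between the two nuclei is smaller than the opening angle, whose cosine is `k ^ 3`
over the radius; hence the chord is at distance at least `k ^ 3` from the vertex. -/
theorem initialPair_mem {k : ℝ} (hk : 0 < k) {q : ℝ × ℝ × ℝ × ℝ} (hq : q ∈ quadrupletSupport k) :
    0 < (initialPair (k ^ 3) q).1 ∧ 1 ≤ (initialPair (k ^ 3) q).2 := by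
  obtain ⟨hr, h1, h2, h3, h4⟩ := hq
  obtain ⟨ht0, ht1⟩ := halfAngle_mem hk hr
  have hρ : k ^ 3 < radius (k ^ 3) q.1 := by
    rw [radius_cube hk]
    have : 0 < k⁻¹ * q.1 := by positivity
    linarith
  have hρ0 : 0 < radius (k ^ 3) q.1 := lt_trans (by positivity) hρ
  rw [initialPair_eq hk]
  set x := ((k ^ 2)⁻¹ * q.2.2.1 - (k ^ 2)⁻¹ * q.2.1) / 2 with hx
  have hx0 : 0 < x := by linarith
  have hxt : x < halfAngle k q.1 := by linarith
  have hsin : 0 < Real.sin x := Real.sin_pos_of_pos_of_lt_pi hx0 (by linarith [Real.pi_pos])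
  refine ⟨by positivity, ?_⟩
  have hcos : Real.cos (halfAngle k q.1) ≤ Real.cos x :=
    Real.cos_le_cos_of_nonneg_of_le_pi hx0.le (by linarith [Real.pi_pos]) hxt.le
  have h5 : Real.cos (halfAngle k q.1) = k ^ 3 / radius (k ^ 3) q.1 := by
    have : 0 < k ^ 3 / radius (k ^ 3) q.1 := by positivity
    exact Real.cos_arccos (by linarith) ((div_le_one hρ0).2 hρ.le)
  rw [h5, div_le_iff₀ hρ0] at hcos
  have hc0 : 0 ≤ Real.cos x := by
    by_contra hc
    have := mul_neg_of_neg_of_pos (not_le.1 hc) hρ0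
    have : 0 < k ^ 3 := by positivity
    linarith
  simp only
  rw [abs_of_pos hρ0, abs_of_nonneg hc0, inv_mul_eq_div, one_le_div (by positivity)]
  linarith

/-- An integrable majorant of the weights. -/
noncomputable def majorant (q : ℝ × ℝ × ℝ × ℝ) : ℝ :=
  (1 + q.1 ^ 2)⁻¹ * ((1 + q.2.1 ^ 2)⁻¹ * ((1 + q.2.2.1 ^ 2)⁻¹ * (1 + q.2.2.2 ^ 2)⁻¹))

theorem integrable_majorant : Integrable majorant :=
  integrable_inv_one_add_sq.mul_prod (integrable_inv_one_add_sq.mul_prod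
    (integrable_inv_one_add_sq.mul_prod integrable_inv_one_add_sq))

/-- The constant in `exp_neg_mul_pow_le`. -/
noncomputable def expConst : ℝ := 2 ^ 24 * (Nat.factorial 24 * 8)

theorem expConst_pos : 0 < expConst := by
  unfold expConst
  positivity

/-- The exponent `24` is `16 + 8`: sixteen powers from the weight times the fifth moment, eight
spent on the integrable majorant. -/
theorem exp_neg_mul_pow_le {r : ℝ} (hr : 0 ≤ r) :
    Real.exp (-(r - 1 / 3)) * (1 + 2 * r) ^ 24 ≤ expConst := by
  have h1 := Real.pow_div_factorial_le_exp (1 + r) (by positivity) 24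
  rw [div_le_iff₀ (by positivity)] at h1
  have h2 : (1 + 2 * r) ^ 24 ≤ (2 * (1 + r)) ^ 24 := by
    gcongr
    linarith
  have h3 : Real.exp (4 / 3) ≤ 8 := by
    have : Real.exp (4 / 3) ≤ Real.exp 2 := Real.exp_le_exp.2 (by norm_num)
    have h4 : Real.exp 2 = Real.exp 1 ^ 2 := by rw [← Real.exp_nat_mul]; norm_num
    have h5 := Real.exp_one_lt_d9
    have h6 := Real.exp_pos 1
    nlinarith
  calc Real.exp (-(r - 1 / 3)) * (1 + 2 * r) ^ 24
      ≤ Real.exp (-(r - 1 / 3)) * (2 ^ 24 * (Real.exp (1 + r) * Nat.factorial 24)) := by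
        refine mul_le_mul_of_nonneg_left (h2.trans ?_) (Real.exp_pos _).le
        rw [mul_pow]
        gcongr
    _ = 2 ^ 24 * (Nat.factorial 24 * (Real.exp (-(r - 1 / 3)) * Real.exp (1 + r))) := by ring
    _ = 2 ^ 24 * (Nat.factorial 24 * Real.exp (4 / 3)) := by
        rw [← Real.exp_add]
        congr 4
        ring
    _ ≤ _ := by
        unfold expConst
        gcongr

/-! ### Two-sided bounds for the weights -/

theorem abs_sin_half_sub_le {c Y θ θ' : ℝ} (hc : 0 ≤ c) (h : |θ| ≤ Y) (h' : |θ'| ≤ Y) :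
    |Real.sin ((c * θ - c * θ') / 2)| ≤ c * Y := by
  refine Real.abs_sin_le_abs.trans ?_
  rw [← mul_sub, abs_div, abs_mul, abs_of_nonneg hc, abs_two, div_le_iff₀ two_pos, mul_assoc]
  refine mul_le_mul_of_nonneg_left ((abs_sub _ _).trans ?_) hc
  linarith

theorem exp_mul_pow_le_majorant {r θl θc θr : ℝ} (hr : 0 ≤ r) (hl : |θl| ≤ 1 + 2 * r)
    (hc : |θc| ≤ 1 + 2 * r) (hr' : |θr| ≤ 1 + 2 * r) :
    Real.exp (-(r - 1 / 3)) * (1 + 2 * r) ^ 16 ≤ 8 * expConst * majorant (r, θl, θc, θr) := by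
  have h24 := exp_neg_mul_pow_le hr
  set Y := 1 + 2 * r with hY
  have hY1 : 1 ≤ Y := by linarith
  have hsq : ∀ θ : ℝ, |θ| ≤ Y → 1 + θ ^ 2 ≤ 2 * Y ^ 2 := fun θ hθ => by
    have := sq_le_sq' (abs_le.1 hθ).1 (abs_le.1 hθ).2
    nlinarith
  have hr2 : 1 + r ^ 2 ≤ Y ^ 2 := by nlinarith
  have hprod : (1 + r ^ 2) * ((1 + θl ^ 2) * ((1 + θc ^ 2) * (1 + θr ^ 2))) ≤ 8 * Y ^ 8 := by
    calc _ ≤ Y ^ 2 * (2 * Y ^ 2 * (2 * Y ^ 2 * (2 * Y ^ 2))) := by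
          gcongr <;> first | exact hr2 | exact hsq _ (by assumption)
      _ = _ := by ring
  have e1 : majorant (r, θl, θc, θr) =
      ((1 + r ^ 2) * ((1 + θl ^ 2) * ((1 + θc ^ 2) * (1 + θr ^ 2))))⁻¹ := by
    simp only [majorant, mul_inv]
  rw [e1, ← div_eq_mul_inv, le_div_iff₀ (by positivity)]
  calc _ ≤ Real.exp (-(r - 1 / 3)) * Y ^ 16 * (8 * Y ^ 8) := by gcongr
    _ = 8 * (Real.exp (-(r - 1 / 3)) * Y ^ 24) := by ring
    _ ≤ _ := by linarith

/-- Each sine is at most `k⁻² Y` and the radius at most `k³ M Y`, so the weight has order `k⁻⁷ k⁹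
k⁻⁶ = k⁻⁴`, the order of the normalization. -/
theorem weight_mul_le {k m : ℝ} (hk : 0 < k) (hm : (k ^ 4)⁻¹ ≤ m) (q : ℝ × ℝ × ℝ × ℝ) :
    quadrupletWeight (k ^ 3) q *
        (1 + (initialPair (k ^ 3) q).1 ^ 5 + (initialPair (k ^ 3) q).1⁻¹) ≤
      (48 * expConst * (1 + m) ^ 8) * (k ^ 4)⁻¹ * majorant q := by
  have hμ : 0 < (k ^ 4)⁻¹ := by positivity
  have hm0 : 0 < m := hμ.trans_le hm
  have hmaj : 0 < majorant q := by unfold majorant; positivity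
  have hexpC := expConst_pos
  by_cases hq : q ∈ quadrupletSupport k
  swap
  · rw [quadrupletWeight_eq hk, simplexArea_radius hk, Set.indicator_of_notMem hq, mul_zero,
      zero_mul]
    positivity
  have hpair := (initialPair_mem hk hq).1
  have hw := quadrupletWeight_eq hk q
  rw [simplexArea_radius hk, Set.indicator_of_mem hq] at hw
  obtain ⟨hr, h1, h2, h3, h4⟩ := hq
  have ht := halfAngle_sq_le hk hr
  obtain ⟨ht0, ht1⟩ := halfAngle_mem hk hr
  have ha := diskCapArea_ge hk hr
  obtain ⟨r, θl, θc, θr⟩ := q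
  simp only at *
  set Y := 1 + 2 * r with hY
  have hY1 : 1 ≤ Y := by linarith
  have hθ : ∀ θ : ℝ, -halfAngle k r < (k ^ 2)⁻¹ * θ → (k ^ 2)⁻¹ * θ < halfAngle k r → |θ| ≤ Y := by
    intro θ hθ1 hθ2
    refine abs_le_of_sq_le_sq ?_ (by linarith)
    have h5 : ((k ^ 2)⁻¹ * θ) ^ 2 ≤ 8 * (k ^ 4)⁻¹ * r :=
      (sq_le_sq' hθ1.le hθ2.le).trans ht
    have h6 : θ ^ 2 ≤ 8 * r := by
      have e : ((k ^ 2)⁻¹ * θ) ^ 2 = (k ^ 4)⁻¹ * θ ^ 2 := by field_simp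
      rw [e, show 8 * (k ^ 4)⁻¹ * r = (k ^ 4)⁻¹ * (8 * r) by ring] at h5
      exact le_of_mul_le_mul_left h5 hμ
    nlinarith [sq_nonneg (1 - 2 * r)]
  have hl := hθ θl h1 (by linarith)
  have hc := hθ θc (by linarith) (by linarith)
  have hr' := hθ θr (by linarith) h4
  have hc0 : 0 ≤ (k ^ 2)⁻¹ := by positivity
  rw [initialPair_eq hk] at hpair ⊢
  simp only at hpair ⊢
  have s1 := abs_sin_half_sub_le hc0 hc hr'
  have s2 := abs_sin_half_sub_le hc0 hr' hl
  have s3 := abs_sin_half_sub_le hc0 hc hl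
  rw [abs_mul, abs_mul] at hw
  have p1 := abs_nonneg (Real.sin (((k ^ 2)⁻¹ * θc - (k ^ 2)⁻¹ * θr) / 2))
  have p2 := abs_nonneg (Real.sin (((k ^ 2)⁻¹ * θr - (k ^ 2)⁻¹ * θl) / 2))
  generalize |Real.sin (((k ^ 2)⁻¹ * θc - (k ^ 2)⁻¹ * θr) / 2)| = S1 at *
  generalize |Real.sin (((k ^ 2)⁻¹ * θr - (k ^ 2)⁻¹ * θl) / 2)| = S2 at *
  have hS3 : 0 < |Real.sin (((k ^ 2)⁻¹ * θc - (k ^ 2)⁻¹ * θl) / 2)| := by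
    refine lt_of_le_of_ne (abs_nonneg _) fun h => ?_
    rw [← h, mul_zero, mul_zero] at hpair
    exact lt_irrefl _ hpair
  generalize |Real.sin (((k ^ 2)⁻¹ * θc - (k ^ 2)⁻¹ * θl) / 2)| = S3 at *
  have hρ1 : k ^ 3 ≤ radius (k ^ 3) r := by
    rw [radius_cube hk]
    have : 0 < k⁻¹ * r := by positivity
    linarith
  have hρ0 : 0 < radius (k ^ 3) r := lt_of_lt_of_le (by positivity) hρ1
  have hρ2 : radius (k ^ 3) r ≤ k ^ 3 * ((1 + m) * Y) := by
    rw [radius_cube hk]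
    have e : k⁻¹ * r = k ^ 3 * ((k ^ 4)⁻¹ * r) := by field_simp
    have h5 : 1 + (k ^ 4)⁻¹ * r ≤ (1 + m) * Y := by
      have := mul_le_mul_of_nonneg_right hm hr.le
      rw [hY]
      nlinarith [mul_pos hm0 hr]
    have := mul_le_mul_of_nonneg_left h5 (pow_pos hk 3).le
    rw [e]
    linarith
  rw [abs_of_pos hρ0]
  generalize radius (k ^ 3) r = ρ at *
  set M := (1 + m) with hM
  have hM1 : 1 ≤ M := by linarith
  have hexp : Real.exp (-diskCapArea (k ^ 3) ρ) ≤ Real.exp (-(r - 1 / 3)) :=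
    Real.exp_le_exp.2 (by linarith)
  set e := Real.exp (-(r - 1 / 3)) with he
  have he0 : 0 < e := Real.exp_pos _
  have hMY : 1 ≤ M * Y := by nlinarith
  have hB : (k⁻¹ * (ρ * S3)) ^ 5 ≤ (M * Y ^ 2) ^ 5 := by
    refine pow_le_pow_left₀ (by positivity) ?_ 5
    calc k⁻¹ * (ρ * S3) ≤ k⁻¹ * (k ^ 3 * (M * Y) * ((k ^ 2)⁻¹ * Y)) := by gcongr
      _ = M * Y ^ 2 := by field_simp
  have hmain : quadrupletWeight (k ^ 3) (r, θl, θc, θr) *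
      (1 + (k⁻¹ * (ρ * S3)) ^ 5) ≤ 4 * (e * ((k ^ 4)⁻¹ * (M ^ 8 * Y ^ 16))) := by
    have g1 : quadrupletWeight (k ^ 3) (r, θl, θc, θr) ≤ 2 * (e * ((k ^ 4)⁻¹ * (M ^ 3 * Y ^ 6))) := by
      rw [hw]
      calc _ ≤ e * (k ^ 7)⁻¹ * (k ^ 3 * (M * Y)) ^ 3 *
            (2 * ((k ^ 2)⁻¹ * Y * ((k ^ 2)⁻¹ * Y) * ((k ^ 2)⁻¹ * Y))) := by gcongr
        _ = _ := by field_simp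
    have g2 : 1 + (k⁻¹ * (ρ * S3)) ^ 5 ≤ 2 * (M ^ 5 * Y ^ 10) := by
      have : 1 ≤ M ^ 5 * Y ^ 10 := one_le_mul_of_one_le_of_one_le (one_le_pow₀ hM1) (one_le_pow₀ hY1)
      have e5 : (M * Y ^ 2) ^ 5 = M ^ 5 * Y ^ 10 := by ring
      rw [e5] at hB
      linarith
    calc _ ≤ 2 * (e * ((k ^ 4)⁻¹ * (M ^ 3 * Y ^ 6))) * (2 * (M ^ 5 * Y ^ 10)) := by gcongr
      _ = _ := by ring
  -- Here `B_0 = k⁻¹ ρ S3`, and `S3` is one of the three sines of the weight, so the division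
  -- cancels it.
  have hinv : quadrupletWeight (k ^ 3) (r, θl, θc, θr) * (k⁻¹ * (ρ * S3))⁻¹ ≤
      2 * (e * ((k ^ 4)⁻¹ * (M ^ 8 * Y ^ 16))) := by
    have g1 : quadrupletWeight (k ^ 3) (r, θl, θc, θr) * (k⁻¹ * (ρ * S3))⁻¹ ≤
        2 * (e * ((k ^ 4)⁻¹ * (M ^ 2 * Y ^ 4))) := by
      rw [hw]
      calc _ = Real.exp (-diskCapArea (k ^ 3) ρ) * (k ^ 6)⁻¹ * ρ ^ 2 * (2 * (S1 * S2)) := by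
            field_simp
        _ ≤ e * (k ^ 6)⁻¹ * (k ^ 3 * (M * Y)) ^ 2 *
            (2 * ((k ^ 2)⁻¹ * Y * ((k ^ 2)⁻¹ * Y))) := by gcongr
        _ = _ := by field_simp
    refine g1.trans ?_
    gcongr <;> first | assumption | norm_num
  have hmaj2 : e * Y ^ 16 ≤ 8 * expConst * majorant (r, θl, θc, θr) :=
    exp_mul_pow_le_majorant hr.le hl hc hr'
  calc _ = quadrupletWeight (k ^ 3) (r, θl, θc, θr) * (1 + (k⁻¹ * (ρ * S3)) ^ 5) +
        quadrupletWeight (k ^ 3) (r, θl, θc, θr) * (k⁻¹ * (ρ * S3))⁻¹ := by ring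
    _ ≤ 4 * (e * ((k ^ 4)⁻¹ * (M ^ 8 * Y ^ 16))) + 2 * (e * ((k ^ 4)⁻¹ * (M ^ 8 * Y ^ 16))) :=
        add_le_add hmain hinv
    _ = 6 * M ^ 8 * (k ^ 4)⁻¹ * (e * Y ^ 16) := by ring
    _ ≤ 6 * M ^ 8 * (k ^ 4)⁻¹ * (8 * expConst *
          majorant (r, θl, θc, θr)) := by gcongr
    _ = _ := by ring

/-- A box on which the weights are bounded below. -/
def weightBox (s : ℝ) : Set (ℝ × ℝ × ℝ × ℝ) :=
  Set.Icc 1 2 ×ˢ Set.Icc (-s) (-s / 2) ×ˢ Set.Icc (-s / 8) (s / 8) ×ˢ Set.Icc (s / 2) s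

theorem measurableSet_weightBox (s : ℝ) : MeasurableSet (weightBox s) :=
  measurableSet_Icc.prod (measurableSet_Icc.prod (measurableSet_Icc.prod measurableSet_Icc))

theorem volume_weightBox_pos {s : ℝ} (hs : 0 < s) : 0 < volume (weightBox s) := by
  rw [weightBox, Measure.volume_eq_prod, Measure.prod_prod, Measure.volume_eq_prod,
    Measure.prod_prod, Measure.volume_eq_prod, Measure.prod_prod]
  simp only [Real.volume_Icc]
  refine ENNReal.mul_pos ?_ (mul_ne_zero ?_ (mul_ne_zero ?_ ?_)) <;>
  · refine (ENNReal.ofReal_pos.2 ?_).ne'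
    linarith

theorem weightBox_subset_support {k m : ℝ} (hk : 0 < k) (hm : (k ^ 4)⁻¹ ≤ m) :
    weightBox (1 + m)⁻¹ ⊆ quadrupletSupport k := by
  rintro ⟨r, θl, θc, θr⟩ ⟨hr, hl, hc, hr'⟩
  have hμ : 0 < (k ^ 4)⁻¹ := by positivity
  have hm0 : 0 < m := hμ.trans_le hm
  have hk2 : 0 < (k ^ 2)⁻¹ := by positivity
  set s := (1 + m)⁻¹ with hs
  have hs0 : 0 < s := by positivity
  have hsm : s * (1 + m) = 1 := inv_mul_cancel₀ (by positivity)
  simp only [Set.mem_Icc] at hr hl hc hr'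
  have hr0 : 0 < r := by linarith
  have hρ1 : k ^ 3 < radius (k ^ 3) r := by
    rw [radius_cube hk]
    have : 0 < k⁻¹ * r := by positivity
    linarith
  have hρ0 : 0 < radius (k ^ 3) r := lt_trans (by positivity) hρ1
  have hs1 : s ^ 2 * (1 + 2 * m) ≤ 1 := by
    have : s ^ 2 * (1 + m) ^ 2 = 1 := by rw [← mul_pow, hsm, one_pow]
    have : 0 ≤ s ^ 2 * m ^ 2 := by positivity
    nlinarith
  have hang : (k ^ 2)⁻¹ * s < halfAngle k r := by
    have h2 : ((k ^ 2)⁻¹ * s) ^ 2 = (k ^ 4)⁻¹ * s ^ 2 := by field_simp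
    have h3 : (k ^ 4)⁻¹ * s ^ 2 ≤ m * s ^ 2 := by gcongr
    have hle1 : (k ^ 2)⁻¹ * s ≤ 1 := by
      refine le_of_sq_le_sq ?_ zero_le_one
      rw [h2]
      nlinarith [sq_nonneg s]
    -- It suffices to compare cosines: `1 - k⁻⁴ s² / 2` exceeds `1 / (1 + k⁻⁴ r)`, because `r ≥ 1`
    -- and `s = (1 + m)⁻¹` is small enough.
    rw [← Real.arccos_cos (x := (k ^ 2)⁻¹ * s) (by positivity) (by linarith [Real.pi_gt_three]),
      halfAngle]
    refine Real.arccos_lt_arccos (le_trans (by norm_num) (div_pos (pow_pos hk 3) hρ0).le) ?_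
      (Real.cos_le_one _)
    refine lt_of_lt_of_le ?_ (Real.one_sub_sq_div_two_le_cos)
    rw [h2, div_lt_iff₀ hρ0, radius_cube hk]
    have e : k ^ 3 + k⁻¹ * r = k ^ 3 * (1 + (k ^ 4)⁻¹ * r) := by field_simp
    rw [e]
    have h5 : 1 < (1 - (k ^ 4)⁻¹ * s ^ 2 / 2) * (1 + (k ^ 4)⁻¹ * r) := by
      generalize (k ^ 4)⁻¹ = μ at *
      have h6 : s ^ 2 * (1 + μ * r) ≤ 1 := by
        have : μ * r ≤ m * 2 := mul_le_mul hm hr.2 hr0.le hm0.le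
        nlinarith [sq_nonneg s]
      nlinarith
    have := mul_lt_mul_of_pos_left h5 (pow_pos hk 3)
    linarith
  have hmono := fun {a b : ℝ} (h : a < b) => mul_lt_mul_of_pos_left h hk2
  refine ⟨hr0, ?_, hmono (by linarith), hmono (by linarith), ?_⟩
  · have := mul_le_mul_of_nonneg_left hl.1 hk2.le
    simp only
    linarith
  · exact lt_of_le_of_lt (mul_le_mul_of_nonneg_left hr'.2 hk2.le) hang

theorem le_abs_sin {x c : ℝ} (hc : 0 < c) (hx : 2 * c ≤ x) (hx1 : x < Real.pi / 2) :
    c ≤ |Real.sin x| := by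
  have h1 := Real.mul_le_sin (by linarith) hx1.le
  have h3 : 1 / 2 ≤ 2 / Real.pi := by
    rw [div_le_div_iff₀ two_pos Real.pi_pos]
    linarith [Real.pi_le_four]
  have := mul_le_mul_of_nonneg_right h3 (show 0 ≤ x by linarith)
  exact le_trans (by linarith) (le_abs_self _)

theorem weight_ge {k m : ℝ} (hk : 0 < k) (hm : (k ^ 4)⁻¹ ≤ m) {q : ℝ × ℝ × ℝ × ℝ}
    (hq : q ∈ weightBox (1 + m)⁻¹) :
    Real.exp (-(2000 * (1 + 2 * m) ^ 4)) * ((1 + m)⁻¹ ^ 3 / 2048) * (k ^ 4)⁻¹ ≤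
      quadrupletWeight (k ^ 3) q := by
  have hμ : 0 < (k ^ 4)⁻¹ := by positivity
  have hm0 : 0 < m := hμ.trans_le hm
  have hsupp := weightBox_subset_support hk hm hq
  have hw := quadrupletWeight_eq hk q
  rw [simplexArea_radius hk, Set.indicator_of_mem hsupp] at hw
  obtain ⟨hr0, h1, h2, h3, h4⟩ := hsupp
  obtain ⟨ht0, ht1⟩ := halfAngle_mem hk hr0
  obtain ⟨r, θl, θc, θr⟩ := q
  obtain ⟨hr, hl, hc, hr'⟩ := hq
  have hs0 : 0 < (1 + m)⁻¹ := by positivity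
  generalize (1 + m)⁻¹ = s at *
  simp only [Set.mem_Icc] at hr hl hc hr' hr0 h1 h2 h3 h4 hw
  have hk2 : 0 < (k ^ 2)⁻¹ := by positivity
  have hA := diskCapArea_le hk hr0 hr.2 hm
  have hρ1 : k ^ 3 ≤ radius (k ^ 3) r := by
    rw [radius_cube hk]
    have : 0 < k⁻¹ * r := by positivity
    linarith
  have hρ0 : 0 < radius (k ^ 3) r := lt_of_lt_of_le (by positivity) hρ1
  have hmono := fun {a b : ℝ} (h : a ≤ b) => mul_le_mul_of_nonneg_left h hk2.le
  -- On the box the angles are at least `s / 4` apart; three sine bounds and the prefactor `2`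
  -- produce `2 / 16³ = 1 / 2048`.
  have s1 : (k ^ 2)⁻¹ * s / 16 ≤ |Real.sin (((k ^ 2)⁻¹ * θc - (k ^ 2)⁻¹ * θr) / 2)| := by
    rw [← abs_neg, ← Real.sin_neg]
    refine le_abs_sin (by positivity) ?_ (by linarith)
    have := hmono (show s / 4 ≤ θr - θc by linarith)
    linarith
  have s2 : (k ^ 2)⁻¹ * s / 16 ≤ |Real.sin (((k ^ 2)⁻¹ * θr - (k ^ 2)⁻¹ * θl) / 2)| := by
    refine le_abs_sin (by positivity) ?_ (by linarith)
    have := hmono (show s / 4 ≤ θr - θl by linarith)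
    linarith
  have s3 : (k ^ 2)⁻¹ * s / 16 ≤ |Real.sin (((k ^ 2)⁻¹ * θc - (k ^ 2)⁻¹ * θl) / 2)| := by
    refine le_abs_sin (by positivity) ?_ (by linarith)
    have := hmono (show s / 4 ≤ θc - θl by linarith)
    linarith
  rw [hw, abs_mul, abs_mul]
  calc _ = Real.exp (-(2000 * (1 + 2 * m) ^ 4)) * (k ^ 7)⁻¹ * (k ^ 3) ^ 3 *
        (2 * ((k ^ 2)⁻¹ * s / 16 * ((k ^ 2)⁻¹ * s / 16) * ((k ^ 2)⁻¹ * s / 16))) := by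
        field_simp
        norm_num
    _ ≤ _ := by
        have hpos : 0 < (k ^ 2)⁻¹ * s / 16 := by positivity
        gcongr

/-- The constant depends only on a bound `m` for `k⁻⁴`: `m = k⁻⁴` serves a fixed `k`, and `m = 1`
gives uniformity for `l ≥ 1`. -/
theorem exists_normalization_ge {m : ℝ} (hm0 : 0 < m) : ∃ c : ℝ≥0∞, c ≠ 0 ∧ ∀ k : ℝ, 0 < k →
    (k ^ 4)⁻¹ ≤ m →
      c * ENNReal.ofReal (k ^ 4)⁻¹ ≤ ∫⁻ q, ENNReal.ofReal (quadrupletWeight (k ^ 3) q) := by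
  refine ⟨ENNReal.ofReal (Real.exp (-(2000 * (1 + 2 * m) ^ 4)) * ((1 + m)⁻¹ ^ 3 / 2048)) *
    volume (weightBox (1 + m)⁻¹), mul_ne_zero (ENNReal.ofReal_pos.2 (by positivity)).ne'
    (volume_weightBox_pos (by positivity)).ne', fun k hk hm => ?_⟩
  rw [mul_right_comm, ← ENNReal.ofReal_mul (by positivity)]
  refine le_trans ?_ (setLIntegral_le_lintegral (weightBox (1 + m)⁻¹) _)
  rw [← setLIntegral_const]
  exact setLIntegral_mono' (measurableSet_weightBox _) fun q hq =>
    ENNReal.ofReal_le_ofReal (weight_ge hk hm hq)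

theorem exists_moment_le {m : ℝ} (hm0 : 0 < m) : ∃ C : ℝ≥0∞, C ≠ ∞ ∧ ∀ k : ℝ, 0 < k →
    (k ^ 4)⁻¹ ≤ m →
      ∫⁻ q, ENNReal.ofReal (quadrupletWeight (k ^ 3) q *
        (1 + (initialPair (k ^ 3) q).1 ^ 5 + (initialPair (k ^ 3) q).1⁻¹)) ≤
        C * ENNReal.ofReal (k ^ 4)⁻¹ := by
  have hC := expConst_pos
  refine ⟨ENNReal.ofReal (48 * expConst * (1 + m) ^ 8) * ∫⁻ q, ENNReal.ofReal (majorant q),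
    ENNReal.mul_ne_top ENNReal.ofReal_ne_top integrable_majorant.lintegral_lt_top.ne,
    fun k hk hm => ?_⟩
  rw [mul_right_comm, ← ENNReal.ofReal_mul (by positivity), ← lintegral_const_mul']
  · refine lintegral_mono fun q => ?_
    rw [← ENNReal.ofReal_mul (by positivity)]
    exact ENNReal.ofReal_le_ofReal (weight_mul_le hk hm q)
  · finiteness

/-! ### Total mass, support and uniform moments of the initial law -/

theorem initialPair_fst_nonneg {k : ℝ} (hk : 0 < k) (q : ℝ × ℝ × ℝ × ℝ) :
    0 ≤ (initialPair (k ^ 3) q).1 := by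
  rw [initialPair_eq hk]
  positivity

theorem normalization_ne_zero {k : ℝ} (hk : 0 < k) :
    ∫⁻ q, ENNReal.ofReal (quadrupletWeight (k ^ 3) q) ≠ 0 := by
  obtain ⟨c, hc, h⟩ := exists_normalization_ge (m := (k ^ 4)⁻¹) (by positivity)
  exact ((ENNReal.mul_pos hc (ENNReal.ofReal_pos.2 (by positivity)).ne').trans_le
    (h k hk le_rfl)).ne'

theorem normalization_ne_top {k : ℝ} (hk : 0 < k) :
    ∫⁻ q, ENNReal.ofReal (quadrupletWeight (k ^ 3) q) ≠ ∞ := by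
  obtain ⟨C, hC, h⟩ := exists_moment_le (m := (k ^ 4)⁻¹) (by positivity)
  refine ne_top_of_le_ne_top (ENNReal.mul_ne_top hC ENNReal.ofReal_ne_top)
    ((lintegral_mono fun q => ENNReal.ofReal_le_ofReal ?_).trans (h k hk le_rfl))
  refine le_mul_of_one_le_right (quadrupletWeight_nonneg hk q) ?_
  have := initialPair_fst_nonneg hk q
  have h1 : 0 ≤ (initialPair (k ^ 3) q).1 ^ 5 := by positivity
  have h2 : 0 ≤ (initialPair (k ^ 3) q).1⁻¹ := by positivity
  linarith

theorem isProbabilityMeasure_initialLaw {l : ℝ} (hl : 0 < l) :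
    IsProbabilityMeasure (initialLaw l) := by
  obtain ⟨k, hk, rfl⟩ := exists_cube hl
  have : IsProbabilityMeasure (quadrupletLaw (k ^ 3)) := by
    refine ⟨?_⟩
    rw [quadrupletLaw, Measure.smul_apply, withDensity_apply _ MeasurableSet.univ,
      Measure.restrict_univ, smul_eq_mul,
      ENNReal.inv_mul_cancel (normalization_ne_zero hk) (normalization_ne_top hk)]
  exact Measure.isProbabilityMeasure_map (measurable_initialPair hk).aemeasurable

theorem ae_initialLaw {l : ℝ} (hl : 0 < l) : ∀ᵐ x ∂initialLaw l, 0 < x.1 ∧ 1 ≤ x.2 := by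
  obtain ⟨k, hk, rfl⟩ := exists_cube hl
  have hm : MeasurableSet {x : ℝ × ℝ | 0 < x.1 ∧ 1 ≤ x.2} :=
    measurableSet_and (measurableSet_lt (by fun_prop) (by fun_prop))
      (measurableSet_le (by fun_prop) (by fun_prop))
  rw [initialLaw, ae_map_iff (measurable_initialPair hk).aemeasurable hm, quadrupletLaw]
  refine Measure.ae_smul_measure ?_ _
  rw [ae_withDensity_iff (measurable_quadrupletWeight _).ennreal_ofReal]
  refine ae_of_all _ fun q hq => initialPair_mem hk (mem_support_of_weight_ne_zero hk fun h => ?_)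
  rw [h, ENNReal.ofReal_zero] at hq
  exact hq rfl

/-- Numerator and normalization are both of order `k⁻⁴`, which cancels in the quotient. -/
theorem exists_initialLaw_moment_le : ∃ C : ℝ≥0∞, C ≠ ∞ ∧ ∀ l : ℝ, 1 ≤ l →
    ∫⁻ x, ENNReal.ofReal (1 + x.1 ^ 5 + x.1⁻¹) ∂initialLaw l ≤ C := by
  obtain ⟨c, hc, hlow⟩ := exists_normalization_ge one_pos
  obtain ⟨C, hC, hup⟩ := exists_moment_le one_pos
  refine ⟨c⁻¹ * C, ENNReal.mul_ne_top (ENNReal.inv_ne_top.2 hc) hC, fun l hl => ?_⟩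
  obtain ⟨k, hk, rfl⟩ := exists_cube (zero_lt_one.trans_le hl)
  have hk1 : 1 ≤ k := by
    by_contra h
    exact absurd hl (not_le.2 (pow_lt_one₀ hk.le (not_le.1 h) three_ne_zero))
  have hk4 : (k ^ 4)⁻¹ ≤ 1 := inv_le_one_of_one_le₀ (one_le_pow₀ hk1)
  have hμ : ENNReal.ofReal (k ^ 4)⁻¹ ≠ 0 := (ENNReal.ofReal_pos.2 (by positivity)).ne'
  have hm := measurable_quadrupletWeight (k ^ 3)
  have hp := measurable_initialPair hk
  have hf : Measurable fun q => ENNReal.ofReal (1 + (initialPair (k ^ 3) q).1 ^ 5 +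
      (initialPair (k ^ 3) q).1⁻¹) :=
    (((hp.fst.pow_const 5).const_add 1).add hp.fst.inv).ennreal_ofReal
  rw [initialLaw, lintegral_map (by fun_prop) hp, quadrupletLaw, lintegral_smul_measure,
    lintegral_withDensity_eq_lintegral_mul _ hm.ennreal_ofReal hf]
  have h1 : ∫⁻ q, ((fun q => ENNReal.ofReal (quadrupletWeight (k ^ 3) q)) *
      fun q => ENNReal.ofReal (1 + (initialPair (k ^ 3) q).1 ^ 5 +
        (initialPair (k ^ 3) q).1⁻¹)) q ≤ C * ENNReal.ofReal (k ^ 4)⁻¹ := by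
    refine le_of_eq_of_le (lintegral_congr fun q => ?_) (hup k hk hk4)
    rw [Pi.mul_apply, ENNReal.ofReal_mul (quadrupletWeight_nonneg hk q)]
  rw [smul_eq_mul]
  calc _ ≤ (c * ENNReal.ofReal (k ^ 4)⁻¹)⁻¹ * (C * ENNReal.ofReal (k ^ 4)⁻¹) :=
        mul_le_mul' (ENNReal.inv_le_inv.2 (hlow k hk hk4)) h1
    _ = c⁻¹ * C := by
        rw [ENNReal.mul_inv (Or.inl hc) (Or.inr hμ), mul_mul_mul_comm,
          ENNReal.inv_mul_cancel hμ ENNReal.ofReal_ne_top, mul_one]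

/-! ### The main theorem -/

/-- The critical term is `k⁻⁴ θ ^ (-4 - d) = l ^ (-(4 ε + ε d - d) / 3)`, and `d ≤ ε` makes this
exponent negative. -/
theorem tendsto_errorRate {ε : ℝ} (hε : 0 < ε) {d : ℝ} (hd : 0 < d) (hd1 : d ≤ ε) :
    Tendsto (fun l : ℝ => 164 * ((l ^ (1 / 3 : ℝ))⁻¹ + 4 * ((l ^ (1 / 3 : ℝ)) ^ 4)⁻¹ +
      34 / d * (((l ^ (1 / 3 : ℝ)) ^ 4)⁻¹ * (l ^ ((ε - 1) / 3)) ^ (-4 - d)))) atTop (𝓝 0) := by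
  have h1 : Tendsto (fun l : ℝ => (l ^ (1 / 3 : ℝ))⁻¹) atTop (𝓝 0) :=
    (tendsto_rpow_atTop (by norm_num)).inv_tendsto_atTop
  have h2 := h1.pow 4
  have h3 : Tendsto (fun l : ℝ => l ^ (-((4 * ε + ε * d - d) / 3))) atTop (𝓝 0) :=
    tendsto_rpow_neg_atTop (by nlinarith [mul_pos hε hd])
  have h4 := ((h1.add (h2.const_mul 4)).add (h3.const_mul (34 / d))).const_mul 164
  simp only [ne_eq, OfNat.ofNat_ne_zero, not_false_eq_true, zero_pow, mul_zero, add_zero] at h4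
  refine h4.congr' ?_
  filter_upwards [eventually_gt_atTop 0] with l hl
  have e : ((l ^ (1 / 3 : ℝ)) ^ 4)⁻¹ * (l ^ ((ε - 1) / 3)) ^ (-4 - d) =
      l ^ (-((4 * ε + ε * d - d) / 3)) := by
    rw [← Real.rpow_natCast, ← Real.rpow_mul hl.le, ← Real.rpow_neg hl.le, ← Real.rpow_mul hl.le,
      ← Real.rpow_add hl]
    congr 1
    push_cast
    ring
  rw [e, inv_pow]

theorem IsCoupling.tendsto_couplingEvent {P : ℝ → Measure Path}
    (hP : ∀ l : ℝ, 0 < l → IsCoupling l (P l)) {ε₀ : ℝ} (hε : 0 < ε₀) :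
    Tendsto (fun l : ℝ => P l (couplingEvent l ε₀)) atTop (𝓝 1) := by
  obtain ⟨C, hC, hmom⟩ := exists_initialLaw_moment_le
  -- The choice `d = min ε₀ 1` meets both constraints: `d ≤ ε₀` for the rate and `d ≤ 1` for the
  -- contraction of `b ^ d`.
  have hd : 0 < min ε₀ 1 := lt_min hε one_pos
  have h1 := (ENNReal.Tendsto.mul_const (b := C) (ENNReal.tendsto_ofReal
    (tendsto_errorRate hε hd (min_le_left _ _))) (Or.inr hC))
  rw [ENNReal.ofReal_zero, zero_mul] at h1
  have h2 := ENNReal.Tendsto.sub (tendsto_const_nhds (x := (1 : ℝ≥0∞))) h1 (Or.inl ENNReal.one_ne_top)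
  rw [tsub_zero] at h2
  refine tendsto_of_tendsto_of_tendsto_of_le_of_le' h2 tendsto_const_nhds ?_ ?_
  · filter_upwards [eventually_ge_atTop 1] with l hl
    have hl0 : 0 < l := zero_lt_one.trans_le hl
    have hk : l = (l ^ (1 / 3 : ℝ)) ^ 3 := by
      rw [← Real.rpow_natCast, ← Real.rpow_mul hl0.le]
      norm_num
    rw [tsub_le_iff_right]
    refine ((hP l hl0).one_le_measure_couplingEvent_add (ε₀ := ε₀) (by positivity) hk hd (min_le_right _ _)
      ((ae_initialLaw hl0).mono fun _ h => h.2)).trans ?_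
    exact add_le_add le_rfl (mul_le_mul_right (hmom l hl) _)
  · filter_upwards [eventually_gt_atTop 0] with l hl
    have := (hP l hl).prob
    exact prob_le_one

end VoronoiChain

theorem mainTheorem9 :
    (∀ l : ℝ, 0 < l → ∃ P : Measure VoronoiChain.Path, VoronoiChain.IsCoupling l P) ∧
    (∀ P : ℝ → Measure VoronoiChain.Path,
      (∀ l : ℝ, 0 < l → VoronoiChain.IsCoupling l (P l)) →
      ∀ ε₀ : ℝ, 0 < ε₀ →
        Tendsto (fun l : ℝ => P l (VoronoiChain.couplingEvent l ε₀)) atTop (𝓝 1)) := by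
  exact ⟨fun l hl => VoronoiChain.exists_isCoupling hl
      (VoronoiChain.isProbabilityMeasure_initialLaw hl)
      ((VoronoiChain.ae_initialLaw hl).mono fun _ h => ⟨h.1, zero_lt_one.trans_le h.2⟩),
    fun _ hP _ hε => VoronoiChain.IsCoupling.tendsto_couplingEvent hP hε⟩
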